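/- Let $n\ge 2$, let $F_q$ be a finite field with $q$ elements and characteristic $p$, let $G=\mathrm{GL}_n(q)$, let $B$ and $U$ be its subgroups of upper triangular and upper unitriangular matrices, and let $\ell\neq p$ be a prime. Let $R$ be a local principal ideal domain of characteristic $0$ with maximal ideal $\ell R$ that contains a primitive $p$-th root of unity, and let $K=R/\ell R$. *Steinberg lattice.* For $S\subseteq G$ let $\widehat S=\sum_{s\in S}s\in RG$. Put $\underline e=\sum_{\sigma\in S_n}\mathrm{sg}(\sigma)\,\sigma\widehat B$ (permutations viewed as permutation matrices) and $I=RG\cdot\underline e$. Let $f$ be the restriction to $I$ of the bilinear form on $RG$ with $(g,h)\mapsto\delta_{g,h}$, divided by $|B|$. For $c\ge 0$ put $I(c)=\{x\in I: f(x,I)\subseteq \ell^cR\}$, $L=I/\ell I$, $L(c)=(I(c)+\ell I)/\ell I$ and $M(c)=L(c)/L(c+1)$. *Parabolics.* A composition $(a_1,\dots,a_k)$ of $n$ (positive integers with sum $n$) is identified with the standard parabolic subgroup $P\supseteq B$ of block upper triangular matrices with diagonal blocks of sizes $a_1,\dots,a_k$. Two standard parabolics are equivalent if their compositions are rearrangements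 of each other. *The modules $N(P)$.* For a group homomorphism $\lambda:U\to R^*$ let $J(\lambda)$ be the set of transpositions $(i,i+1)$ such that $\lambda$ is non-trivial on the root subgroup $X_{i,i+1}$, let $P(\lambda)=\langle B,J(\lambda)\rangle$, let $E_\lambda=\sum_{u\in U}\lambda(u)\,u\,\underline e\in I$ and let $F_\lambda=E_\lambda+\ell I\in L$. For a standard parabolic $P$ with $c=\nu_\ell([G:P])$ let $N(P)=KG\cdot(F_\lambda+L(c+1))\subseteq M(c)$ for any $\lambda$ with $P(\lambda)=P$; such $\lambda$ exist, $F_\lambda\in L(c)$, and $N(P)$ does not depend on the choice of $\lambda$. *Digit sums.* Let $e=\min\{i\ge 2: \ell\mid (q^i-1)/(q-1)\}$, $d=\nu_\ell\big((q^e-1)/(q-1)\big)$, and $m=\max\{i\ge 0:\ell^i\le\lfloor n/e\rfloor\}$ (with $m=0$ if $n<e$). For $1\le a\le n$ let $\Delta(a)=(y_{-1},y_0,\dots,y_m)$ be the unique sequence of integers with $0\le y_{-1}<e$, $0\le y_i<\ell$ for $0\le i\le m$, and $a=y_{-1}+e(y_0+y_1\ell+\cdots+y_m\ell^m)$. For $P=(a_1,\dots,a_k)$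 let $\Delta(P)=\Delta(a_1)+\cdots+\Delta(a_k)=(z_{-1},z_0,\dots,z_m)$, and let $P^*$ be the standard parabolic given by the composition with $z_{-1}$ parts equal to $1$, followed by $z_0$ parts equal to $e$, $z_1$ parts equal to $e\ell$, …, $z_m$ parts equal to $e\ell^m$. For $i\ge 0$ let $s_i=\ell^id+\ell^{i-1}+\cdots+\ell+1$ (so $s_0=d$). **Theorem.** For every composition $P=(a_1,\dots,a_k)$ of $n$, the subgroup $P^*$ is equivalent to a standard parabolic subgroup contained in $P$. Moreover $$\nu_\ell([P:B])=s_0z_0+s_1z_1+\cdots+s_mz_m=\nu_\ell([P^*:B]);$$ in particular $\nu_\ell([G:P])=\nu_\ell([G:P^*])=:c$, and $N(P)=N(P^*)$ as submodules of $M(c)$. -/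

import Mathlib

namespace SteinbergGL

open Matrix

/-! ### Arithmetic: the numbers `e`, `d`, `m`, `s_i` and the digit sums -/

/-- `e`: the least `i ≥ 2` such that `ℓ` divides `(q ^ i - 1) / (q - 1)`. -/
noncomputable def eNum (ℓ q : ℕ) : ℕ := sInf {i | 2 ≤ i ∧ ℓ ∣ (q ^ i - 1) / (q - 1)}

/-- `d = ν_ℓ ((q ^ e - 1) / (q - 1))`. -/
noncomputable def dNum (ℓ q : ℕ) : ℕ :=
  padicValNat ℓ ((q ^ eNum ℓ q - 1) / (q - 1))

/-- `m`: the largest `i ≥ 0` with `ℓ ^ i ≤ ⌊n / e⌋` (and `m = 0` when `n < e`). -/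
def mNum (ℓ e n : ℕ) : ℕ := Nat.log ℓ (n / e)

/-- `s_i = ℓ ^ i * d + ℓ ^ (i - 1) + ⋯ + ℓ + 1`. -/
def sNum (ℓ d i : ℕ) : ℕ := ℓ ^ i * d + ∑ j ∈ Finset.range i, ℓ ^ j

/-- `y_i(a)` for `i ≥ 0`: the `i`-th base-`ℓ` digit of `⌊a / e⌋`. -/
def digit (ℓ e a i : ℕ) : ℕ := a / e / ℓ ^ i % ℓ

/-- `z_{-1}(P)`: the sum over the parts `a` of `P` of the remainders `y_{-1}(a) = a % e`. -/
def zRem (e : ℕ) {n : ℕ} (P : Composition n) : ℕ := (P.blocks.map fun a => a % e).sum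

/-- `z_i(P)` for `i ≥ 0`: the sum over the parts `a` of `P` of the digits `y_i(a)`. -/
def zNum (ℓ e : ℕ) {n : ℕ} (P : Composition n) (i : ℕ) : ℕ :=
  (P.blocks.map fun a => digit ℓ e a i).sum

/-- The parts of `P*`: `z_{-1}` ones, followed by `z_i` copies of `e * ℓ ^ i` for `i = 0, …, m`. -/
def starBlocks (ℓ e : ℕ) {n : ℕ} (P : Composition n) : List ℕ :=
  List.replicate (zRem e P) 1 ++
    (List.range (mNum ℓ e n + 1)).flatMap fun i => List.replicate (zNum ℓ e P i) (e * ℓ ^ i)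

theorem sum_digit_mul_pow {ℓ : ℕ} (hℓ : 1 < ℓ) (k N : ℕ) (h : N < ℓ ^ k) :
    ∑ i ∈ Finset.range k, N / ℓ ^ i % ℓ * ℓ ^ i = N := by
  induction k generalizing N with
  | zero => simp at h; simp [h]
  | succ k ih =>
    rw [Finset.sum_range_succ']
    have h1 : N / ℓ < ℓ ^ k := by
      rw [Nat.div_lt_iff_lt_mul (by omega)]
      rwa [pow_succ] at h
    have h2 := ih (N / ℓ) h1
    have h3 : ∑ i ∈ Finset.range k, N / ℓ ^ (i + 1) % ℓ * ℓ ^ (i + 1)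
        = (∑ i ∈ Finset.range k, N / ℓ / ℓ ^ i % ℓ * ℓ ^ i) * ℓ := by
      rw [Finset.sum_mul]
      refine Finset.sum_congr rfl fun i _ => ?_
      rw [Nat.div_div_eq_div_mul, pow_succ, mul_comm ℓ, mul_assoc]
    rw [h3, h2]
    simp only [pow_zero, Nat.div_one, mul_one]
    exact Nat.div_add_mod' N ℓ

theorem sum_digits {ℓ e : ℕ} (hℓ : 1 < ℓ) {a n : ℕ} (ha : a ≤ n) :
    a % e + ∑ i ∈ Finset.range (mNum ℓ e n + 1), digit ℓ e a i * (e * ℓ ^ i) = a := by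
  have h1 : a / e < ℓ ^ (mNum ℓ e n + 1) :=
    (Nat.div_le_div_right ha).trans_lt (Nat.lt_pow_succ_log_self hℓ _)
  have h2 : ∑ i ∈ Finset.range (mNum ℓ e n + 1), digit ℓ e a i * (e * ℓ ^ i)
      = e * ∑ i ∈ Finset.range (mNum ℓ e n + 1), a / e / ℓ ^ i % ℓ * ℓ ^ i := by
    rw [Finset.mul_sum]
    refine Finset.sum_congr rfl fun i _ => ?_
    rw [digit]
    ring
  rw [h2, sum_digit_mul_pow hℓ _ _ h1]
  exact Nat.mod_add_div a e

theorem starBlocks_sum {ℓ e : ℕ} (hℓ : 1 < ℓ) {n : ℕ} (P : Composition n) :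
    (starBlocks ℓ e P).sum = n := by
  have key : ∀ L : List ℕ, (∀ a ∈ L, a ≤ n) →
      (L.map fun a => a % e).sum + ∑ i ∈ Finset.range (mNum ℓ e n + 1),
        (L.map fun a => digit ℓ e a i).sum * (e * ℓ ^ i) = L.sum := by
    intro L
    induction L with
    | nil => simp
    | cons a L ih =>
      intro h
      have h1 := ih fun b hb => h b (List.mem_cons_of_mem _ hb)
      have h2 := sum_digits (e := e) hℓ (h a List.mem_cons_self)
      simp only [List.map_cons, List.sum_cons, add_mul, Finset.sum_add_distrib]
      omega
  have h := key P.blocks fun a ha => P.blocks_le ha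
  have h3 : ∀ (f : ℕ → List ℕ) (k : ℕ),
      ((List.range k).flatMap f).sum = ∑ i ∈ Finset.range k, (f i).sum := by
    intro f k
    induction k with
    | zero => simp
    | succ k ih => simp [List.range_succ, Finset.sum_range_succ, ih]
  rw [P.blocks_sum] at h
  rw [starBlocks, List.sum_append, h3]
  simpa [zRem, zNum] using h

theorem eNum_pos (F : Type*) [Field F] [Fintype F] (p ℓ : ℕ) [Fact p.Prime] [CharP F p]
    [Fact ℓ.Prime] (hpℓ : ℓ ≠ p) : 0 < eNum ℓ (Fintype.card F) := by
  set q := Fintype.card F with hq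
  have hq1 : 1 < q := Fintype.one_lt_card
  have hp : p.Prime := Fact.out
  have hl : ℓ.Prime := Fact.out
  obtain ⟨k, -, hk⟩ := FiniteField.card F p
  have hcop : Nat.Coprime q (ℓ * (q - 1)) := by
    apply Nat.Coprime.mul_right
    · rw [hq, hk]
      exact Nat.Coprime.pow_left _ ((Nat.coprime_primes hp hl).2 hpℓ.symm)
    · have : Nat.Coprime ((q - 1) + 1) (q - 1) := by simp
      rwa [Nat.sub_add_cancel hq1.le] at this
  have hne : ({i | 2 ≤ i ∧ ℓ ∣ (q ^ i - 1) / (q - 1)} : Set ℕ).Nonempty := by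
    set t := Nat.totient (ℓ * (q - 1)) with ht
    have htpos : 0 < t :=
      Nat.totient_pos.2 (Nat.mul_pos hl.pos (by omega))
    refine ⟨t * 2, by omega, ?_⟩
    have h1 : q ^ t ≡ 1 [MOD ℓ * (q - 1)] := Nat.ModEq.pow_totient hcop
    have h2 : q ^ (t * 2) ≡ 1 [MOD ℓ * (q - 1)] := by
      simpa [pow_mul] using h1.pow 2
    have h3 : ℓ * (q - 1) ∣ q ^ (t * 2) - 1 :=
      (Nat.modEq_iff_dvd' (Nat.one_le_pow _ _ (by omega))).1 h2.symm
    exact Nat.dvd_div_of_mul_dvd (by rwa [mul_comm])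
  have := Nat.sInf_mem hne
  exact lt_of_lt_of_le (by norm_num) this.1

/-- `P*`, as a composition of `n`, for `G = GL_n(F)` and the prime `ℓ ≠ char F`. -/
noncomputable def starComp (F : Type*) [Field F] [Fintype F] (p ℓ : ℕ) [Fact p.Prime] [CharP F p]
    [Fact ℓ.Prime] (hpℓ : ℓ ≠ p) {n : ℕ} (P : Composition n) : Composition n where
  blocks := starBlocks ℓ (eNum ℓ (Fintype.card F)) P
  blocks_pos := by
    intro i hi
    have he := eNum_pos F p ℓ hpℓ
    have hl : 0 < ℓ := (Fact.out : ℓ.Prime).pos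
    simp only [starBlocks, List.mem_append, List.mem_replicate, List.mem_flatMap] at hi
    rcases hi with ⟨-, rfl⟩ | ⟨j, -, -, rfl⟩
    · exact one_pos
    · positivity
  blocks_sum := starBlocks_sum (Fact.out : ℓ.Prime).one_lt P

/-! ### Subgroups of `GL_n(F)` -/

section Subgroups

variable (n : ℕ) (F : Type*) [Field F]

/-- Invertible matrices that are block upper triangular with respect to `b`. -/
def blockSubgroup {α : Type*} [LinearOrder α] {n : ℕ} (F : Type*) [Field F] (b : Fin n → α) :
    Subgroup (GL (Fin n) F) where
  carrier := {g | (g : Matrix (Fin n) (Fin n) F).BlockTriangular b}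
  mul_mem' := by
    intro g h hg hh
    simpa using BlockTriangular.mul (M := (g : Matrix (Fin n) (Fin n) F)) hg hh
  one_mem' := by
    simpa using (blockTriangular_one : BlockTriangular (1 : Matrix (Fin n) (Fin n) F) b)
  inv_mem' := by
    intro g hg
    have : Invertible (g : Matrix (Fin n) (Fin n) F) := g.invertible
    have := blockTriangular_inv_of_blockTriangular
      (M := (g : Matrix (Fin n) (Fin n) F)) (b := b) hg
    simpa [Matrix.coe_units_inv] using this

/-- `B`: the upper triangular subgroup. -/
def borelB : Subgroup (GL (Fin n) F) := blockSubgroup F (id : Fin n → Fin n)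

/-- `P_(a_1, …, a_k)`: the block upper triangular subgroup with diagonal blocks of sizes
`a_1, …, a_k` in this order. -/
def parabolic {n : ℕ} (P : Composition n) : Subgroup (GL (Fin n) F) := blockSubgroup F P.index

/-- Upper triangular matrices with all diagonal entries equal to `1`. -/
def IsUpperUnitri {n : ℕ} {F : Type*} [Field F] (M : Matrix (Fin n) (Fin n) F) : Prop :=
  M.BlockTriangular id ∧ ∀ i, M i i = 1

theorem mul_diag_of_triangular {n : ℕ} {F : Type*} [Field F] {M N : Matrix (Fin n) (Fin n) F}
    (hM : M.BlockTriangular id) (hN : N.BlockTriangular id) (i : Fin n) :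
    (M * N) i i = M i i * N i i := by
  rw [Matrix.mul_apply]
  refine Finset.sum_eq_single i (fun j _ hj => ?_) (by simp)
  rcases lt_or_gt_of_ne hj with h | h
  · rw [hM (show id j < id i from h), zero_mul]
  · rw [hN (show id i < id j from h), mul_zero]

/-- `U`: the upper unitriangular subgroup. -/
def unitri : Subgroup (GL (Fin n) F) where
  carrier := {g | IsUpperUnitri (g : Matrix (Fin n) (Fin n) F)}
  mul_mem' := by
    intro g h hg hh
    refine ⟨(borelB n F).mul_mem (x := g) (y := h) hg.1 hh.1, fun i => ?_⟩
    rw [Units.val_mul, mul_diag_of_triangular hg.1 hh.1, hg.2, hh.2, one_mul]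
  one_mem' := ⟨(borelB n F).one_mem, fun i => by simp⟩
  inv_mem' := by
    intro g hg
    have h1 : ((g⁻¹ : GL (Fin n) F) : Matrix (Fin n) (Fin n) F).BlockTriangular id :=
      (borelB n F).inv_mem (x := g) hg.1
    refine ⟨h1, fun i => ?_⟩
    have h2 := mul_diag_of_triangular hg.1 h1 i
    rw [← Units.val_mul, mul_inv_cancel, hg.2, one_mul] at h2
    simpa using h2.symm

/-- The permutation matrix of `σ`, with `σ e_i = e_{σ i}` on column vectors. -/
def permGL {n : ℕ} (F : Type*) [Field F] (σ : Equiv.Perm (Fin n)) : GL (Fin n) F :=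
  ⟨(σ⁻¹).permMatrix F, σ.permMatrix F,
    by rw [← permMatrix_mul, mul_inv_cancel, permMatrix_one],
    by rw [← permMatrix_mul, inv_mul_cancel, permMatrix_one]⟩

theorem permGL_mulVec_single {n : ℕ} (F : Type*) [Field F] (σ : Equiv.Perm (Fin n)) (i : Fin n) :
    (permGL F σ : Matrix (Fin n) (Fin n) F) *ᵥ Pi.single i 1 = Pi.single (σ i) 1 := by
  ext j
  simp [permGL, PEquiv.toMatrix_apply, Pi.single_apply, Equiv.symm_apply_eq]

end Subgroups

section Characters

variable {n : ℕ} {F : Type*} [Field F] {R : Type*} [CommRing R]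

/-- `J(χ)`: the transpositions `(i, i + 1)` for which the linear character `χ` of `U` is non-trivial
on the root subgroup `X_{i,i+1} = {1 + a E^{i,i+1} | a ∈ F}`. -/
def charJ (χ : unitri n F →* Rˣ) : Set (Equiv.Perm (Fin n)) :=
  {s | ∃ i j : Fin n, (i : ℕ) + 1 = j ∧ s = Equiv.swap i j ∧
    ∃ u : unitri n F, (∃ a : F, ((u : GL (Fin n) F) : Matrix (Fin n) (Fin n) F)
      = transvection i j a) ∧ χ u ≠ 1}

/-- `P(χ) = ⟨B, J(χ)⟩`. -/
def charP (χ : unitri n F →* Rˣ) : Subgroup (GL (Fin n) F) :=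
  Subgroup.closure ((borelB n F : Set (GL (Fin n) F)) ∪ permGL F '' charJ χ)

end Characters

/-! ### The Steinberg lattice, its filtration, its reduction, and the modules `N(P)`

`RG`-submodules of `L` (and of its quotients) are the same as `KG`-submodules, where `K = R / ℓ R`,
because `ℓ` annihilates `L` and `RG → KG` is surjective. -/

section Lattice

variable (n : ℕ) (F : Type*) [Field F] [Fintype F] (R : Type*) [CommRing R]

/-- The group algebra `RG` of `G = GL_n(F)`. -/
abbrev RG : Type _ := MonoidAlgebra R (GL (Fin n) F)

open Classical in
/-- `∑_{σ ∈ S_n} sg(σ) σ B̂`, where `B̂` is the sum of the elements of `B`. -/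
noncomputable def steinbergElt : RG n F R :=
  ∑ σ : Equiv.Perm (Fin n), ((Equiv.Perm.sign σ : ℤ) : RG n F R) *
    (MonoidAlgebra.single (permGL F σ) 1 *
      ∑ b : borelB n F, MonoidAlgebra.single (b : GL (Fin n) F) 1)

/-- `I`: the left ideal of `RG` generated by `steinbergElt`, i.e. the Steinberg lattice. -/
noncomputable def latI : Submodule (RG n F R) (RG n F R) :=
  Submodule.span (RG n F R) {steinbergElt n F R}

variable {n F R}

open Classical in
/-- The canonical symmetric bilinear form on `RG`, for which `G` is an orthonormal basis. -/
noncomputable def canForm (x y : RG n F R) : R := ∑ g : GL (Fin n) F, x.coeff g * y.coeff g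

theorem canForm_add (x x' y : RG n F R) : canForm (x + x') y = canForm x y + canForm x' y := by
  simp [canForm, add_mul, Finset.sum_add_distrib]

theorem canForm_single_mul (g : GL (Fin n) F) (r : R) (x y : RG n F R) :
    canForm (MonoidAlgebra.single g r * x) y = r * canForm x (MonoidAlgebra.single g⁻¹ 1 * y) := by
  classical
  unfold canForm
  rw [Finset.mul_sum]
  refine Fintype.sum_equiv (Equiv.mulLeft g⁻¹) _ _ fun h => ?_
  simp [mul_assoc]

variable (n F R)

/-- `I(c) = {x ∈ I | f(x, I) ⊆ ℓ^c R}` where `f = canForm / |B|`; the condition `f(x, y) ∈ ℓ^c R` is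
written without denominators. -/
noncomputable def latIc (ℓ c : ℕ) : Submodule (RG n F R) (RG n F R) where
  carrier := {x | x ∈ latI n F R ∧
    ∀ y ∈ latI n F R, (Nat.card (borelB n F) : R) * (ℓ : R) ^ c ∣ canForm x y}
  add_mem' := by
    rintro x x' ⟨hx, hx'⟩ ⟨hy, hy'⟩
    refine ⟨add_mem hx hy, fun y h => ?_⟩
    rw [canForm_add]
    exact dvd_add (hx' y h) (hy' y h)
  zero_mem' := ⟨zero_mem _, fun y _ => by simp [canForm]⟩
  smul_mem' := by
    rintro a x ⟨hx, hx'⟩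
    refine ⟨Submodule.smul_mem _ _ hx, fun y h => ?_⟩
    rw [smul_eq_mul]
    induction a using MonoidAlgebra.induction_linear with
    | zero => simp [canForm]
    | add a b ha hb =>
      rw [add_mul, canForm_add]
      exact dvd_add ha hb
    | single g r =>
      rw [canForm_single_mul]
      exact Dvd.dvd.mul_left (hx' _ (Submodule.smul_mem _ _ h)) r

/-- `ℓ I`, as a submodule of `I`. -/
noncomputable def ellI (ℓ : ℕ) : Submodule (RG n F R) (latI n F R) :=
  LinearMap.range (ℓ • (LinearMap.id : latI n F R →ₗ[RG n F R] latI n F R))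

/-- `L = I / ℓ I`. -/
abbrev redL (ℓ : ℕ) : Type _ := latI n F R ⧸ ellI n F R ℓ

/-- `(S + ℓ I) / ℓ I ⊆ L` for a submodule `S ⊆ I`. -/
noncomputable def reduce (ℓ : ℕ) (S : Submodule (RG n F R) (RG n F R)) :
    Submodule (RG n F R) (redL n F R ℓ) :=
  (S.submoduleOf (latI n F R)).map (ellI n F R ℓ).mkQ

/-- `L(c) = (I(c) + ℓ I) / ℓ I`. -/
noncomputable def redLc (ℓ c : ℕ) : Submodule (RG n F R) (redL n F R ℓ) :=
  reduce n F R ℓ (latIc n F R ℓ c)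

/-- `M(c) = L(c) / L(c + 1)`, as a submodule of `L / L(c + 1)`. -/
noncomputable def facM (ℓ c : ℕ) :
    Submodule (RG n F R) (redL n F R ℓ ⧸ redLc n F R ℓ (c + 1)) :=
  (redLc n F R ℓ c).map (redLc n F R ℓ (c + 1)).mkQ

variable {n F R}

open Classical in
/-- `E_χ = ∑_{u ∈ U} χ(u) u ê`, where `ê` is `steinbergElt`. -/
noncomputable def charE (χ : unitri n F →* Rˣ) : RG n F R :=
  ∑ u : unitri n F, MonoidAlgebra.single (u : GL (Fin n) F) (χ u : R) * steinbergElt n F R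

theorem charE_mem (χ : unitri n F →* Rˣ) : charE χ ∈ latI n F R :=
  Submodule.sum_mem _ fun _ _ => Submodule.smul_mem _ _ (Submodule.subset_span rfl)

/-- `F_χ = E_χ + ℓ I ∈ L`. -/
noncomputable def charF (ℓ : ℕ) (χ : unitri n F →* Rˣ) : redL n F R ℓ :=
  (ellI n F R ℓ).mkQ ⟨charE χ, charE_mem χ⟩

/-- `N(χ)`: the submodule generated by `F_χ + L(c + 1)`, where `c = ν_ℓ [G : P(χ)]`. -/
noncomputable def charN (ℓ c : ℕ) (χ : unitri n F →* Rˣ) :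
    Submodule (RG n F R) (redL n F R ℓ ⧸ redLc n F R ℓ (c + 1)) :=
  Submodule.span (RG n F R) {(redLc n F R ℓ (c + 1)).mkQ (charF ℓ χ)}

variable (F R)

/-- `I'(P)`: the submodule generated by the `E_χ` with `P(χ) = P`. (Each one of these elements
generates the same submodule, since they are conjugate under the diagonal subgroup.) -/
noncomputable def latI' (P : Composition n) : Submodule (RG n F R) (RG n F R) :=
  Submodule.span (RG n F R) {x | ∃ χ : unitri n F →* Rˣ, charP χ = parabolic F P ∧ x = charE χ}

/-- `L'(P) = (I'(P) + ℓ I) / ℓ I`. -/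
noncomputable def redL' (ℓ : ℕ) (P : Composition n) : Submodule (RG n F R) (redL n F R ℓ) :=
  reduce n F R ℓ (latI' F R P)

/-- `N(P) = (L'(P) + L(c + 1)) / L(c + 1)`, where `c = ν_ℓ [G : P]`. -/
noncomputable def facN (ℓ c : ℕ) (P : Composition n) :
    Submodule (RG n F R) (redL n F R ℓ ⧸ redLc n F R ℓ (c + 1)) :=
  (redL' F R ℓ P).map (redLc n F R ℓ (c + 1)).mkQ

end Lattice

end SteinbergGL

open SteinbergGL

namespace SteinbergGL

open Matrix

/-! ### Permutations and blocks -/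

/-! Fix a non-trivial additive character ψ of F with values in R. Every linear character of U has
the form χ(u) = ψ(∑ c_i u_{i,i+1}) (`eq_supChar`), and P(χ) depends only on the support of c. Write
ê for `steinbergElt`. The eigenvectors E_χ are compared inside the lattice I itself: the submodules
I'(P) and I'(P*) generated by them coincide, and N(P) = N(P*) is the image of this equality.

Three facts about I carry the argument. Multiplicity one: the U-translates of ê span I over R
(`mem_spanU_of_mem_latI`), so the projection attached to χ maps I into R·E_χ, and comparing
eigenvectors amounts to computing scalars. Form values: f(E_χ, ê) = [G : P(χ)], since both sides are
sums over the Bruhat decomposition (`canForm_supChar`, `index_blockSubgroup`). Descent: if the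
blocks of χ' arise from those of χ by splitting a block or exchanging two neighbours, then E_χ' lies
in RG·E_χ. Indeed, for a suitable permutation π the projection of π⁻¹E_χ is κE_χ', and a single
coefficient shows that κ divides a power of q, which is a unit because ℓ ≠ p
(`charE_mem_span_of_perm`, `below_of_shift`).

Such an inclusion can be reversed when the two indices have the same ℓ-part (`charE_mem_span_symm`):
the adjoint of an element a with aE_χ = E_χ' carries the inverse eigenvector of χ' to a vector whose
projection to the inverse of χ has a coefficient that the form values identify as a unit.

The rest is arithmetic. ν_ℓ[P : B] is the sum over the parts a of ν_ℓ([1]_q⋯[a]_q). By lifting the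
exponent and Legendre's formula this is linear in the digits of a, a part eℓ^i contributing s_i.
Splitting every part into its digit parts therefore preserves the valuation, and a rearrangement of
the result is P*. -/

theorem perm_apply_eq_of_le {ι α : Type*} [Finite ι] [PartialOrder α] {b : ι → α}
    {π : Equiv.Perm ι} (h : ∀ x, b x ≤ b (π x)) (x : ι) : b (π x) = b x := by
  have h1 : ∀ (k : ℕ) (y : ι), b y ≤ b ((π ^ k) y) := by
    intro k
    induction k with
    | zero => simp
    | succ k ih =>
      intro y
      rw [pow_succ, Equiv.Perm.mul_apply]
      exact (h y).trans (ih _)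
  refine le_antisymm ?_ (h x)
  -- Following the cycle of x from π x leads back to x after `orderOf π - 1` more steps, so b cannot
  -- have increased.
  have h2 := h1 (orderOf π - 1) (π x)
  rwa [← Equiv.Perm.mul_apply, ← pow_succ, Nat.sub_add_cancel (orderOf_pos π), pow_orderOf_eq_one,
    Equiv.Perm.one_apply] at h2

/-- A measure of how well sorted a permutation is. -/
def permWeight {n : ℕ} (ρ : Equiv.Perm (Fin n)) : ℕ := ∑ k : Fin n, (k : ℕ) * (ρ k : ℕ)

/-- The rearrangement inequality for one transposition. It makes `permWeight` a measure for sorting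
arguments. -/
theorem permWeight_lt {n : ℕ} (ρ : Equiv.Perm (Fin n)) {i j : Fin n} (hij : i < j)
    (h : ρ j < ρ i) : permWeight ρ < permWeight (ρ * Equiv.swap i j) := by
  have hne : i ≠ j := hij.ne
  have key : ∀ τ : Equiv.Perm (Fin n), permWeight τ
      = (i : ℕ) * τ i + ((j : ℕ) * τ j + ∑ k ∈ (Finset.univ.erase i).erase j, (k : ℕ) * (τ k : ℕ)) := by
    intro τ
    rw [permWeight, Finset.add_sum_erase _ (fun k : Fin n => (k : ℕ) * (τ k : ℕ)) (by simp [hne.symm]),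
      Finset.add_sum_erase _ (fun k : Fin n => (k : ℕ) * (τ k : ℕ)) (Finset.mem_univ i)]
  rw [key ρ, key (ρ * Equiv.swap i j)]
  have h1 : ∑ k ∈ (Finset.univ.erase i).erase j, (k : ℕ) * (ρ * Equiv.swap i j) k
      = ∑ k ∈ (Finset.univ.erase i).erase j, (k : ℕ) * ρ k := by
    refine Finset.sum_congr rfl fun k hk => ?_
    simp only [Finset.mem_erase, Finset.mem_univ, and_true] at hk
    rw [Equiv.Perm.mul_apply, Equiv.swap_apply_of_ne_of_ne hk.2 hk.1]
  rw [h1]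
  simp only [Equiv.Perm.mul_apply, Equiv.swap_apply_left, Equiv.swap_apply_right]
  have h2 : (i : ℕ) < j := hij
  have h3 : (ρ j : ℕ) < ρ i := h
  obtain ⟨a, ha⟩ := Nat.exists_eq_add_of_lt h2
  obtain ⟨c, hc⟩ := Nat.exists_eq_add_of_lt h3
  rw [ha, hc]
  nlinarith

/-- Choose δ with `permWeight (ρ * δ)` maximal: an inversion of ρδ inside a block could be undone by
a swap that raises the weight. This yields minimal length coset representatives. -/
theorem exists_sorted_mul {n : ℕ} {α : Type*} (b : Fin n → α) (ρ : Equiv.Perm (Fin n)) :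
    ∃ δ : Equiv.Perm (Fin n), (∀ i, b (δ i) = b i) ∧
      ∀ i j, i < j → b i = b j → ρ (δ i) < ρ (δ j) := by
  let S := {δ : Equiv.Perm (Fin n) // ∀ i, b (δ i) = b i}
  have : Nonempty S := ⟨⟨1, fun i => rfl⟩⟩
  obtain ⟨⟨δ, hδ⟩, hmax⟩ := Finite.exists_max fun δ : S => permWeight (ρ * δ.1)
  refine ⟨δ, hδ, fun i j hij hb => ?_⟩
  by_contra hcon
  have hlt : (ρ * δ) j < (ρ * δ) i := by
    refine lt_of_le_of_ne (not_lt.1 hcon) fun h => hij.ne' ?_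
    exact (ρ * δ).injective h
  have h1 := permWeight_lt (ρ * δ) hij hlt
  have h2 := hmax ⟨δ * Equiv.swap i j, fun k => by
    rw [Equiv.Perm.mul_apply, hδ]
    rcases eq_or_ne k i with rfl | hki
    · simp [hb]
    rcases eq_or_ne k j with rfl | hkj
    · simp [hb]
    rw [Equiv.swap_apply_of_ne_of_ne hki hkj]⟩
  rw [mul_assoc] at h1
  exact absurd h2 (not_le.2 h1)

/-- The transpositions `(i, i + 1)` contained in a block of `b`. -/
def blockSwaps {n : ℕ} {α : Type*} (b : Fin n → α) : Set (Equiv.Perm (Fin n)) :=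
  {s | ∃ i j : Fin n, (i : ℕ) + 1 = j ∧ b i = b j ∧ s = Equiv.swap i j}

theorem eq_one_of_adjacent_lt {n : ℕ} {ρ : Equiv.Perm (Fin n)}
    (h : ∀ i j : Fin n, (i : ℕ) + 1 = j → ρ i < ρ j) : ρ = 1 := by
  have hmono : StrictMono ρ := by
    have : ∀ d : ℕ, ∀ i j : Fin n, (i : ℕ) + d + 1 = j → ρ i < ρ j := by
      intro d
      induction d with
      | zero => intro i j hij; exact h i j (by omega)
      | succ d ih =>
        intro i j hij
        have hk : (i : ℕ) + d + 1 < n := by omega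
        exact (ih i ⟨_, hk⟩ rfl).trans (h ⟨_, hk⟩ j (by simp; omega))
    intro i j hij
    have hij' : (i : ℕ) < j := hij
    exact this (j - i - 1) i j (by omega)
  ext i
  have := (hmono.range_inj (strictMono_id (α := Fin n))).1 (by simp [ρ.surjective.range_eq])
  rw [this]; rfl

/-- Bubble sort: as b is monotone and ρ preserves it, an adjacent descent of ρ can only occur inside
a block, so every swap used is a generator. -/
theorem mem_closure_blockSwaps {n : ℕ} {α : Type*} [LinearOrder α] {b : Fin n → α}
    (hb : Monotone b) (ρ : Equiv.Perm (Fin n)) (hρ : ∀ i, b (ρ i) = b i) :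
    ρ ∈ Subgroup.closure (blockSwaps b) := by
  obtain ⟨N, hN⟩ : ∃ N, ∀ τ : Equiv.Perm (Fin n), permWeight τ ≤ N := by
    obtain ⟨τ, hτ⟩ := Finite.exists_max fun τ : Equiv.Perm (Fin n) => permWeight τ
    exact ⟨_, hτ⟩
  induction hm : N - permWeight ρ using Nat.strong_induction_on generalizing ρ with
  | _ m ih =>
    by_cases hs : ∀ i j : Fin n, (i : ℕ) + 1 = j → ρ i < ρ j
    · rw [eq_one_of_adjacent_lt hs]; exact one_mem _
    push Not at hs
    obtain ⟨i, j, hij, hle⟩ := hs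
    have hij' : i < j := by rw [Fin.lt_def]; omega
    have hlt : ρ j < ρ i := lt_of_le_of_ne hle fun h => hij'.ne' (ρ.injective h)
    have hbij : b i = b j := by
      refine le_antisymm (hb hij'.le) ?_
      rw [← hρ j, ← hρ i]
      exact hb hle
    have hw := permWeight_lt ρ hij' hlt
    have hN1 := hN (ρ * Equiv.swap i j)
    have hmem : Equiv.swap i j ∈ Subgroup.closure (blockSwaps b) :=
      Subgroup.subset_closure ⟨i, j, hij, hbij, rfl⟩
    have h1 := ih (N - permWeight (ρ * Equiv.swap i j)) (by omega) (ρ * Equiv.swap i j) (fun k => by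
      rw [Equiv.Perm.mul_apply, hρ]
      rcases eq_or_ne k i with rfl | hki
      · simp [hbij]
      rcases eq_or_ne k j with rfl | hkj
      · simp [hbij]
      rw [Equiv.swap_apply_of_ne_of_ne hki hkj]) rfl
    have h2 := mul_mem h1 hmem
    rwa [mul_assoc, Equiv.swap_mul_self, mul_one] at h2

/-! ### Permutation matrices and block triangular matrices -/

section PermGL

variable {n : ℕ} {F : Type*} [Field F]

theorem permGL_apply (σ : Equiv.Perm (Fin n)) (i j : Fin n) :
    (permGL F σ : Matrix (Fin n) (Fin n) F) i j = if i = σ j then 1 else 0 := by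
  have : (σ⁻¹ i = j) ↔ i = σ j := by rw [Equiv.Perm.inv_eq_iff_eq, eq_comm]
  simp only [permGL, Equiv.Perm.permMatrix, PEquiv.toMatrix_apply, Equiv.toPEquiv_apply,
    Option.mem_def, Option.some_inj, this]

theorem permGL_mul (σ τ : Equiv.Perm (Fin n)) : permGL F (σ * τ) = permGL F σ * permGL F τ := by
  ext i j
  rw [Units.val_mul, Matrix.mul_apply]
  rw [Finset.sum_eq_single (τ j)]
  · rw [permGL_apply, permGL_apply, permGL_apply, if_pos rfl, mul_one, Equiv.Perm.mul_apply]
  · intro k _ hk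
    rw [permGL_apply τ, if_neg hk, mul_zero]
  · simp

theorem permGL_one : permGL F (1 : Equiv.Perm (Fin n)) = 1 := by
  ext i j
  rw [permGL_apply, Units.val_one, Matrix.one_apply, Equiv.Perm.one_apply]

theorem permGL_inv (σ : Equiv.Perm (Fin n)) : permGL F σ⁻¹ = (permGL F σ)⁻¹ := by
  rw [eq_inv_iff_mul_eq_one, ← permGL_mul, inv_mul_cancel, permGL_one]

/-- `permGL` as a homomorphism. -/
def permGLHom (n : ℕ) (F : Type*) [Field F] : Equiv.Perm (Fin n) →* GL (Fin n) F where
  toFun := permGL F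
  map_one' := permGL_one
  map_mul' := permGL_mul

theorem mul_permGL_apply (g : GL (Fin n) F) (τ : Equiv.Perm (Fin n)) (i j : Fin n) :
    ((g * permGL F τ : GL (Fin n) F) : Matrix (Fin n) (Fin n) F) i j = g i (τ j) := by
  rw [Units.val_mul, Matrix.mul_apply]
  simp [permGL_apply]

theorem permGL_mul_apply (g : GL (Fin n) F) (σ : Equiv.Perm (Fin n)) (i j : Fin n) :
    ((permGL F σ * g : GL (Fin n) F) : Matrix (Fin n) (Fin n) F) i j = g (σ⁻¹ i) j := by
  rw [Units.val_mul, Matrix.mul_apply]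
  rw [Finset.sum_eq_single (σ⁻¹ i)]
  · simp [permGL_apply]
  · intro k _ hk
    rw [permGL_apply, if_neg, zero_mul]
    rintro rfl
    simp at hk
  · simp

theorem permGL_inv_mul_mul_apply (g : GL (Fin n) F) (σ τ : Equiv.Perm (Fin n)) (i j : Fin n) :
    (((permGL F σ)⁻¹ * g * permGL F τ : GL (Fin n) F) : Matrix (Fin n) (Fin n) F) i j
      = g (σ i) (τ j) := by
  rw [mul_permGL_apply, ← permGL_inv, permGL_mul_apply, inv_inv]

theorem permGL_conj_apply (g : GL (Fin n) F) (σ : Equiv.Perm (Fin n)) (i j : Fin n) :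
    ((permGL F σ * g * (permGL F σ)⁻¹ : GL (Fin n) F) : Matrix (Fin n) (Fin n) F) i j
      = g (σ⁻¹ i) (σ⁻¹ j) := by
  rw [← permGL_inv, mul_permGL_apply, permGL_mul_apply]

theorem mem_blockSubgroup {α : Type*} [LinearOrder α] {b : Fin n → α} {g : GL (Fin n) F} :
    g ∈ blockSubgroup F b ↔ ∀ i j, b j < b i → g i j = 0 := Iff.rfl

theorem mem_borelB {g : GL (Fin n) F} : g ∈ borelB n F ↔ ∀ i j, j < i → g i j = 0 := Iff.rfl

theorem mem_unitri {g : GL (Fin n) F} :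
    g ∈ unitri n F ↔ (∀ i j, j < i → g i j = 0) ∧ ∀ i, g i i = 1 := Iff.rfl

theorem unitri_le_borelB : unitri n F ≤ borelB n F := fun _ hg => hg.1

theorem borelB_le_blockSubgroup {α : Type*} [LinearOrder α] {b : Fin n → α} (hb : Monotone b) :
    borelB n F ≤ blockSubgroup F b :=
  fun _ hg i j hij => hg (show j < i from by
    by_contra h
    exact absurd (hb (not_lt.1 h)) (not_le.2 hij))

theorem borelB_apply_self_ne_zero {g : GL (Fin n) F} (hg : g ∈ borelB n F) (i : Fin n) :
    g i i ≠ 0 := by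
  intro h
  have h1 := mul_diag_of_triangular (M := (g : Matrix (Fin n) (Fin n) F))
    (N := ((g⁻¹ : GL (Fin n) F) : Matrix (Fin n) (Fin n) F)) hg ((borelB n F).inv_mem hg) i
  rw [← Units.val_mul, mul_inv_cancel, h, zero_mul] at h1
  simp at h1

/-- Triangularity only gives an inequality between block numbers. On a finite set a permutation
satisfying it must preserve the blocks. -/
theorem permGL_mem_blockSubgroup {α : Type*} [LinearOrder α] {b : Fin n → α}
    {ρ : Equiv.Perm (Fin n)} : permGL F ρ ∈ blockSubgroup F b ↔ ∀ i, b (ρ i) = b i := by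
  rw [mem_blockSubgroup]
  constructor
  · intro h
    have h1 : ∀ x, b x ≤ b (ρ⁻¹ x) := by
      intro x
      by_contra hlt
      have h2 := h x (ρ⁻¹ x) (not_le.1 hlt)
      rw [permGL_apply] at h2
      simp at h2
    intro i
    have h2 := perm_apply_eq_of_le h1 (ρ i)
    simpa using h2.symm
  · intro h i j hij
    rw [permGL_apply, if_neg]
    rintro rfl
    rw [h] at hij
    exact lt_irrefl _ hij

/-- Disjointness in the Bruhat decomposition. -/
theorem block_eq_of_double_coset {α : Type*} [LinearOrder α] {b : Fin n → α}
    {σ τ : Equiv.Perm (Fin n)} {u : GL (Fin n) F} (hu : u ∈ borelB n F)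
    (h : (permGL F σ)⁻¹ * u * permGL F τ ∈ blockSubgroup F b) (k : Fin n) :
    b (τ⁻¹ k) = b (σ⁻¹ k) := by
  -- The entry of the conjugated matrix at (σ⁻¹ k, τ⁻¹ k) is the diagonal entry u k k, which is
  -- non-zero.
  have h1 : ∀ k, b (σ⁻¹ k) ≤ b (τ⁻¹ k) := by
    intro k
    by_contra hlt
    have h2 := mem_blockSubgroup.1 h (σ⁻¹ k) (τ⁻¹ k) (not_le.1 hlt)
    rw [permGL_inv_mul_mul_apply] at h2
    rw [← Equiv.Perm.mul_apply, ← Equiv.Perm.mul_apply, mul_inv_cancel, mul_inv_cancel] at h2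
    exact borelB_apply_self_ne_zero hu k h2
  have h2 : ∀ x, b x ≤ b ((τ⁻¹ * σ) x) := by
    intro x
    simpa using h1 (σ x)
  simpa using perm_apply_eq_of_le h2 (σ⁻¹ k)

theorem perm_eq_of_double_coset {σ τ : Equiv.Perm (Fin n)} {u : GL (Fin n) F}
    (hu : u ∈ borelB n F) (h : (permGL F σ)⁻¹ * u * permGL F τ ∈ borelB n F) : σ = τ := by
  have h1 : τ⁻¹ = σ⁻¹ := Equiv.ext fun k => block_eq_of_double_coset (b := id) hu h k
  simpa using h1.symm

end PermGL

/-! ### The unitriangular group and the Bruhat decomposition -/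

section Unitri

variable {n : ℕ} {F : Type*} [Field F]

theorem IsUpperUnitri.det {M : Matrix (Fin n) (Fin n) F} (hM : IsUpperUnitri M) : M.det = 1 := by
  rw [det_of_isUpperTriangular hM.1]
  simp [hM.2]

/-- An upper unitriangular matrix, as an element of `U`. -/
noncomputable def unitriMk (M : Matrix (Fin n) (Fin n) F) (hM : IsUpperUnitri M) : unitri n F :=
  ⟨GeneralLinearGroup.mkOfDetNeZero M (by rw [hM.det]; exact one_ne_zero), hM⟩

theorem unitriMk_coe (M : Matrix (Fin n) (Fin n) F) (hM : IsUpperUnitri M) :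
    ((unitriMk M hM : GL (Fin n) F) : Matrix (Fin n) (Fin n) F) = M := rfl

theorem unitri_ext {u v : unitri n F}
    (h : ∀ i j, i < j → ((u : GL (Fin n) F) : Matrix (Fin n) (Fin n) F) i j
      = ((v : GL (Fin n) F) : Matrix (Fin n) (Fin n) F) i j) : u = v := by
  apply Subtype.ext
  ext i j
  rcases lt_trichotomy i j with hij | rfl | hij
  · exact h i j hij
  · rw [u.2.2, v.2.2]
  · rw [(mem_unitri.1 u.2).1 i j hij, (mem_unitri.1 v.2).1 i j hij]

theorem isUpperUnitri_transvection {i j : Fin n} (hij : i < j) (a : F) :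
    IsUpperUnitri (transvection i j a) := by
  refine ⟨fun k l hkl => ?_, fun k => ?_⟩
  · have hkl' : l < k := hkl
    have h1 : ¬ (i = k ∧ j = l) := by rintro ⟨rfl, rfl⟩; exact absurd hij hkl'.le.not_gt
    simp [transvection, h1, one_apply, hkl'.ne']
  · have h1 : ¬ (i = k ∧ j = k) := by rintro ⟨rfl, h⟩; exact hij.ne h.symm
    simp [transvection, h1]

/-- The root element `1 + a E^{i,j}`. -/
noncomputable def rootElt {i j : Fin n} (hij : i < j) (a : F) : unitri n F :=
  unitriMk _ (isUpperUnitri_transvection hij a)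

theorem rootElt_coe {i j : Fin n} (hij : i < j) (a : F) :
    ((rootElt hij a : GL (Fin n) F) : Matrix (Fin n) (Fin n) F) = transvection i j a := rfl

theorem exists_leading_entry (v : Fin n → F) :
    ∃ m : ℕ, v ≠ 0 → ∃ j : Fin n, (j : ℕ) = m ∧ v j ≠ 0 ∧ ∀ k < j, v k = 0 := by
  by_cases hv : v = 0
  · exact ⟨0, fun h => absurd hv h⟩
  obtain ⟨j, hj⟩ := Function.ne_iff.1 hv
  obtain ⟨i, hi⟩ := WellFounded.has_min (wellFounded_lt (α := Fin n)) {j | v j ≠ 0} ⟨j, hj⟩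
  exact ⟨i, fun _ => ⟨i, rfl, hi.1, fun k hk => by
    by_contra hne
    exact hi.2 k hne hk⟩⟩

theorem row_ne_zero (g : GL (Fin n) F) (i : Fin n) :
    (g : Matrix (Fin n) (Fin n) F) i ≠ 0 := by
  intro h
  have h1 : ((g * g⁻¹ : GL (Fin n) F) : Matrix (Fin n) (Fin n) F) i i = 0 := by
    rw [Units.val_mul, Matrix.mul_apply]
    exact Finset.sum_eq_zero fun k _ => by rw [h]; simp
  rw [mul_inv_cancel] at h1
  simp at h1

theorem transvection_mul_apply' {i k : Fin n} (a : F) (M : Matrix (Fin n) (Fin n) F) (m l : Fin n) :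
    (transvection i k a * M) m l = M m l + if m = i then a * M k l else 0 := by
  split_ifs with h
  · subst h; rw [transvection_mul_apply_same]
  · rw [transvection_mul_apply_of_ne _ _ _ _ h, add_zero]

/-- Choose u in U so that the leading positions of the rows of ug have maximal sum. If rows i < k
had the same leading column, adding a multiple of row k to row i would move the leading entry of row
i to the right. Hence the leading columns form a permutation, which sorts ug into B. -/
theorem exists_bruhat [Finite F] (g : GL (Fin n) F) :
    ∃ u ∈ unitri n F, ∃ ρ : Equiv.Perm (Fin n), ∃ b ∈ borelB n F, g = u * permGL F ρ * b := by
  choose lead hlead using fun v : Fin n → F => exists_leading_entry v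
  obtain ⟨u, hu⟩ := Finite.exists_max fun u : unitri n F =>
    ∑ i, lead (((u : GL (Fin n) F) * g : GL (Fin n) F) i)
  set x : GL (Fin n) F := (u : GL (Fin n) F) * g with hx
  choose L hL using fun i => hlead (x i) (row_ne_zero x i)
  have key : ∀ i k, i < k → L i ≠ L k := by
    intro i k hik heq
    -- This multiple of row k cancels the leading entry of row i.
    set a : F := -(x i (L k) / x k (L k)) with ha
    have hu' := hu (rootElt hik a * u)
    simp only [Subgroup.coe_mul, mul_assoc, ← hx] at hu'
    have hrow : ∀ m l, ((rootElt hik a : GL (Fin n) F) * x : GL (Fin n) F) m l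
        = x m l + if m = i then a * x k l else 0 := by
      intro m l
      rw [Units.val_mul, rootElt_coe, transvection_mul_apply']
    refine absurd hu' (not_le.2 (Finset.sum_lt_sum (fun m _ => ?_) ⟨i, Finset.mem_univ _, ?_⟩))
    · rcases eq_or_ne m i with rfl | hm
      · obtain ⟨j, hj1, hj2, hj3⟩ := hlead _ (row_ne_zero ((rootElt hik a : GL (Fin n) F) * x) m)
        rw [← hj1, ← (hL m).1]
        by_contra hlt
        have hlt' : j < L m := not_le.1 hlt
        rw [hrow, if_pos rfl, (hL m).2.2 j hlt', (hL k).2.2 j (heq ▸ hlt')] at hj2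
        simp at hj2
      · have : ((rootElt hik a : GL (Fin n) F) * x : GL (Fin n) F) m = x m := by
          ext l; rw [hrow, if_neg hm, add_zero]
        rw [this]
    · obtain ⟨j, hj1, hj2, hj3⟩ := hlead _ (row_ne_zero ((rootElt hik a : GL (Fin n) F) * x) i)
      rw [← hj1, ← (hL i).1]
      by_contra hlt
      have hlt' : j ≤ L i := not_lt.1 hlt
      rw [hrow, if_pos rfl] at hj2
      rcases hlt'.lt_or_eq with h | h
      · rw [(hL i).2.2 j h, (hL k).2.2 j (heq ▸ h)] at hj2
        simp at hj2
      · rw [h, heq, ha] at hj2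
        have := (hL k).2.1
        field_simp at hj2
        simp at hj2
  have hinj : Function.Injective L := by
    intro i k h
    rcases lt_trichotomy i k with hik | hik | hik
    · exact absurd h (key i k hik)
    · exact hik
    · exact absurd h.symm (key k i hik)
  let τ : Equiv.Perm (Fin n) := Equiv.ofBijective L (Finite.injective_iff_bijective.1 hinj)
  refine ⟨(u : GL (Fin n) F)⁻¹, (unitri n F).inv_mem u.2, τ⁻¹, permGL F τ * x, ?_, ?_⟩
  · rw [mem_borelB]
    intro i j hij
    rw [permGL_mul_apply]
    refine (hL (τ⁻¹ i)).2.2 j ?_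
    have : L (τ⁻¹ i) = i := by
      change τ (τ⁻¹ i) = i
      rw [← Equiv.Perm.mul_apply, mul_inv_cancel, Equiv.Perm.one_apply]
    rwa [this]
  · rw [permGL_inv, hx]; group

/-- In g = uρt the factors u and t lie in B, so ρ lies in the block subgroup too. It then preserves
the blocks and is a product of adjacent swaps within them. -/
theorem blockSubgroup_eq_closure [Finite F] {α : Type*} [LinearOrder α] {b : Fin n → α}
    (hb : Monotone b) :
    blockSubgroup F b
      = Subgroup.closure ((borelB n F : Set (GL (Fin n) F)) ∪ permGL F '' blockSwaps b) := by
  apply le_antisymm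
  · intro g hg
    obtain ⟨u, hu, ρ, t, ht, rfl⟩ := exists_bruhat g
    have hu' := borelB_le_blockSubgroup hb (unitri_le_borelB hu)
    have ht' := borelB_le_blockSubgroup hb ht
    have hρ : permGL F ρ ∈ blockSubgroup F b := by
      have := mul_mem (mul_mem (inv_mem hu') hg) (inv_mem ht')
      convert this using 1
      group
    have h1 := mem_closure_blockSwaps hb ρ (permGL_mem_blockSubgroup.1 hρ)
    have h2 : permGL F ρ ∈ Subgroup.closure (permGL F '' blockSwaps b) := by
      have := Subgroup.mem_map_of_mem (permGLHom n F) h1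
      rw [MonoidHom.map_closure] at this
      exact this
    refine mul_mem (mul_mem ?_ ?_) ?_
    · exact Subgroup.subset_closure (Or.inl (unitri_le_borelB hu))
    · exact Subgroup.closure_mono Set.subset_union_right h2
    · exact Subgroup.subset_closure (Or.inl ht)
  · rw [Subgroup.closure_le]
    rintro g (hg | ⟨s, ⟨i, j, -, hij, rfl⟩, rfl⟩)
    · exact borelB_le_blockSubgroup hb hg
    · refine permGL_mem_blockSubgroup.2 fun k => ?_
      rcases eq_or_ne k i with rfl | hki
      · simp [hij]
      rcases eq_or_ne k j with rfl | hkj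
      · simp [hij]
      rw [Equiv.swap_apply_of_ne_of_ne hki hkj]

/-! ### Generators of the unitriangular group -/

theorem isUpperUnitri_column {k : Fin n} (c : Fin n → F) (s : Finset (Fin n))
    (hs : ∀ i ∈ s, i < k) : IsUpperUnitri (1 + ∑ i ∈ s, single i k (c i)) := by
  have key : ∀ m l, l ≤ m → (∑ i ∈ s, single i k (c i)) m l = 0 := by
    intro m l hlm
    rw [Matrix.sum_apply]
    refine Finset.sum_eq_zero fun i hi => ?_
    rw [single_apply, if_neg]
    rintro ⟨rfl, rfl⟩
    exact absurd (hs _ hi) (not_lt.2 hlm)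
  refine ⟨fun m l hml => ?_, fun m => ?_⟩
  · have hml' : l < m := hml
    rw [Matrix.add_apply, key m l hml'.le, one_apply_ne hml'.ne', add_zero]
  · rw [Matrix.add_apply, key m m le_rfl, one_apply_eq, add_zero]

/-- The root elements of `U`. -/
def rootSet (n : ℕ) (F : Type*) [Field F] : Set (unitri n F) :=
  {u | ∃ (i j : Fin n) (hij : i < j) (a : F), u = rootElt hij a}

/-- Root elements of one column multiply by adding their entries, because E^{i,k} E^{m,k} = 0 for m
≠ k. -/
theorem column_mem_closure {k : Fin n} (c : Fin n → F) (s : Finset (Fin n))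
    (hs : ∀ i ∈ s, i < k) :
    unitriMk _ (isUpperUnitri_column c s hs) ∈ Subgroup.closure (rootSet n F) := by
  classical
  induction s using Finset.induction_on with
  | empty =>
    have : unitriMk _ (isUpperUnitri_column c ∅ hs) = 1 := by
      apply Subtype.ext
      ext i j
      simp [unitriMk_coe]
    rw [this]
    exact one_mem _
  | insert i s hi ih =>
    have h1 := ih fun m hm => hs m (Finset.mem_insert_of_mem hm)
    have h2 : rootElt (hs i (Finset.mem_insert_self _ _)) (c i) ∈ Subgroup.closure (rootSet n F) :=
      Subgroup.subset_closure ⟨_, _, _, _, rfl⟩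
    convert mul_mem h2 h1 using 1
    apply Subtype.ext
    apply Units.ext
    rw [Subgroup.coe_mul, Units.val_mul, unitriMk_coe, unitriMk_coe, rootElt_coe, transvection,
      Finset.sum_insert hi, mul_add, add_mul, one_mul, mul_one, add_mul, one_mul, Finset.mul_sum,
      Finset.sum_eq_zero (f := fun m => single i k (c i) * single m k (c m))]
    · abel
    · intro m hm
      exact single_mul_single_of_ne _ _ _ _ (hs m (Finset.mem_insert_of_mem hm)).ne' _

theorem closure_rootSet : Subgroup.closure (rootSet n F) = ⊤ := by
  classical
  rw [eq_top_iff]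
  -- Induction on the number k of columns, counted from the left, that may differ from those of the
  -- identity.
  have key : ∀ k : ℕ, ∀ u : unitri n F, (∀ (m l : Fin n), k ≤ l → m < l →
      ((u : GL (Fin n) F) : Matrix (Fin n) (Fin n) F) m l = 0) →
      u ∈ Subgroup.closure (rootSet n F) := by
    intro k
    induction k with
    | zero =>
      intro u hu
      have : u = 1 := unitri_ext fun i j hij => by
        rw [hu i j (Nat.zero_le _) hij, Subgroup.coe_one, Units.val_one, one_apply_ne hij.ne]
      rw [this]
      exact one_mem _
    | succ k ih =>
      intro u hu
      by_cases hk : k < n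
      · let K : Fin n := ⟨k, hk⟩
        let M : Matrix (Fin n) (Fin n) F := (u : GL (Fin n) F)
        have hMup := (mem_unitri.1 u.2).1
        have hMd := (mem_unitri.1 u.2).2
        have hs : ∀ i ∈ Finset.univ.filter (· < K), i < K := by simp
        set y := unitriMk _ (isUpperUnitri_column (fun i => M i K) _ hs) with hy
        have hv : IsUpperUnitri
            (Matrix.of fun m l => if l = K then (if m = K then 1 else 0) else M m l) := by
          refine ⟨fun m l hml => ?_, fun m => ?_⟩
          · have hml' : l < m := hml
            by_cases h : l = K
            · subst h
              simp [hml'.ne']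
            · simp only [of_apply, h, if_false]
              exact hMup m l hml'
          · by_cases h : m = K
            · simp [h]
            · simp only [of_apply, h, if_false]
              exact hMd m
        have h1 : unitriMk _ hv ∈ Subgroup.closure (rootSet n F) := by
          refine ih _ fun m l hl hml => ?_
          rw [unitriMk_coe]
          by_cases h : l = K
          · simp only [of_apply, h, if_true]
            rw [if_neg (h ▸ hml.ne)]
          · simp only [of_apply, h, if_false]
            refine hu m l ?_ hml
            have : (l : ℕ) ≠ k := fun h' => h (Fin.ext h')
            omega
        -- Here u = y·v, where y carries column K of u and v is u with that column cleared. Row K of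
        -- v is a unit vector, as the columns after K are already trivial.
        have h2 := mul_mem (column_mem_closure (fun i => M i K) _ hs) h1
        convert h2 using 1
        refine unitri_ext fun i j hij => ?_
        rw [Subgroup.coe_mul, Units.val_mul, unitriMk_coe, unitriMk_coe, add_mul, one_mul,
          Matrix.add_apply, Finset.sum_mul, Matrix.sum_apply]
        have h3 : ∀ m, (single m K (M m K) * Matrix.of fun m l =>
            if l = K then (if m = K then 1 else 0) else M m l) i j
            = if m = i then (if j = K then M i K else 0) else 0 := by
          intro m
          by_cases hm : m = i
          · subst hm
            rw [single_mul_apply_same, if_pos rfl]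
            by_cases hj : j = K
            · simp [hj]
            · simp only [of_apply, hj, if_false]
              rcases lt_or_gt_of_ne hj with h | h
              · rw [show M K j = 0 from hMup K j h, mul_zero]
              · rw [show M K j = 0 from hu K j h h, mul_zero]
          · rw [single_mul_apply_of_ne _ _ _ _ _ (Ne.symm hm), if_neg hm]
        simp only [h3, Finset.sum_ite_eq', Finset.mem_filter, Finset.mem_univ, true_and]
        by_cases hj : j = K
        · subst hj
          simp only [of_apply, hij.ne, if_true, if_false, hij, zero_add]; rfl
        · simp only [of_apply, hj, if_false, ite_self, add_zero]; rfl
      · exact ih u fun m l hl hml => absurd l.2 (by omega)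
  intro u _
  exact key n u fun m l hl _ => absurd l.2 (by omega)

end Unitri

/-! ### Linear characters of the unitriangular group -/

section SupSum

variable {n : ℕ} {F : Type*} [Field F]

/-- The weighted sum of the superdiagonal entries of a matrix. -/
def supSum (c : Fin n → F) (M : Matrix (Fin n) (Fin n) F) : F :=
  ∑ i : Fin n, ∑ j : Fin n, if (i : ℕ) + 1 = j then c i * M i j else 0

theorem supSum_congr {c : Fin n → F} {c' : Fin n → F} {M N : Matrix (Fin n) (Fin n) F}
    (h : ∀ i j : Fin n, (i : ℕ) + 1 = j → c i * M i j = c' i * N i j) :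
    supSum c M = supSum c' N :=
  Finset.sum_congr rfl fun i _ => Finset.sum_congr rfl fun j _ => by
    split_ifs with hij
    · exact h i j hij
    · rfl

theorem supSum_eq_zero {c : Fin n → F} {M : Matrix (Fin n) (Fin n) F}
    (h : ∀ i j : Fin n, (i : ℕ) + 1 = j → c i * M i j = 0) : supSum c M = 0 :=
  Finset.sum_eq_zero fun i _ => Finset.sum_eq_zero fun j _ => by
    split_ifs with hij
    · exact h i j hij
    · rfl

theorem supSum_transvection (c : Fin n → F) {i j : Fin n} (hij : (i : ℕ) + 1 = j) (a : F) :
    supSum c (transvection i j a) = c i * a := by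
  have hne : i ≠ j := by rintro rfl; omega
  rw [supSum, Finset.sum_eq_single i, Finset.sum_eq_single j]
  · simp [hij, transvection, one_apply_ne hne]
  · intro k _ hk
    rw [if_neg fun h => hk (Fin.ext (by omega))]
  · simp
  · intro k _ hk
    refine Finset.sum_eq_zero fun l _ => ?_
    split_ifs with hkl
    · have : k ≠ l := by rintro rfl; omega
      rw [transvection, Matrix.add_apply, one_apply_ne this, single_apply, if_neg]
      · simp
      · exact fun h => hk h.1.symm
    · rfl
  · simp

theorem supSum_transvection_of_ne (c : Fin n → F) {i j : Fin n} (hij : (i : ℕ) + 1 ≠ j) (a : F) :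
    supSum c (transvection i j a) = 0 := by
  refine supSum_eq_zero fun k l hkl => ?_
  have : k ≠ l := by rintro rfl; omega
  rw [transvection, Matrix.add_apply, one_apply_ne this, single_apply, if_neg]
  · simp
  · rintro ⟨rfl, rfl⟩; exact hij hkl

/-- No index lies strictly between i and i + 1, so superdiagonal entries add up. This makes
`supChar` multiplicative. -/
theorem unitri_mul_apply_succ {u v : GL (Fin n) F} (hu : u ∈ unitri n F) (hv : v ∈ unitri n F)
    {i j : Fin n}
    (hij : (i : ℕ) + 1 = j) : (u * v : GL (Fin n) F) i j = u i j + v i j := by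
  have hne : i ≠ j := by rintro rfl; omega
  rw [Units.val_mul, Matrix.mul_apply, Finset.sum_eq_add i j hne]
  · rw [(mem_unitri.1 hu).2, (mem_unitri.1 hv).2, one_mul, mul_one, add_comm]
  · rintro k - ⟨hki, hkj⟩
    rcases lt_or_ge k i with h | h
    · rw [(mem_unitri.1 hu).1 i k h, zero_mul]
    · rw [(mem_unitri.1 hv).1 k j, mul_zero]
      have h1 : (i : ℕ) ≤ k := h
      have h2 : (k : ℕ) ≠ i := fun h => hki (Fin.ext h)
      have h3 : (k : ℕ) ≠ j := fun h => hkj (Fin.ext h)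
      rw [Fin.lt_def]; omega
  · simp
  · simp

theorem supSum_mul (c : Fin n → F) {u v : GL (Fin n) F} (hu : u ∈ unitri n F)
    (hv : v ∈ unitri n F) :
    supSum c (u * v : GL (Fin n) F) = supSum c u + supSum c v := by
  simp only [supSum, ← Finset.sum_add_distrib]
  refine Finset.sum_congr rfl fun i _ => Finset.sum_congr rfl fun j _ => ?_
  split_ifs with hij
  · rw [unitri_mul_apply_succ hu hv hij, mul_add]
  · simp

variable {R : Type*} [CommRing R]

/-- The linear character `u ↦ ψ (∑ i, c i * u i (i + 1))` of `U`. -/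
noncomputable def supChar (ψ : AddChar F R) (c : Fin n → F) : unitri n F →* Rˣ :=
  MonoidHom.toHomUnits
    { toFun := fun u => ψ (supSum c (u : GL (Fin n) F))
      map_one' := by
        rw [supSum_eq_zero, AddChar.map_zero_eq_one]
        intro i j hij
        have hne : i ≠ j := by rintro rfl; omega
        rw [Subgroup.coe_one, Units.val_one, one_apply_ne hne, mul_zero]
      map_mul' := fun u v => by
        rw [Subgroup.coe_mul, supSum_mul c u.2 v.2, AddChar.map_add_eq_mul] }

theorem supChar_apply (ψ : AddChar F R) (c : Fin n → F) (u : unitri n F) :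
    (supChar ψ c u : R) = ψ (supSum c (u : GL (Fin n) F)) := rfl

theorem supChar_eq_one_of {ψ : AddChar F R} {c : Fin n → F} {u : unitri n F}
    (h : ∀ i j : Fin n, (i : ℕ) + 1 = j → c i ≠ 0 → (u : GL (Fin n) F) i j = 0) :
    supChar ψ c u = 1 := by
  apply Units.ext
  rw [supChar_apply, supSum_eq_zero, AddChar.map_zero_eq_one, Units.val_one]
  intro i j hij
  by_cases hc : c i = 0
  · rw [hc, zero_mul]
  · rw [h i j hij hc, mul_zero]

theorem supSum_neg (c : Fin n → F) (M : Matrix (Fin n) (Fin n) F) :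
    supSum (-c) M = - supSum c M := by
  simp only [supSum, ← Finset.sum_neg_distrib]
  refine Finset.sum_congr rfl fun i _ => Finset.sum_congr rfl fun j _ => ?_
  split_ifs <;> simp

theorem supChar_neg (ψ : AddChar F R) (c : Fin n → F) (u : unitri n F) :
    (supChar ψ (-c) u : R) = (supChar ψ c u⁻¹ : Rˣ) := by
  rw [map_inv]
  refine (Units.inv_eq_of_mul_eq_one_right (u := supChar ψ c u) ?_).symm
  rw [supChar_apply, supChar_apply, ← AddChar.map_add_eq_mul, supSum_neg, add_neg_cancel,
    AddChar.map_zero_eq_one]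

/-- The trace to the prime field is surjective, so it can be composed with a ↦ ζ^a. -/
theorem exists_nontrivial_addChar [Fintype F] (p : ℕ) [Fact p.Prime] [CharP F p]
    (hζ : ∃ ζ : R, IsPrimitiveRoot ζ p) : ∃ ψ : AddChar F R, ψ ≠ 1 := by
  obtain ⟨ζ, hζ⟩ := hζ
  let _ : Algebra (ZMod p) F := ZMod.algebra F p
  have hprim := AddChar.zmodChar_primitive_of_primitive_root p hζ
  obtain ⟨a, ha⟩ := Algebra.trace_surjective (ZMod p) F 1
  refine ⟨(AddChar.zmodChar p hζ.pow_eq_one).compAddMonoidHom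
    (Algebra.trace (ZMod p) F).toAddMonoidHom, fun h => ?_⟩
  have h1 := DFunLike.congr_fun h a
  rw [AddChar.compAddMonoidHom_apply, LinearMap.toAddMonoidHom_coe, ha, AddChar.one_apply] at h1
  exact one_ne_zero ((AddChar.IsPrimitive.zmod_char_eq_one_iff p hprim 1).1 h1)

variable [IsDomain R] [CharZero R]

/-- Otherwise φ would be orthogonal to every shift of ψ. Summing these relations over all shifts
collapses to |F|·φ(0) = 0, impossible in characteristic 0. -/
theorem exists_mulShift_eq [Fintype F] {ψ : AddChar F R} (hψ : ψ ≠ 1) (φ : AddChar F R) :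
    ∃ a, φ = AddChar.mulShift ψ a := by
  classical
  by_contra! hne
  have hprim : ψ.IsPrimitive := AddChar.IsPrimitive.of_ne_one hψ
  have h1 : ∀ a, ∑ x, φ x * ψ (-(a * x)) = 0 := by
    intro a
    have h2 : φ * (AddChar.mulShift ψ a)⁻¹ ≠ 1 := fun h => hne a (by rwa [mul_inv_eq_one] at h)
    have h3 := AddChar.sum_eq_zero_of_ne_one h2
    rw [← h3]
    refine Finset.sum_congr rfl fun x _ => ?_
    rw [AddChar.mul_apply, AddChar.inv_apply, AddChar.mulShift_apply, mul_neg]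
  have h2 : ∑ a, ∑ x, φ x * ψ (-(a * x)) = 0 := Finset.sum_eq_zero fun a _ => h1 a
  rw [Finset.sum_comm] at h2
  have h3 : ∀ x : F, ∑ a, φ x * ψ (-(a * x)) = if x = 0 then (Fintype.card F : R) else 0 := by
    intro x
    have h4 := AddChar.sum_mulShift (-x) hprim
    simp only [mul_neg, neg_eq_zero] at h4
    rw [← Finset.mul_sum, h4]
    split_ifs with hx
    · rw [hx, AddChar.map_zero_eq_one, one_mul]
    · simp
  simp only [h3, Finset.sum_ite_eq', Finset.mem_univ, if_true] at h2
  exact Fintype.card_ne_zero (Nat.cast_eq_zero.1 h2)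

/-- The commutator relation: linear characters of U are trivial on the root elements of non-adjacent
pairs. -/
theorem transvection_comm {i k j : Fin n} (hik : i < k) (hkj : k < j) (a : F) :
    rootElt hik a * rootElt hkj 1
      = rootElt (hik.trans hkj) a * (rootElt hkj 1 * rootElt hik a) := by
  apply Subtype.ext
  apply Units.ext
  simp only [Subgroup.coe_mul, Units.val_mul, rootElt_coe, transvection, add_mul, mul_add, one_mul,
    mul_one, single_mul_single_same]
  rw [single_mul_single_of_ne (i := i) (j := j) (h := hkj.ne'),
    single_mul_single_of_ne (i := k) (j := j) (h := (hik.trans hkj).ne')]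
  simp only [mul_zero, single_mul_single_of_ne _ _ _ _ (hik.trans hkj).ne']
  abel

/-- On a simple root subgroup χ is an additive character of F, hence a shift of ψ. The other root
elements are commutators, and all root elements together generate U. -/
theorem eq_supChar [Fintype F] {ψ : AddChar F R} (hψ : ψ ≠ 1) (χ : unitri n F →* Rˣ) :
    ∃ c : Fin n → F, χ = supChar ψ c := by
  classical
  have h1 : ∀ i : Fin n, ∃ ci : F, ∀ (j : Fin n) (hij : (i : ℕ) + 1 = j) (a : F),
      (χ (rootElt (i := i) (j := j) (by rw [Fin.lt_def]; omega) a) : R) = ψ (ci * a) := by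
    intro i
    by_cases hi : (i : ℕ) + 1 < n
    · have hlt : i < (⟨i + 1, hi⟩ : Fin n) := by rw [Fin.lt_def]; simp
      let φ : AddChar F R :=
        { toFun := fun a => (χ (rootElt hlt a) : R)
          map_zero_eq_one' := by
            have : rootElt hlt (0 : F) = 1 := by
              apply Subtype.ext
              apply Units.ext
              rw [rootElt_coe, transvection_zero]; rfl
            rw [this, map_one, Units.val_one]
          map_add_eq_mul' := fun a b => by
            have : rootElt hlt (a + b) = rootElt hlt a * rootElt hlt b := by
              apply Subtype.ext
              apply Units.ext
              rw [Subgroup.coe_mul, Units.val_mul, rootElt_coe, rootElt_coe, rootElt_coe,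
                transvection_mul_transvection_same _ _ hlt.ne]
            rw [this, map_mul, Units.val_mul] }
      obtain ⟨ci, hci⟩ := exists_mulShift_eq hψ φ
      refine ⟨ci, fun j hij a => ?_⟩
      have hj : j = ⟨i + 1, hi⟩ := Fin.ext hij.symm
      subst hj
      have := DFunLike.congr_fun hci a
      rwa [AddChar.mulShift_apply] at this
    -- The last index has no successor; the value of c there never enters `supSum`.
    · exact ⟨0, fun j hij => absurd j.2 (by omega)⟩
  choose c hc using h1
  refine ⟨c, ?_⟩
  refine MonoidHom.eq_of_eqOn_dense closure_rootSet ?_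
  rintro _ ⟨i, j, hij, a, rfl⟩
  by_cases hadj : (i : ℕ) + 1 = j
  · apply Units.ext
    rw [hc i j hadj, supChar_apply, rootElt_coe, supSum_transvection c hadj]
  · have hij' : (i : ℕ) < j := hij
    have hk : (i : ℕ) + 1 < n := by omega
    have hik : i < (⟨i + 1, hk⟩ : Fin n) := by rw [Fin.lt_def]; simp
    have hkj : (⟨i + 1, hk⟩ : Fin n) < j := by rw [Fin.lt_def]; simp; omega
    have h2 := congrArg χ (transvection_comm hik hkj a)
    rw [map_mul, map_mul, map_mul, mul_comm (χ (rootElt hkj 1)), right_eq_mul] at h2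
    rw [h2]
    apply Units.ext
    rw [supChar_apply, rootElt_coe, supSum_transvection_of_ne c hadj, AddChar.map_zero_eq_one,
      Units.val_one]

end SupSum

/-! ### The Steinberg lattice is spanned by the `U`-translates of its generator -/

section Span

variable {n : ℕ} {F : Type*} [Field F] [Fintype F] {R : Type*} [CommRing R]

open Classical in
/-- `σ B̂`. -/
noncomputable def permB (F : Type*) [Field F] [Fintype F] (R : Type*) [CommRing R]
    (σ : Equiv.Perm (Fin n)) : RG n F R :=
  MonoidAlgebra.single (permGL F σ) 1 *
    ∑ b : borelB n F, MonoidAlgebra.single (b : GL (Fin n) F) 1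

theorem steinbergElt_eq :
    steinbergElt n F R = ∑ σ : Equiv.Perm (Fin n), ((Equiv.Perm.sign σ : ℤ) • permB F R σ) := by
  rw [steinbergElt]
  exact Finset.sum_congr rfl fun σ _ => by rw [zsmul_eq_mul]; rfl

theorem single_mul_permB {g : GL (Fin n) F} {σ : Equiv.Perm (Fin n)}
    (h : (permGL F σ)⁻¹ * g * permGL F σ ∈ borelB n F) :
    MonoidAlgebra.single g (1 : R) * permB F R σ = permB F R σ := by
  classical
  have h1 : MonoidAlgebra.single ((permGL F σ)⁻¹ * g * permGL F σ) (1 : R) *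
      ∑ b : borelB n F, MonoidAlgebra.single (b : GL (Fin n) F) 1
      = ∑ b : borelB n F, MonoidAlgebra.single (b : GL (Fin n) F) 1 := by
    rw [Finset.mul_sum]
    refine Fintype.sum_equiv (Equiv.mulLeft (⟨_, h⟩ : borelB n F)) _ _ fun b => ?_
    rw [MonoidAlgebra.single_mul_single, one_mul]; rfl
  rw [permB]
  nth_rw 2 [← h1]
  rw [← mul_assoc, ← mul_assoc, MonoidAlgebra.single_mul_single, MonoidAlgebra.single_mul_single,
    one_mul]
  rw [show permGL F σ * ((permGL F σ)⁻¹ * g * permGL F σ) = g * permGL F σ by group]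

theorem permGL_mul_permB (τ σ : Equiv.Perm (Fin n)) :
    MonoidAlgebra.single (permGL F τ) (1 : R) * permB F R σ = permB F R (τ * σ) := by
  rw [permB, ← mul_assoc, MonoidAlgebra.single_mul_single, one_mul, ← permGL_mul]; rfl

theorem permGL_mul_steinbergElt (τ : Equiv.Perm (Fin n)) :
    MonoidAlgebra.single (permGL F τ) (1 : R) * steinbergElt n F R
      = (Equiv.Perm.sign τ : ℤ) • steinbergElt n F R := by
  rw [steinbergElt_eq, Finset.mul_sum, Finset.smul_sum]
  refine Fintype.sum_equiv (Equiv.mulLeft τ) _ _ fun σ => ?_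
  rw [mul_smul_comm, permGL_mul_permB, Equiv.coe_mulLeft, smul_smul, Equiv.Perm.sign_mul]
  congr 1
  rw [Units.val_mul, ← mul_assoc, Int.units_coe_mul_self, one_mul]

/-- Permutation matrices normalise the diagonal matrices, so t is absorbed by the factor B̂ of every
summand. -/
theorem diag_mul_steinbergElt {t : GL (Fin n) F} (ht : ∀ i j, i ≠ j → t i j = 0) :
    MonoidAlgebra.single t (1 : R) * steinbergElt n F R = steinbergElt n F R := by
  rw [steinbergElt_eq, Finset.mul_sum]
  refine Finset.sum_congr rfl fun σ _ => ?_
  rw [mul_smul_comm, single_mul_permB]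
  intro i j hij
  rw [permGL_inv_mul_mul_apply]
  exact ht _ _ fun h => (ne_of_gt hij) (σ.injective h)

/-- Pairing σ with (i j)σ, of opposite sign, lets the reflection formula be checked one pair at a
time, as in rank one. -/
theorem steinbergElt_eq_sum_pairs {i j : Fin n} (hij : i < j) :
    steinbergElt n F R = ∑ σ : Equiv.Perm (Fin n) with σ⁻¹ i < σ⁻¹ j,
      (Equiv.Perm.sign σ : ℤ) • (permB F R σ - permB F R (Equiv.swap i j * σ)) := by
  rw [steinbergElt_eq, ← Finset.sum_filter_add_sum_filter_not _
    (fun σ : Equiv.Perm (Fin n) => σ⁻¹ i < σ⁻¹ j)]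
  simp only [smul_sub, Finset.sum_sub_distrib]
  rw [sub_eq_add_neg]
  congr 1
  rw [← Finset.sum_neg_distrib]
  refine Finset.sum_bij' (fun σ _ => Equiv.swap i j * σ) (fun σ _ => Equiv.swap i j * σ)
    ?_ ?_ ?_ ?_ ?_
  · intro σ hσ
    simp only [Finset.mem_filter, Finset.mem_univ, true_and, not_lt] at hσ ⊢
    simp only [_root_.mul_inv_rev, Equiv.swap_inv, Equiv.Perm.mul_apply, Equiv.swap_apply_left,
      Equiv.swap_apply_right]
    exact lt_of_le_of_ne hσ fun h => hij.ne' (σ⁻¹.injective h)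
  · intro σ hσ
    simp only [Finset.mem_filter, Finset.mem_univ, true_and, not_lt] at hσ ⊢
    simp only [_root_.mul_inv_rev, Equiv.swap_inv, Equiv.Perm.mul_apply, Equiv.swap_apply_left,
      Equiv.swap_apply_right]
    exact hσ.le
  · intro σ _; rw [← mul_assoc, Equiv.swap_mul_self, one_mul]
  · intro σ _; rw [← mul_assoc, Equiv.swap_mul_self, one_mul]
  · intro σ _
    rw [← mul_assoc, Equiv.swap_mul_self, one_mul, Equiv.Perm.sign_mul, Equiv.Perm.sign_swap hij.ne]
    simp

omit [Fintype F] in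
theorem transvection_apply_of_ne {i j k l : Fin n} (a : F) (hkl : k ≠ l)
    (h : ¬ (k = i ∧ l = j)) : transvection i j a k l = 0 := by
  rw [transvection, Matrix.add_apply, one_apply_ne hkl, single_apply, if_neg, add_zero]
  rintro ⟨rfl, rfl⟩; exact h ⟨rfl, rfl⟩

omit [Fintype F] in
-- A computation in the GL₂ of the coordinates i, j: the product of the lower root element with
-- parameter −1/a and the matrix with rows (a, 1), (1, 0) has rows (a, 1), (0, −1/a).
theorem swap_mul_rootElt_mul_swap_apply {i j : Fin n} (hij : i < j) {a : F} (ha : a ≠ 0)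
    {k l : Fin n} (hkl : k ≠ l) (h : ¬ (k = i ∧ l = j)) :
    (permGL F (Equiv.swap i j) * (rootElt hij (-a⁻¹) : GL (Fin n) F) *
      (permGL F (Equiv.swap i j))⁻¹ * ((rootElt hij a : GL (Fin n) F) *
      permGL F (Equiv.swap i j)) : GL (Fin n) F) k l = 0 := by
  have hne := hij.ne
  have h1 : ((permGL F (Equiv.swap i j) * (rootElt hij (-a⁻¹) : GL (Fin n) F) *
      (permGL F (Equiv.swap i j))⁻¹ : GL (Fin n) F) : Matrix (Fin n) (Fin n) F)
      = transvection j i (-a⁻¹) := by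
    ext m r
    rw [permGL_conj_apply, rootElt_coe, Equiv.swap_inv]
    simp only [transvection, Matrix.add_apply, one_apply, single_apply,
      (Equiv.swap i j).injective.eq_iff, eq_comm (a := i), eq_comm (a := j),
      Equiv.swap_apply_eq_iff, Equiv.swap_apply_left, Equiv.swap_apply_right]
  rw [Units.val_mul, h1, transvection_mul_apply', mul_permGL_apply, mul_permGL_apply, rootElt_coe]
  by_cases hkj : k = j
  · subst hkj
    rw [if_pos rfl]
    by_cases hli : l = i
    · subst hli
      rw [Equiv.swap_apply_left]
      simp [transvection, one_apply_ne hne, ha, hne]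
    · rw [Equiv.swap_apply_of_ne_of_ne hli hkl.symm, transvection_apply_of_ne _ hkl,
        transvection_apply_of_ne _ (Ne.symm hli)]
      · simp
      · rintro ⟨-, rfl⟩; exact hkl rfl
      · rintro ⟨rfl, -⟩; exact hne rfl
  · rw [if_neg hkj, add_zero]
    by_cases hki : k = i
    · subst hki
      have hlj : l ≠ j := fun h' => h ⟨rfl, h'⟩
      rw [Equiv.swap_apply_of_ne_of_ne hkl.symm hlj, transvection_apply_of_ne _ hkl]
      rintro ⟨-, rfl⟩; exact hlj rfl
    · rw [transvection_apply_of_ne]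
      · intro h'
        rw [eq_comm, Equiv.swap_apply_eq_iff, Equiv.swap_apply_of_ne_of_ne hki hkj] at h'
        exact hkl h'.symm
      · rintro ⟨rfl, -⟩; exact hki rfl

omit [Fintype F] in
theorem rootElt_neg_inv {i j : Fin n} (hij : i < j) (a : F) :
    (rootElt hij (-a) : GL (Fin n) F) = (rootElt hij a : GL (Fin n) F)⁻¹ := by
  rw [eq_inv_iff_mul_eq_one]
  apply Units.ext
  rw [Units.val_mul, rootElt_coe, rootElt_coe, transvection_mul_transvection_same _ _ hij.ne,
    neg_add_cancel, transvection_zero, Units.val_one]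

/-- The action of a reflection on the generator of the Steinberg lattice of the corresponding
rank one subgroup. -/
theorem swap_mul_rootElt_mul_steinbergElt {i j : Fin n} (hij : i < j) {a : F} (ha : a ≠ 0) :
    MonoidAlgebra.single (permGL F (Equiv.swap i j)) (1 : R) *
      (MonoidAlgebra.single (rootElt hij a : GL (Fin n) F) (1 : R) * steinbergElt n F R)
      = MonoidAlgebra.single (rootElt hij a⁻¹ : GL (Fin n) F) (1 : R) * steinbergElt n F R
        - steinbergElt n F R := by
  rw [steinbergElt_eq_sum_pairs hij]
  simp only [Finset.mul_sum, ← Finset.sum_sub_distrib]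
  refine Finset.sum_congr rfl fun σ hσ => ?_
  have hσ' : σ⁻¹ i < σ⁻¹ j := by simpa using hσ
  -- As σ⁻¹ i < σ⁻¹ j, the root subgroup lies in σBσ⁻¹ and fixes σB̂.
  have hfix : ∀ c : F, MonoidAlgebra.single (rootElt hij c : GL (Fin n) F) (1 : R) * permB F R σ
      = permB F R σ := by
    intro c
    refine single_mul_permB ?_
    rw [mem_borelB]
    intro k l hlk
    rw [permGL_inv_mul_mul_apply, rootElt_coe, transvection_apply_of_ne]
    · exact fun h => hlk.ne' (σ.injective h)
    · rintro ⟨rfl, rfl⟩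
      simp only [← Equiv.Perm.mul_apply, inv_mul_cancel, Equiv.Perm.one_apply] at hσ'
      exact absurd hσ' hlk.not_gt
  set s := Equiv.swap i j with hs
  have hss : s⁻¹ = s := Equiv.swap_inv i j
  -- On sσB̂ the elements s·x(a) and x(a⁻¹) act alike, since x(−a⁻¹)·s·x(a) lies in the stabiliser
  -- (sσ)B(sσ)⁻¹.
  have h2 : MonoidAlgebra.single (permGL F s) (1 : R) *
      (MonoidAlgebra.single (rootElt hij a : GL (Fin n) F) (1 : R) * permB F R (s * σ))
      = MonoidAlgebra.single (rootElt hij a⁻¹ : GL (Fin n) F) (1 : R) * permB F R (s * σ) := by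
    have h3 : MonoidAlgebra.single ((rootElt hij (-a⁻¹) : GL (Fin n) F) * permGL F s *
        (rootElt hij a : GL (Fin n) F)) (1 : R) * permB F R (s * σ) = permB F R (s * σ) := by
      refine single_mul_permB ?_
      have h4 : (permGL F (s * σ))⁻¹ * ((rootElt hij (-a⁻¹) : GL (Fin n) F) * permGL F s *
        (rootElt hij a : GL (Fin n) F)) * permGL F (s * σ)
        = (permGL F σ)⁻¹ * (permGL F s * (rootElt hij (-a⁻¹) : GL (Fin n) F) *
          (permGL F s)⁻¹ * ((rootElt hij a : GL (Fin n) F) * permGL F s)) * permGL F σ := by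
        have : (permGL F s)⁻¹ = permGL F s := by rw [← permGL_inv, hss]
        rw [permGL_mul, _root_.mul_inv_rev, this]
        simp only [mul_assoc]
      rw [h4, mem_borelB]
      intro k l hlk
      rw [permGL_inv_mul_mul_apply, swap_mul_rootElt_mul_swap_apply hij ha]
      · exact fun h => hlk.ne' (σ.injective h)
      · rintro ⟨rfl, rfl⟩
        simp only [← Equiv.Perm.mul_apply, inv_mul_cancel, Equiv.Perm.one_apply] at hσ'
        exact absurd hσ' hlk.not_gt
    nth_rw 2 [← h3]
    rw [← mul_assoc, ← mul_assoc, MonoidAlgebra.single_mul_single,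
      MonoidAlgebra.single_mul_single, one_mul, rootElt_neg_inv, mul_assoc _ (permGL F s),
      mul_inv_cancel_left]
  simp only [mul_smul_comm, mul_sub, hfix, h2, ← smul_sub]
  rw [permGL_mul_permB]
  congr 1
  abel

/-- The `R`-span of the `U`-translates of `steinbergElt`. -/
noncomputable def spanU (n : ℕ) (F : Type*) [Field F] [Fintype F] (R : Type*) [CommRing R] :
    Submodule R (RG n F R) :=
  Submodule.span R (Set.range fun u : unitri n F =>
    MonoidAlgebra.single (u : GL (Fin n) F) (1 : R) * steinbergElt n F R)

/-- B is the product of U and the diagonal matrices, and the latter fix ê. -/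
theorem borelB_mul_mem_spanU {b : GL (Fin n) F} (hb : b ∈ borelB n F) :
    MonoidAlgebra.single b (1 : R) * steinbergElt n F R ∈ spanU n F R := by
  classical
  have hd : (Matrix.diagonal fun i => b i i).det ≠ 0 := by
    rw [det_diagonal]
    exact Finset.prod_ne_zero_iff.2 fun i _ => borelB_apply_self_ne_zero hb i
  set t : GL (Fin n) F := GeneralLinearGroup.mkOfDetNeZero _ hd with ht
  have htc : (t : Matrix (Fin n) (Fin n) F) = Matrix.diagonal fun i => b i i := rfl
  have htz : ∀ i j, i ≠ j → t i j = 0 := fun i j hij => by rw [htc, diagonal_apply_ne _ hij]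
  have htB : t ∈ borelB n F := fun i j hij => htz i j (ne_of_gt hij)
  have hu : b * t⁻¹ ∈ unitri n F := by
    refine ⟨(borelB n F).mul_mem hb ((borelB n F).inv_mem htB), fun i => ?_⟩
    have h1 := mul_diag_of_triangular (M := ((b * t⁻¹ : GL (Fin n) F) : Matrix (Fin n) (Fin n) F))
      (N := (t : Matrix (Fin n) (Fin n) F))
      ((borelB n F).mul_mem hb ((borelB n F).inv_mem htB)) htB i
    rw [← Units.val_mul, inv_mul_cancel_right, htc, diagonal_apply_eq] at h1
    exact (right_eq_mul₀ (borelB_apply_self_ne_zero hb i)).1 h1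
  have h2 : MonoidAlgebra.single b (1 : R) * steinbergElt n F R
      = MonoidAlgebra.single (b * t⁻¹) (1 : R) * steinbergElt n F R := by
    nth_rw 2 [← diag_mul_steinbergElt htz]
    rw [← mul_assoc, MonoidAlgebra.single_mul_single, one_mul, inv_mul_cancel_right]
  rw [h2]
  exact Submodule.subset_span ⟨⟨_, hu⟩, rfl⟩

omit [Fintype F] in
-- A simple reflection permutes the positive roots other than its own, and `h0` excludes that one.
theorem swap_conj_mem_unitri {i j : Fin n} (hij : (i : ℕ) + 1 = j) {v : GL (Fin n) F}
    (hv : v ∈ unitri n F) (h0 : v i j = 0) :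
    permGL F (Equiv.swap i j) * v * (permGL F (Equiv.swap i j))⁻¹ ∈ unitri n F := by
  rw [mem_unitri]
  constructor
  · intro k l hlk
    rw [permGL_conj_apply, Equiv.swap_inv]
    by_cases hlt : Equiv.swap i j l < Equiv.swap i j k
    · exact (mem_unitri.1 hv).1 _ _ hlt
    · have : k = j ∧ l = i := by
        have hlk' : (l : ℕ) < k := hlk
        rw [not_lt, Fin.le_def] at hlt
        rcases eq_or_ne k i with rfl | hki
        · have h1 : l ≠ k := hlk.ne
          have h2 : l ≠ j := by rintro rfl; omega
          rw [Equiv.swap_apply_left, Equiv.swap_apply_of_ne_of_ne h1 h2] at hlt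
          omega
        rcases eq_or_ne k j with rfl | hkj
        · rcases eq_or_ne l i with rfl | hli
          · exact ⟨rfl, rfl⟩
          · have h3 : (l : ℕ) ≠ i := fun h => hli (Fin.ext h)
            rw [Equiv.swap_apply_right, Equiv.swap_apply_of_ne_of_ne hli hlk.ne] at hlt
            omega
        · have h3 : (k : ℕ) ≠ j := fun h => hkj (Fin.ext h)
          have h4 : (k : ℕ) ≠ i := fun h => hki (Fin.ext h)
          rw [Equiv.swap_apply_of_ne_of_ne hki hkj] at hlt
          rcases eq_or_ne l i with rfl | hli
          · rw [Equiv.swap_apply_left] at hlt; omega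
          rcases eq_or_ne l j with rfl | hlj
          · rw [Equiv.swap_apply_right] at hlt; omega
          rw [Equiv.swap_apply_of_ne_of_ne hli hlj] at hlt
          omega
      rw [this.1, this.2, Equiv.swap_apply_left, Equiv.swap_apply_right, h0]
  · intro k
    rw [permGL_conj_apply, (mem_unitri.1 hv).2]

theorem swap_mul_mem_spanU {i j : Fin n} (hij : (i : ℕ) + 1 = j) {x : RG n F R}
    (hx : x ∈ spanU n F R) :
    MonoidAlgebra.single (permGL F (Equiv.swap i j)) (1 : R) * x ∈ spanU n F R := by
  induction hx using Submodule.span_induction with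
  | zero => rw [mul_zero]; exact zero_mem _
  | add x y _ _ hx hy => rw [mul_add]; exact add_mem hx hy
  | smul r x _ hx => rw [mul_smul_comm]; exact Submodule.smul_mem _ _ hx
  | mem x hx =>
    obtain ⟨u, rfl⟩ := hx
    have hlt : i < j := by rw [Fin.lt_def]; omega
    set s := Equiv.swap i j
    set a : F := (u : GL (Fin n) F) i j with ha
    set v : GL (Fin n) F := (u : GL (Fin n) F) * (rootElt hlt (-a) : GL (Fin n) F) with hv
    have hvU : v ∈ unitri n F := mul_mem u.2 (rootElt hlt (-a)).2
    have hv0 : v i j = 0 := by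
      rw [hv, unitri_mul_apply_succ u.2 (rootElt hlt (-a)).2 hij, ← ha, rootElt_coe]
      simp [transvection, one_apply_ne hlt.ne]
    have hw := swap_conj_mem_unitri hij hvU hv0
    set w : unitri n F := ⟨_, hw⟩ with hw'
    have hwc : (w : GL (Fin n) F) = permGL F s * v * (permGL F s)⁻¹ := rfl
    -- With u = v·x(a) and v i j = 0, the conjugate w = svs⁻¹ stays in U, so suê = w·(s x(a) ê) and
    -- only the rank one action on ê is left to evaluate.
    have key : MonoidAlgebra.single (permGL F s) (1 : R) *
        (MonoidAlgebra.single (u : GL (Fin n) F) (1 : R) * steinbergElt n F R)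
        = MonoidAlgebra.single (w : GL (Fin n) F) (1 : R) *
          (MonoidAlgebra.single (permGL F s) (1 : R) *
          (MonoidAlgebra.single (rootElt hlt a : GL (Fin n) F) (1 : R) * steinbergElt n F R)) := by
      simp only [← mul_assoc, MonoidAlgebra.single_mul_single, one_mul]
      congr 2
      rw [hwc, hv, rootElt_neg_inv]
      group
    simp only at key ⊢
    rw [key]
    by_cases ha0 : a = 0
    · have h1 : (rootElt hlt a : GL (Fin n) F) = 1 := by
        apply Units.ext
        rw [rootElt_coe, ha0, transvection_zero, Units.val_one]
      rw [h1, ← MonoidAlgebra.one_def, one_mul, permGL_mul_steinbergElt,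
        Equiv.Perm.sign_swap hlt.ne]
      simp only [Units.val_neg, Units.val_one, neg_smul, one_smul, mul_neg]
      exact neg_mem (Submodule.subset_span ⟨w, rfl⟩)
    · rw [swap_mul_rootElt_mul_steinbergElt hlt ha0, mul_sub, ← mul_assoc,
        MonoidAlgebra.single_mul_single, one_mul]
      exact sub_mem (Submodule.subset_span ⟨w * rootElt hlt a⁻¹, rfl⟩)
        (Submodule.subset_span ⟨w, rfl⟩)

theorem single_mul_mem_spanU (g : GL (Fin n) F) {x : RG n F R} (hx : x ∈ spanU n F R) :
    MonoidAlgebra.single g (1 : R) * x ∈ spanU n F R := by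
  let S : Submonoid (GL (Fin n) F) :=
    { carrier := {g | ∀ x ∈ spanU n F R, MonoidAlgebra.single g (1 : R) * x ∈ spanU n F R}
      one_mem' := fun x hx => by rwa [← MonoidAlgebra.one_def, one_mul]
      mul_mem' := fun {g h} hg hh x hx => by
        have := hg _ (hh x hx)
        rwa [← mul_assoc, MonoidAlgebra.single_mul_single, one_mul] at this }
  suffices h : g ∈ S from h x hx
  -- With a single block the block subgroup is all of G, so G is generated by B and the adjacent
  -- swaps.
  have htop : g ∈ blockSubgroup F (fun _ : Fin n => (0 : ℕ)) :=
    fun i j hij => absurd hij (lt_irrefl _)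
  rw [blockSubgroup_eq_closure monotone_const] at htop
  induction htop using Subgroup.closure_induction with
  | one => exact one_mem S
  | mul a b _ _ ha hb => exact mul_mem ha hb
  | inv a _ ha =>
    -- S is only a submonoid; finiteness of G supplies inverses.
    have : a⁻¹ = a ^ (orderOf a - 1) := by
      rw [inv_eq_iff_mul_eq_one, ← pow_succ', Nat.sub_add_cancel (orderOf_pos a),
        pow_orderOf_eq_one]
    rw [this]
    exact pow_mem ha _
  | mem a ha =>
    intro x hx
    rcases ha with hb | ⟨_, ⟨i, j, hij, -, rfl⟩, rfl⟩
    · induction hx using Submodule.span_induction with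
      | zero => rw [mul_zero]; exact zero_mem _
      | add x y _ _ hx hy => rw [mul_add]; exact add_mem hx hy
      | smul r x _ hx => rw [mul_smul_comm]; exact Submodule.smul_mem _ _ hx
      | mem x hx =>
        obtain ⟨u, rfl⟩ := hx
        simp only
        rw [← mul_assoc, MonoidAlgebra.single_mul_single, one_mul]
        exact borelB_mul_mem_spanU (mul_mem hb (unitri_le_borelB u.2))
    · exact swap_mul_mem_spanU hij hx

omit [Fintype F] in
theorem single_eq_smul (g : GL (Fin n) F) (r : R) :
    (MonoidAlgebra.single g r : RG n F R) = r • MonoidAlgebra.single g (1 : R) := by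
  rw [MonoidAlgebra.smul_single, smul_eq_mul, mul_one]

/-- The span of the U-translates of ê is stable under B and under simple reflections, hence under G.
-/
theorem mem_spanU_of_mem_latI {x : RG n F R} (hx : x ∈ latI n F R) : x ∈ spanU n F R := by
  obtain ⟨a, rfl⟩ := Submodule.mem_span_singleton.1 hx
  rw [smul_eq_mul]
  have he : steinbergElt n F R ∈ spanU n F R := by
    have h1 : MonoidAlgebra.single (1 : GL (Fin n) F) (1 : R) * steinbergElt n F R ∈ spanU n F R :=
      Submodule.subset_span ⟨1, rfl⟩
    rwa [← MonoidAlgebra.one_def, one_mul] at h1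
  induction a using MonoidAlgebra.induction_linear with
  | zero => rw [zero_mul]; exact zero_mem _
  | add a b ha hb =>
    rw [add_mul]
    exact add_mem (ha (Submodule.mem_span_singleton.2 ⟨a, rfl⟩))
      (hb (Submodule.mem_span_singleton.2 ⟨b, rfl⟩))
  | single g r =>
    rw [single_eq_smul, smul_mul_assoc]
    exact Submodule.smul_mem _ _ (single_mul_mem_spanU g he)

/-! ### Projections to the eigenspaces of `U` -/

open Classical in
/-- `x ↦ ∑ u, χ(u) u x`. -/
noncomputable def charProj (χ : unitri n F →* Rˣ) (x : RG n F R) : RG n F R :=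
  ∑ u : unitri n F, MonoidAlgebra.single (u : GL (Fin n) F) (χ u : R) * x

theorem charE_eq (χ : unitri n F →* Rˣ) : charE χ = charProj χ (steinbergElt n F R) := rfl

theorem charProj_eq_mul (χ : unitri n F →* Rˣ) (x : RG n F R) :
    charProj χ x = (charProj χ 1) * x := by
  simp only [charProj, mul_one, Finset.sum_mul]

theorem charProj_single_mul (χ : unitri n F →* Rˣ) (v : unitri n F) (x : RG n F R) :
    charProj χ (MonoidAlgebra.single (v : GL (Fin n) F) 1 * x)
      = ((χ v⁻¹ : Rˣ) : R) • charProj χ x := by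
  classical
  rw [charProj, charProj, Finset.smul_sum]
  refine Fintype.sum_equiv (Equiv.mulRight v) _ _ fun u => ?_
  rw [← mul_assoc, MonoidAlgebra.single_mul_single, mul_one, ← smul_mul_assoc,
    MonoidAlgebra.smul_single, smul_eq_mul, Equiv.coe_mulRight, map_mul, mul_comm (χ u),
    ← Units.val_mul, ← mul_assoc, ← map_mul, inv_mul_cancel, map_one, one_mul, Subgroup.coe_mul]

theorem single_mul_charProj (χ : unitri n F →* Rˣ) (v : unitri n F) (x : RG n F R) :
    MonoidAlgebra.single (v : GL (Fin n) F) 1 * charProj χ x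
      = ((χ v⁻¹ : Rˣ) : R) • charProj χ x := by
  classical
  rw [charProj, Finset.mul_sum, Finset.smul_sum]
  refine Fintype.sum_equiv (Equiv.mulLeft v) _ _ fun u => ?_
  rw [← mul_assoc, MonoidAlgebra.single_mul_single, one_mul, ← smul_mul_assoc,
    MonoidAlgebra.smul_single, smul_eq_mul, Equiv.coe_mulLeft, ← Units.val_mul, ← map_mul]
  simp

/-- Multiplicity one: the projection sends uê to a scalar multiple of E_χ, and such elements span I.
-/
theorem exists_charProj_eq_smul (χ : unitri n F →* Rˣ) {x : RG n F R} (hx : x ∈ latI n F R) :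
    ∃ r : R, charProj χ x = r • charE χ := by
  have hx' := mem_spanU_of_mem_latI hx
  clear hx
  induction hx' using Submodule.span_induction with
  | zero => exact ⟨0, by rw [charProj_eq_mul, mul_zero, zero_smul]⟩
  | add x y _ _ hx hy =>
    obtain ⟨r, hr⟩ := hx
    obtain ⟨s, hs⟩ := hy
    exact ⟨r + s, by rw [charProj_eq_mul, mul_add, ← charProj_eq_mul, ← charProj_eq_mul, hr, hs,
      add_smul]⟩
  | smul a x _ hx =>
    obtain ⟨r, hr⟩ := hx
    exact ⟨a * r, by rw [charProj_eq_mul, mul_smul_comm, ← charProj_eq_mul, hr, smul_smul]⟩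
  | mem x hx =>
    obtain ⟨u, rfl⟩ := hx
    exact ⟨_, charProj_single_mul χ u _⟩

end Span

/-! ### Coefficients and the bilinear form -/

section Coeff

variable {n : ℕ} {F : Type*} [Field F]

/-- `U ∩ σ B σ⁻¹`, as a subgroup of `U`. -/
def stabU (F : Type*) [Field F] (σ : Equiv.Perm (Fin n)) : Subgroup (unitri n F) where
  carrier := {u | (permGL F σ)⁻¹ * (u : GL (Fin n) F) * permGL F σ ∈ borelB n F}
  mul_mem' := fun {u v} hu hv => by
    have hu' : (permGL F σ)⁻¹ * (u : GL (Fin n) F) * permGL F σ ∈ borelB n F := hu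
    have hv' : (permGL F σ)⁻¹ * (v : GL (Fin n) F) * permGL F σ ∈ borelB n F := hv
    have := mul_mem hu' hv'
    simp only [Set.mem_ofPred_eq, Subgroup.coe_mul]
    convert this using 1
    group
  one_mem' := by simp [one_mem]
  inv_mem' := fun {u} hu => by
    have hu' : (permGL F σ)⁻¹ * (u : GL (Fin n) F) * permGL F σ ∈ borelB n F := hu
    have := inv_mem hu'
    simp only [Set.mem_ofPred_eq, Subgroup.coe_inv]
    convert this using 1
    group

theorem mem_stabU {σ : Equiv.Perm (Fin n)} {u : unitri n F} :
    u ∈ stabU F σ ↔ (permGL F σ)⁻¹ * (u : GL (Fin n) F) * permGL F σ ∈ borelB n F := Iff.rfl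

theorem mem_stabU' {σ : Equiv.Perm (Fin n)} {u : unitri n F} :
    u ∈ stabU F σ ↔ ∀ i j, σ⁻¹ j < σ⁻¹ i → (u : GL (Fin n) F) i j = 0 := by
  rw [mem_stabU, mem_borelB]
  constructor
  · intro h i j hij
    have := h _ _ hij
    rw [permGL_inv_mul_mul_apply] at this
    simpa using this
  · intro h i j hij
    rw [permGL_inv_mul_mul_apply]
    refine h _ _ ?_
    simpa using hij

variable [Fintype F] {R : Type*} [CommRing R]

theorem canForm_comm (x y : RG n F R) : canForm x y = canForm y x := by
  simp [canForm, mul_comm]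

theorem canForm_smul_left (r : R) (x y : RG n F R) : canForm (r • x) y = r * canForm x y := by
  simp [canForm, Finset.mul_sum, mul_assoc]

theorem canForm_smul_right (r : R) (x y : RG n F R) : canForm x (r • y) = r * canForm x y := by
  rw [canForm_comm, canForm_smul_left, canForm_comm]

theorem canForm_add_right (x y y' : RG n F R) :
    canForm x (y + y') = canForm x y + canForm x y' := by
  rw [canForm_comm, canForm_add, canForm_comm y, canForm_comm y']

theorem canForm_zero_right (x : RG n F R) : canForm x 0 = 0 := by
  simp [canForm]

theorem canForm_sum_right {ι : Type*} (s : Finset ι) (x : RG n F R) (y : ι → RG n F R) :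
    canForm x (∑ i ∈ s, y i) = ∑ i ∈ s, canForm x (y i) := by
  classical
  induction s using Finset.induction_on with
  | empty => simp [canForm_zero_right]
  | insert i s hi ih => rw [Finset.sum_insert hi, Finset.sum_insert hi, canForm_add_right, ih]

theorem canForm_sum_left {ι : Type*} (s : Finset ι) (x : ι → RG n F R) (y : RG n F R) :
    canForm (∑ i ∈ s, x i) y = ∑ i ∈ s, canForm (x i) y := by
  rw [canForm_comm, canForm_sum_right]
  simp only [canForm_comm y]

theorem canForm_single_right (x : RG n F R) (g : GL (Fin n) F) :
    canForm x (MonoidAlgebra.single g 1) = x.coeff g := by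
  classical
  rw [canForm, Finset.sum_eq_single g]
  · simp
  · intro h _ hh
    rw [MonoidAlgebra.coeff_single, Finsupp.single_eq_of_ne hh, mul_zero]
  · simp

theorem permB_coeff (σ : Equiv.Perm (Fin n)) (g : GL (Fin n) F)
    [Decidable ((permGL F σ)⁻¹ * g ∈ borelB n F)] :
    (permB F R σ).coeff g = if (permGL F σ)⁻¹ * g ∈ borelB n F then 1 else 0 := by
  classical
  rw [permB, MonoidAlgebra.coeff_single_mul_apply, one_mul, MonoidAlgebra.coeff_sum,
    Finsupp.finsetSum_apply]
  split_ifs with h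
  · rw [Finset.sum_eq_single ⟨_, h⟩]
    · simp
    · intro b _ hb
      rw [MonoidAlgebra.coeff_single, Finsupp.single_eq_of_ne]
      intro h'
      exact hb (Subtype.ext h'.symm)
    · simp
  · refine Finset.sum_eq_zero fun b _ => ?_
    rw [MonoidAlgebra.coeff_single, Finsupp.single_eq_of_ne]
    intro h'
    exact h (h' ▸ b.2)

open Classical in
-- By uniqueness in the Bruhat decomposition only the summand σB̂ of ê contributes, and only for u
-- in σBσ⁻¹.
theorem charE_coeff_permGL (χ : unitri n F →* Rˣ) (σ : Equiv.Perm (Fin n)) :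
    (charE χ).coeff (permGL F σ)
      = (Equiv.Perm.sign σ : ℤ) • ∑ u : stabU F σ, (χ u : R) := by
  rw [charE, MonoidAlgebra.coeff_sum, Finsupp.finsetSum_apply, steinbergElt_eq]
  simp only [MonoidAlgebra.coeff_single_mul_apply, MonoidAlgebra.coeff_sum,
    Finsupp.finsetSum_apply, MonoidAlgebra.coeff_smul, Finsupp.smul_apply, permB_coeff]
  have h1 : ∀ (u : unitri n F) (τ : Equiv.Perm (Fin n)),
      ((permGL F τ)⁻¹ * ((u : GL (Fin n) F)⁻¹ * permGL F σ) ∈ borelB n F)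
        ↔ (τ = σ ∧ u ∈ stabU F σ) := by
    intro u τ
    constructor
    · intro h
      rw [← mul_assoc] at h
      have h2 : τ = σ := perm_eq_of_double_coset (unitri_le_borelB (inv_mem u.2)) h
      subst h2
      exact ⟨rfl, (inv_mem_iff (H := stabU F τ)).1 h⟩
    · rintro ⟨rfl, h⟩
      rw [← mul_assoc]
      exact (inv_mem_iff (H := stabU F τ)).2 h
  simp only [h1]
  have h2 : ∀ u : unitri n F, (χ u : R) * ∑ τ : Equiv.Perm (Fin n), (Equiv.Perm.sign τ : ℤ) •
      (if τ = σ ∧ u ∈ stabU F σ then (1 : R) else 0)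
      = (Equiv.Perm.sign σ : ℤ) • (if u ∈ stabU F σ then (χ u : R) else 0) := by
    intro u
    rw [Finset.sum_eq_single σ]
    · split_ifs with h h' h'
      · rw [mul_smul_comm, mul_one]
      · exact absurd h.2 h'
      · exact absurd ⟨rfl, h'⟩ h
      · simp
    · intro τ _ hτ
      simp [hτ]
    · simp
  simp only [h2]
  rw [← Finset.smul_sum, ← Finset.sum_filter]
  congr 1
  exact Finset.sum_subtype _ (by simp) _

theorem steinbergElt_mul_single {b : GL (Fin n) F} (hb : b ∈ borelB n F) :
    steinbergElt n F R * MonoidAlgebra.single b 1 = steinbergElt n F R := by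
  classical
  rw [steinbergElt_eq, Finset.sum_mul]
  refine Finset.sum_congr rfl fun σ _ => ?_
  rw [smul_mul_assoc, permB, mul_assoc, Finset.sum_mul]
  congr 2
  refine Fintype.sum_equiv (Equiv.mulRight (⟨b, hb⟩ : borelB n F)) _ _ fun c => ?_
  rw [MonoidAlgebra.single_mul_single, one_mul]; rfl

theorem charE_mul_single (χ : unitri n F →* Rˣ) {b : GL (Fin n) F} (hb : b ∈ borelB n F) :
    charE χ * MonoidAlgebra.single b 1 = charE χ := by
  rw [charE_eq, charProj_eq_mul, mul_assoc, steinbergElt_mul_single hb]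

theorem charE_coeff_mul (χ : unitri n F →* Rˣ) (g : GL (Fin n) F) {b : GL (Fin n) F}
    (hb : b ∈ borelB n F) : (charE χ).coeff (g * b) = (charE χ).coeff g := by
  have h := congrArg (fun x : RG n F R => x.coeff (g * b)) (charE_mul_single χ hb)
  simp only [MonoidAlgebra.coeff_mul_single_apply, mul_inv_cancel_right, mul_one] at h
  exact h.symm

theorem charE_coeff_unitri_mul (χ : unitri n F →* Rˣ) (u : unitri n F) (g : GL (Fin n) F) :
    (charE χ).coeff ((u : GL (Fin n) F) * g) = (χ u : R) * (charE χ).coeff g := by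
  have h := congrArg (fun x : RG n F R => x.coeff g) (single_mul_charProj χ u⁻¹ (steinbergElt n F R))
  simp only [MonoidAlgebra.coeff_single_mul_apply, one_mul, ← charE_eq, MonoidAlgebra.coeff_smul,
    Finsupp.smul_apply, smul_eq_mul, inv_inv, Subgroup.coe_inv] at h
  exact h

open Classical in
-- E_χ is invariant under B on the right, so pairing with σB̂ gives |B| times the coefficient at σ.
-- The two factors sg(σ) cancel.
theorem canForm_charE_steinbergElt (χ : unitri n F →* Rˣ) :
    canForm (charE χ) (steinbergElt n F R)
      = (Nat.card (borelB n F) : R) *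
        ∑ σ : Equiv.Perm (Fin n), ∑ u : stabU F σ, (χ u : R) := by
  rw [steinbergElt_eq, canForm_sum_right, Finset.mul_sum]
  refine Finset.sum_congr rfl fun σ _ => ?_
  have h1 : canForm (charE χ) (permB F R σ)
      = (Nat.card (borelB n F) : R) * (charE χ).coeff (permGL F σ) := by
    rw [permB, Finset.mul_sum, canForm_sum_right]
    simp only [MonoidAlgebra.single_mul_single, one_mul, canForm_single_right,
      charE_coeff_mul χ _ (Subtype.prop _)]
    rw [Finset.sum_const, nsmul_eq_mul, Finset.card_univ, Nat.card_eq_fintype_card]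
  rw [← Int.cast_smul_eq_zsmul R, canForm_smul_right, h1, charE_coeff_permGL,
    ← Int.cast_smul_eq_zsmul R, smul_eq_mul]
  have h2 : ((Equiv.Perm.sign σ : ℤ) : R) * ((Equiv.Perm.sign σ : ℤ) : R) = 1 := by
    rw [← Int.cast_mul, Int.units_coe_mul_self, Int.cast_one]
  linear_combination (Nat.card (borelB n F) : R) * (∑ u : stabU F σ, (χ u : R)) * h2

/-! ### The values of the form -/

variable {ψ : AddChar F R}

omit [Fintype F] in
theorem exists_rootElt_ne_one (hψ : ψ ≠ 1) {c : Fin n → F} {i j : Fin n} (hij : (i : ℕ) + 1 = j)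
    (hlt : i < j) (hc : c i ≠ 0) : ∃ a, supChar ψ c (rootElt hlt a) ≠ 1 := by
  obtain ⟨x, hx⟩ := AddChar.ne_one_iff.1 hψ
  refine ⟨(c i)⁻¹ * x, fun h => hx ?_⟩
  have := congrArg Units.val h
  rwa [supChar_apply, rootElt_coe, supSum_transvection c hij, mul_inv_cancel_left₀ hc] at this

variable [IsDomain R]

open Classical in
-- Orthogonality of characters: the sum vanishes unless χ is trivial on `stabU F σ`, and a simple
-- root subgroup contained in it on which χ is non-trivial is the only obstruction.
theorem sum_stabU (hψ : ψ ≠ 1) (c : Fin n → F) (σ : Equiv.Perm (Fin n)) :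
    ∑ u : stabU F σ, (supChar ψ c u : R)
      = if ∀ i j : Fin n, (i : ℕ) + 1 = j → c i ≠ 0 → σ⁻¹ j < σ⁻¹ i then
        (Nat.card (stabU F σ) : R) else 0 := by
  split_ifs with h
  · rw [Nat.card_eq_fintype_card, ← Finset.card_univ, ← nsmul_one, ← Finset.sum_const]
    refine Finset.sum_congr rfl fun u _ => ?_
    rw [supChar_eq_one_of, Units.val_one]
    intro i j hij hc
    exact mem_stabU'.1 u.2 i j (h i j hij hc)
  · push Not at h
    obtain ⟨i, j, hij, hc, hle⟩ := h
    have hlt : i < j := by rw [Fin.lt_def]; omega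
    obtain ⟨a, ha⟩ := exists_rootElt_ne_one hψ hij hlt hc
    have hmem : rootElt hlt a ∈ stabU F σ := by
      rw [mem_stabU']
      intro k l hkl
      rw [rootElt_coe, transvection_apply_of_ne]
      · rintro rfl; exact lt_irrefl _ hkl
      · rintro ⟨rfl, rfl⟩; exact absurd hkl (not_lt.2 hle)
    refine sum_hom_units_eq_zero ((Units.coeHom R).comp ((supChar ψ c).comp (stabU F σ).subtype))
      fun h1 => ha ?_
    have := DFunLike.congr_fun h1 ⟨_, hmem⟩
    exact Units.ext this

open Classical in
/-- The number `f(E_χ, ê)`. -/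
noncomputable def formVal (F : Type*) [Field F] {n : ℕ} (c : Fin n → F) : ℕ :=
  ∑ σ : Equiv.Perm (Fin n) with ∀ i j : Fin n, (i : ℕ) + 1 = j → c i ≠ 0 → σ⁻¹ j < σ⁻¹ i,
    Nat.card (stabU F σ)

theorem canForm_supChar (hψ : ψ ≠ 1) (c : Fin n → F) :
    canForm (charE (supChar ψ c)) (steinbergElt n F R)
      = (Nat.card (borelB n F) : R) * (formVal F c : R) := by
  classical
  rw [canForm_charE_steinbergElt, formVal, Nat.cast_sum, Finset.sum_filter]
  simp only [sum_stabU hψ]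

end Coeff

/-! ### The index of a parabolic subgroup -/

section Index

variable {n : ℕ} {F : Type*} [Field F] [Fintype F]

/-- The pairs that a permutation leaves in order. -/
def nonInv (τ : Equiv.Perm (Fin n)) : ℕ :=
  (Finset.univ.filter fun x : Fin n × Fin n => x.1 < x.2 ∧ τ x.1 < τ x.2).card

omit [Fintype F] in
theorem isUpperUnitri_of_fun {S : Fin n → Fin n → Prop} [DecidableRel S]
    (f : {x : Fin n × Fin n // x.1 < x.2 ∧ S x.1 x.2} → F) :
    IsUpperUnitri (Matrix.of fun i j =>
      if h : i < j ∧ S i j then f ⟨(i, j), h⟩ else if i = j then 1 else 0) := by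
  refine ⟨fun i j hij => ?_, fun i => by simp⟩
  have hij' : j < i := hij
  rw [of_apply, dif_neg (fun h => absurd h.1 hij'.not_gt), if_neg hij'.ne']

/-- Coordinates on a pattern subgroup of `U`. -/
noncomputable def patternEquiv (F : Type*) [Field F] (S : Fin n → Fin n → Prop) [DecidableRel S] :
    {u : unitri n F // ∀ i j, i < j → ¬ S i j → (u : GL (Fin n) F) i j = 0}
      ≃ ({x : Fin n × Fin n // x.1 < x.2 ∧ S x.1 x.2} → F) where
  toFun u x := (u.1 : GL (Fin n) F) x.1.1 x.1.2
  invFun f := ⟨unitriMk _ (isUpperUnitri_of_fun f), fun i j hij hS => by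
    rw [unitriMk_coe, of_apply, dif_neg (fun h => hS h.2), if_neg hij.ne]⟩
  left_inv u := by
    apply Subtype.ext
    refine unitri_ext fun i j hij => ?_
    rw [unitriMk_coe, of_apply]
    split_ifs with h h'
    · rfl
    · exact absurd h' hij.ne
    · rw [u.2 i j hij fun hS => h ⟨hij, hS⟩]
  right_inv f := by
    funext x
    simp only
    rw [unitriMk_coe, of_apply, dif_pos x.2]

theorem card_stabU (τ : Equiv.Perm (Fin n)) :
    Nat.card (stabU F τ) = Fintype.card F ^ nonInv τ := by
  have e1 : stabU F τ ≃ {u : unitri n F // ∀ i j, i < j → ¬ τ⁻¹ i < τ⁻¹ j →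
      (u : GL (Fin n) F) i j = 0} := Equiv.subtypeEquivRight fun u => by
    rw [mem_stabU']
    constructor
    · intro h i j hij hn
      exact h i j (lt_of_le_of_ne (not_lt.1 hn) fun h' => hij.ne' (τ⁻¹.injective h'))
    · intro h i j hij
      rcases lt_trichotomy i j with h' | rfl | h'
      · exact h i j h' hij.not_gt
      · exact absurd hij (lt_irrefl _)
      · exact (mem_unitri.1 u.2).1 i j h'
  rw [Nat.card_congr (e1.trans (patternEquiv F fun i j => τ⁻¹ i < τ⁻¹ j)), Nat.card_fun,
    Nat.card_eq_fintype_card, Nat.card_eq_fintype_card, nonInv]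
  congr 1
  rw [Fintype.card_subtype]
  -- There is one free entry for each pair kept in order by τ⁻¹; applying τ⁻¹ turns these into the
  -- pairs kept in order by τ.
  refine Finset.card_bij' (fun x _ => (τ⁻¹ x.1, τ⁻¹ x.2)) (fun x _ => (τ x.1, τ x.2)) ?_ ?_ ?_ ?_
  all_goals simp +contextual

/-- Pairs kept in order by w₀σ⁻¹, with w₀ the reversal, correspond under σ⁻¹ to the inversions of σ.
-/
theorem nonInv_add (σ : Equiv.Perm (Fin n)) :
    nonInv (Fin.revPerm * σ⁻¹) + nonInv σ = nonInv (1 : Equiv.Perm (Fin n)) := by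
  have h1 : nonInv (Fin.revPerm * σ⁻¹)
      = (Finset.univ.filter fun x : Fin n × Fin n => x.1 < x.2 ∧ ¬ σ x.1 < σ x.2).card := by
    refine Finset.card_bij' (fun x _ => (σ⁻¹ x.2, σ⁻¹ x.1)) (fun x _ => (σ x.2, σ x.1)) ?_ ?_ ?_ ?_
    · intro x
      simp only [Finset.mem_filter, Finset.mem_univ, true_and, Equiv.Perm.mul_apply,
        Fin.revPerm_apply, Fin.rev_lt_rev, not_lt, ← Equiv.Perm.mul_apply σ, mul_inv_cancel,
        Equiv.Perm.one_apply]
      exact fun h => ⟨h.2, h.1.le⟩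
    · intro x
      simp only [Finset.mem_filter, Finset.mem_univ, true_and, Equiv.Perm.mul_apply,
        Fin.revPerm_apply, Fin.rev_lt_rev, not_lt]
      simp only [← Equiv.Perm.mul_apply, inv_mul_cancel, Equiv.Perm.one_apply]
      exact fun h => ⟨lt_of_le_of_ne h.2 fun h' => h.1.ne' (σ.injective h'), h.1⟩
    · intro x _; simp
    · intro x _; simp
  rw [h1, add_comm, nonInv, nonInv, ← Finset.filter_filter, ← Finset.filter_filter,
    Finset.card_filter_add_card_filter_not]
  simp

theorem card_unitri : Nat.card (unitri n F) = Fintype.card F ^ nonInv (1 : Equiv.Perm (Fin n)) := by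
  rw [← card_stabU]
  have : stabU F (1 : Equiv.Perm (Fin n)) = ⊤ := by
    rw [eq_top_iff]
    intro u _
    rw [mem_stabU']
    intro i j hij
    exact (mem_unitri.1 u.2).1 i j (by simpa using hij)
  rw [this, Subgroup.card_top]

/-- Converts the sizes of U-orbits on flags into the summands of `formVal`. -/
theorem index_stabU (σ : Equiv.Perm (Fin n)) :
    (stabU F (Fin.revPerm * σ⁻¹)).index = Nat.card (stabU F σ) := by
  have h1 := (stabU F (Fin.revPerm * σ⁻¹)).index_mul_card
  rw [card_unitri, card_stabU, ← nonInv_add σ, pow_add, mul_comm] at h1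
  rw [card_stabU]
  exact Nat.eq_of_mul_eq_mul_left (pow_pos Fintype.card_pos _) h1

variable {α : Type*} [LinearOrder α] {b : Fin n → α}

/-- The minimal length representatives. -/
def IncOn (b : Fin n → α) : Type := {ρ : Equiv.Perm (Fin n) // ∀ i j, i < j → b i = b j → ρ i < ρ j}

omit [Fintype F] in
-- As ρ increases on each block, conjugation by it leaves the diagonal blocks of an element of U
-- upper triangular. Hence U meets ρPρ⁻¹ and ρBρ⁻¹ in the same subgroup.
theorem mem_stabU_of_incOn (hb : Monotone b) (ρ : IncOn b) (u : unitri n F) :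
    u ∈ stabU F ρ.1 ↔ (permGL F ρ.1)⁻¹ * (u : GL (Fin n) F) * permGL F ρ.1 ∈ blockSubgroup F b := by
  constructor
  · intro h; exact borelB_le_blockSubgroup hb h
  · intro h
    rw [mem_stabU, mem_borelB]
    intro i j hij
    rcases (hb hij.le).lt_or_eq with hlt | heq
    · exact h hlt
    · rw [permGL_inv_mul_mul_apply]
      exact (mem_unitri.1 u.2).1 _ _ (ρ.2 j i hij heq)

omit [Fintype F] in
-- By `hτ` the permutation ρ⁻¹τ preserves the blocks. It increases on each of them, hence
-- everywhere, and so is trivial.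
theorem incOn_eq (hb : Monotone b) {ρ τ : IncOn b} (hτ : ∀ k, b (τ.1⁻¹ k) = b (ρ.1⁻¹ k)) :
    ρ = τ := by
  have h1 : ∀ i, b ((ρ.1⁻¹ * τ.1) i) = b i := by
    intro i
    rw [Equiv.Perm.mul_apply, ← hτ]
    simp
  have h2 : ∀ i j, i < j → b i = b j → (ρ.1⁻¹ * τ.1) i < (ρ.1⁻¹ * τ.1) j := by
    intro i j hij hbij
    by_contra hle
    have hlt := lt_of_le_of_ne (not_lt.1 hle) fun h => hij.ne' ((ρ.1⁻¹ * τ.1).injective h)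
    have h3 := ρ.2 _ _ hlt (by rw [h1, h1, hbij])
    rw [← Equiv.Perm.mul_apply, ← Equiv.Perm.mul_apply, mul_inv_cancel_left] at h3
    exact absurd h3 (τ.2 i j hij hbij).not_gt
  have h3 : ρ.1⁻¹ * τ.1 = 1 := eq_one_of_adjacent_lt fun i j hij => by
    have hlt : i < j := by rw [Fin.lt_def]; omega
    rcases (hb hlt.le).lt_or_eq with h | h
    · by_contra hle
      have h4 := hb (not_lt.1 hle)
      rw [h1, h1] at h4
      exact absurd h h4.not_gt
    · exact h2 i j hlt h
  exact Subtype.ext (inv_mul_eq_one.1 h3)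

/-- The orbit map of `U` on the flags of type `b` through `ρ`. -/
def orbitMap (b : Fin n → α) (hb : Monotone b) (x : Σ ρ : IncOn b, unitri n F ⧸ stabU F ρ.1) :
    GL (Fin n) F ⧸ blockSubgroup F b :=
  Quotient.map' (fun u : unitri n F => (u : GL (Fin n) F) * permGL F x.1.1) (fun u v h => by
    rw [QuotientGroup.leftRel_apply] at h ⊢
    rw [mem_stabU_of_incOn hb] at h
    convert h using 1
    simp only [_root_.mul_inv_rev, Subgroup.coe_mul, Subgroup.coe_inv, mul_assoc]) x.2

theorem orbitMap_bijective (hb : Monotone b) :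
    Function.Bijective (orbitMap (F := F) b hb) := by
  constructor
  · rintro ⟨ρ, x⟩ ⟨τ, y⟩ h
    induction x using QuotientGroup.induction_on with | _ u =>
    induction y using QuotientGroup.induction_on with | _ v =>
    have h1 : ((u : GL (Fin n) F) * permGL F ρ.1)⁻¹ * ((v : GL (Fin n) F) * permGL F τ.1)
        ∈ blockSubgroup F b := QuotientGroup.eq.1 h
    have h2 : (permGL F ρ.1)⁻¹ * ((u⁻¹ * v : unitri n F) : GL (Fin n) F) * permGL F τ.1
        ∈ blockSubgroup F b := by
      convert h1 using 1
      simp only [_root_.mul_inv_rev, Subgroup.coe_mul, Subgroup.coe_inv, mul_assoc]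
    have h3 : ρ = τ :=
      incOn_eq hb fun k => block_eq_of_double_coset (unitri_le_borelB (u⁻¹ * v).2) h2 k
    subst h3
    congr 1
    exact QuotientGroup.eq.2 ((mem_stabU_of_incOn hb ρ _).2 h2)
  · intro y
    induction y using QuotientGroup.induction_on with | _ g =>
    obtain ⟨u, hu, ρ, t, ht, rfl⟩ := exists_bruhat g
    -- Sorting ρ within the blocks changes it by an element of the block subgroup, which leaves the
    -- coset alone.
    obtain ⟨δ, hδ1, hδ2⟩ := exists_sorted_mul b ρ
    refine ⟨⟨⟨ρ * δ, hδ2⟩, QuotientGroup.mk ⟨u, hu⟩⟩, ?_⟩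
    refine QuotientGroup.eq.2 ?_
    simp only [permGL_mul]
    have h1 : permGL F δ ∈ blockSubgroup F b := permGL_mem_blockSubgroup.2 hδ1
    have h2 := borelB_le_blockSubgroup hb ht
    convert mul_mem (inv_mem h1) h2 using 1
    group

/-- The index is the sum of the orbit sizes [U : stabU ρ]. The substitution ρ = w₀σ⁻¹ turns each
into |stabU σ| and "ρ increases on blocks" into "σ⁻¹ reverses the simple roots in the support of c".
-/
theorem index_blockSubgroup (hb : Monotone b) {c : Fin n → F}
    (hc : ∀ i j : Fin n, (i : ℕ) + 1 = j → (c i ≠ 0 ↔ b i = b j)) :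
    (blockSubgroup F b).index = formVal F c := by
  classical
  have : Fintype (IncOn b) := by unfold IncOn; infer_instance
  rw [Subgroup.index, ← Nat.card_congr (Equiv.ofBijective _ (orbitMap_bijective hb)), Nat.card_sigma,
    formVal]
  symm
  have hgood : ∀ σ : Equiv.Perm (Fin n),
      (∀ i j : Fin n, (i : ℕ) + 1 = j → c i ≠ 0 → σ⁻¹ j < σ⁻¹ i) →
      ∀ i j, i < j → b i = b j →
        (Fin.revPerm * σ⁻¹ : Equiv.Perm (Fin n)) i < (Fin.revPerm * σ⁻¹ : Equiv.Perm (Fin n)) j := by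
    intro σ hσ
    have key : ∀ d : ℕ, ∀ i j : Fin n, (i : ℕ) + d + 1 = j → b i = b j → σ⁻¹ j < σ⁻¹ i := by
      intro d
      induction d with
      | zero => intro i j hij hbij; exact hσ i j (by omega) ((hc i j (by omega)).2 hbij)
      | succ d ih =>
        intro i j hij hbij
        have hk : (i : ℕ) + d + 1 < n := by omega
        have h1 : b i ≤ b ⟨_, hk⟩ := hb (by rw [Fin.le_def]; simp; omega)
        have h2 : b ⟨_, hk⟩ ≤ b j := hb (by rw [Fin.le_def]; simp; omega)
        have h3 : b i = b ⟨_, hk⟩ := le_antisymm h1 (hbij ▸ h2)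
        have h4 : ((⟨_, hk⟩ : Fin n) : ℕ) + 1 = j := by simp; omega
        exact (hσ _ j h4 ((hc _ j h4).2 (h3 ▸ hbij))).trans (ih i ⟨_, hk⟩ rfl h3)
    intro i j hij hbij
    have hij' : (i : ℕ) < j := hij
    rw [Equiv.Perm.mul_apply, Equiv.Perm.mul_apply, Fin.revPerm_apply, Fin.revPerm_apply,
      Fin.rev_lt_rev]
    exact key (j - i - 1) i j (by omega) hbij
  refine Finset.sum_bij' (fun σ hσ => ⟨Fin.revPerm * σ⁻¹, hgood σ (by simpa using hσ)⟩)
    (fun ρ _ => ρ.1⁻¹ * Fin.revPerm) ?_ ?_ ?_ ?_ ?_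
  · intro σ _; exact Finset.mem_univ _
  · intro ρ _
    rw [Finset.mem_filter]
    refine ⟨Finset.mem_univ _, fun i j hij hci => ?_⟩
    have hlt : i < j := by rw [Fin.lt_def]; omega
    have := ρ.2 i j hlt ((hc i j hij).1 hci)
    rw [_root_.mul_inv_rev, inv_inv, Equiv.Perm.mul_apply, Equiv.Perm.mul_apply]
    change Fin.revPerm.symm _ < Fin.revPerm.symm _
    rw [Fin.revPerm_symm, Fin.revPerm_apply, Fin.revPerm_apply, Fin.rev_lt_rev]
    exact this
  · intro σ _
    simp
  · intro ρ _
    apply Subtype.ext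
    simp
  · intro σ _
    exact (index_stabU σ).symm

end Index

/-! ### Comparing the submodules generated by eigenvectors of `U` -/

section Torus

variable {n : ℕ} {F : Type*} [Field F] [Fintype F] {R : Type*} [CommRing R]

/-- Conjugation by a suitable diagonal t carries one character to the other, and t fixes ê. -/
theorem charE_mem_span_of_support_eq (ψ : AddChar F R) {c c' : Fin n → F}
    (h : ∀ i j : Fin n, (i : ℕ) + 1 = j → (c i = 0 ↔ c' i = 0)) :
    charE (supChar ψ c') ∈ Submodule.span (RG n F R) {charE (supChar ψ c)} := by
  classical
  -- r k is the required quotient of consecutive diagonal entries of t, set to 1 where nothing is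
  -- required; the entries d are its partial products.
  let r : ℕ → F := fun k => if hk : k < n then (if c ⟨k, hk⟩ = 0 ∨ c' ⟨k, hk⟩ = 0 then 1
    else c' ⟨k, hk⟩ / c ⟨k, hk⟩) else 1
  have hr : ∀ k, r k ≠ 0 := by
    intro k
    simp only [r]
    split_ifs with h1 h2
    · exact one_ne_zero
    · push Not at h2; exact div_ne_zero h2.2 h2.1
    · exact one_ne_zero
  let d : ℕ → F := fun k => ∏ i ∈ Finset.range k, r i
  have hd : ∀ k, d k ≠ 0 := fun k => Finset.prod_ne_zero_iff.2 fun i _ => hr i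
  have hdet : (Matrix.diagonal fun i : Fin n => d i).det ≠ 0 := by
    rw [det_diagonal]
    exact Finset.prod_ne_zero_iff.2 fun i _ => hd i
  set t : GL (Fin n) F := GeneralLinearGroup.mkOfDetNeZero _ hdet with ht
  have htc : (t : Matrix (Fin n) (Fin n) F) = Matrix.diagonal fun i : Fin n => d i := rfl
  have hconj : ∀ (g : GL (Fin n) F) (i j : Fin n),
      (t * g * t⁻¹ : GL (Fin n) F) i j * d j = d i * g i j := by
    intro g i j
    have h1 : (t * g * t⁻¹) * t = t * g := by group
    have h2 := congrArg (fun x : GL (Fin n) F => (x : Matrix (Fin n) (Fin n) F) i j) h1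
    simp only [Units.val_mul _ t] at h2
    rw [Units.val_mul t g, htc, mul_diagonal, diagonal_mul] at h2
    exact h2
  have hU : ∀ u : unitri n F, t * (u : GL (Fin n) F) * t⁻¹ ∈ unitri n F := by
    intro u
    rw [mem_unitri]
    refine ⟨fun i j hij => ?_, fun i => ?_⟩
    · have := hconj u i j
      rw [(mem_unitri.1 u.2).1 i j hij, mul_zero] at this
      exact (mul_eq_zero.1 this).resolve_right (hd _)
    · have := hconj u i i
      rw [(mem_unitri.1 u.2).2 i, mul_one] at this
      exact (mul_eq_right₀ (hd _)).1 this
  refine Submodule.mem_span_singleton.2 ⟨MonoidAlgebra.single t 1, ?_⟩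
  rw [smul_eq_mul, charE, charE, Finset.mul_sum]
  let φ : unitri n F → unitri n F := fun u => ⟨_, hU u⟩
  have hφ : Function.Bijective φ := by
    refine Finite.injective_iff_bijective.1 fun u v huv => ?_
    have := congrArg (fun x : unitri n F => (x : GL (Fin n) F)) huv
    simp only [φ, mul_left_inj, mul_right_inj] at this
    exact Subtype.ext this
  refine Fintype.sum_bijective φ hφ _ _ fun u => ?_
  have h1 : (supChar ψ c' (φ u) : R) = supChar ψ c u := by
    rw [supChar_apply, supChar_apply]
    congr 1
    refine supSum_congr fun i j hij => ?_
    have h2 := hconj u i j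
    have h3 : d j = d i * r i := by
      simp only [d]; rw [← hij, Finset.prod_range_succ]
    rw [h3, mul_comm (d (i : ℕ)), ← mul_assoc, mul_comm (d (i : ℕ))] at h2
    have h4 := mul_right_cancel₀ (hd _) h2
    change c' i * (t * (u : GL (Fin n) F) * t⁻¹ : GL (Fin n) F) i j = _
    rw [← h4]
    have h5 : r i = if c i = 0 ∨ c' i = 0 then 1 else c' i / c i := by
      simp only [r, i.2, dif_pos]
    rw [h5]
    have h6 := h i j hij
    split_ifs with h7
    · have : c i = 0 := by tauto
      rw [this, h6.1 this, zero_mul, zero_mul]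
    · push Not at h7
      have := h7.1
      field_simp
  rw [h1, ← mul_assoc, MonoidAlgebra.single_mul_single, one_mul]
  have h2 : steinbergElt n F R = MonoidAlgebra.single t (1 : R) * steinbergElt n F R :=
    (diag_mul_steinbergElt fun i j hij => by rw [htc, diagonal_apply_ne _ hij]).symm
  nth_rw 2 [h2]
  rw [← mul_assoc, MonoidAlgebra.single_mul_single, mul_one]
  congr 2
  simp only [φ]
  group

end Torus

/-! ### Moving eigenvectors by permutation matrices -/

section Key

variable {n : ℕ} {F : Type*} [Field F]

/-- The block diagonal part of an element of `U`. -/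
noncomputable def blockPart (b : Fin n → ℕ) (v : unitri n F) : unitri n F :=
  unitriMk (Matrix.of fun i j => if b i = b j then (v : GL (Fin n) F) i j else 0)
    ⟨fun i j hij => by
      have h := (mem_unitri.1 v.2).1 i j hij
      rw [of_apply, h, ite_self], fun i => by
      rw [of_apply, if_pos rfl, (mem_unitri.1 v.2).2]⟩

theorem blockPart_apply (b : Fin n → ℕ) (v : unitri n F) (i j : Fin n) :
    (blockPart b v : GL (Fin n) F) i j = if b i = b j then (v : GL (Fin n) F) i j else 0 := rfl

/-- Levi decomposition: removing the block diagonal part of v leaves an element of the unipotent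
radical. -/
theorem blockPart_inv_mul_apply (b : Fin n → ℕ) (v : unitri n F) {i j : Fin n} (hij : b i = b j)
    (hne : i ≠ j) :
    (((blockPart b v)⁻¹ * v : unitri n F) : GL (Fin n) F) i j = 0 := by
  have h1 : (blockPart b v : GL (Fin n) F) ∈ blockSubgroup F b := by
    rw [mem_blockSubgroup]
    intro k l hkl
    rw [blockPart_apply, if_neg hkl.ne']
  -- Block lower triangularity is block upper triangularity for the dual order; both together make
  -- the inverse block diagonal.
  have h2 : (blockPart b v : GL (Fin n) F) ∈ blockSubgroup F (OrderDual.toDual ∘ b) := by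
    rw [mem_blockSubgroup]
    intro k l hkl
    rw [blockPart_apply, if_neg (fun h => by simp [h] at hkl)]
  have h3 : ∀ k l, b k ≠ b l → ((blockPart b v : GL (Fin n) F)⁻¹ : GL (Fin n) F) k l = 0 := by
    intro k l hkl
    rcases lt_or_gt_of_ne hkl with h | h
    · exact mem_blockSubgroup.1 (inv_mem h2) k l h
    · exact mem_blockSubgroup.1 (inv_mem h1) k l h
  have h4 : ((blockPart b v : GL (Fin n) F)⁻¹ * (blockPart b v : GL (Fin n) F) : GL (Fin n) F) i j
      = 0 := by rw [inv_mul_cancel, Units.val_one, one_apply_ne hne]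
  rw [Subgroup.coe_mul, Subgroup.coe_inv, ← h4, Units.val_mul, Units.val_mul, Matrix.mul_apply,
    Matrix.mul_apply]
  refine Finset.sum_congr rfl fun m _ => ?_
  by_cases hm : b i = b m
  · rw [blockPart_apply, if_pos (hm.symm.trans hij)]
  · rw [h3 i m hm, zero_mul, zero_mul]

variable {b : Fin n → ℕ} {π : Equiv.Perm (Fin n)}

/-- `hA` says that π translates each block, so it preserves the order inside blocks. -/
theorem blockPart_conj_mem (hA : ∀ i j, b i = b j → (π j : ℕ) + i = π i + j) (v : unitri n F) :
    permGL F π * (blockPart b v : GL (Fin n) F) * (permGL F π)⁻¹ ∈ unitri n F := by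
  rw [mem_unitri]
  refine ⟨fun k l hlk => ?_, fun k => ?_⟩
  · rw [permGL_conj_apply]
    by_cases h : b (π⁻¹ k) = b (π⁻¹ l)
    · refine (mem_unitri.1 (blockPart b v).2).1 _ _ ?_
      have h1 := hA _ _ h
      rw [← Equiv.Perm.mul_apply, ← Equiv.Perm.mul_apply, mul_inv_cancel, Equiv.Perm.one_apply,
        Equiv.Perm.one_apply] at h1
      have h2 : (l : ℕ) < k := hlk
      rw [Fin.lt_def]
      omega
    · rw [blockPart_apply, if_neg h]
  · rw [permGL_conj_apply, (mem_unitri.1 (blockPart b v).2).2]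

/-- A translation of a block matches superdiagonal positions with superdiagonal positions, and c' is
c transported along π, with zeros at the block boundaries. -/
theorem supSum_blockPart_conj (hA : ∀ i j, b i = b j → (π j : ℕ) + i = π i + j) {c c' : Fin n → F}
    (hC : ∀ i j : Fin n, (i : ℕ) + 1 = j → c' i = if b i = b j then c (π i) else 0)
    (v : unitri n F) :
    supSum c (permGL F π * (blockPart b v : GL (Fin n) F) * (permGL F π)⁻¹ : GL (Fin n) F)
      = supSum c' (v : GL (Fin n) F) := by
  rw [supSum, supSum, ← Equiv.sum_comp π]
  refine Finset.sum_congr rfl fun i _ => ?_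
  rw [← Equiv.sum_comp π]
  refine Finset.sum_congr rfl fun j _ => ?_
  rw [permGL_conj_apply, ← Equiv.Perm.mul_apply, ← Equiv.Perm.mul_apply, inv_mul_cancel,
    Equiv.Perm.one_apply, Equiv.Perm.one_apply, blockPart_apply]
  by_cases h : b i = b j
  · have h1 := hA i j h
    by_cases hij : (i : ℕ) + 1 = j
    · rw [if_pos hij, if_pos (by omega), if_pos h, hC i j hij, if_pos h]
    · rw [if_neg hij, if_neg (by omega)]
  · rw [if_neg h, mul_zero, ite_self]
    split_ifs with hij
    · rw [hC i j hij, if_neg h, zero_mul]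
    · rfl

variable [Fintype F] {R : Type*} [CommRing R] [IsDomain R] {ψ : AddChar F R}

/-- By multiplicity one, the projection of π⁻¹E_χ for χ' is κE_χ'. Its coefficient at ρ, the
reversal of every block, is |U| times the coefficient of E_χ at πρ. The latter is ± a power of q, so
κ is a unit. -/
theorem charE_mem_span_of_perm (hψ : ψ ≠ 1) (hq : IsUnit (Fintype.card F : R)) (hb : Monotone b)
    (hA : ∀ i j, b i = b j → (π j : ℕ) + i = π i + j) {c c' : Fin n → F}
    (hB : ∀ i j : Fin n, (i : ℕ) + 1 = j → c i ≠ 0 → b (π⁻¹ j) ≤ b (π⁻¹ i))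
    (hC : ∀ i j : Fin n, (i : ℕ) + 1 = j → c' i = if b i = b j then c (π i) else 0) :
    charE (supChar ψ c') ∈ Submodule.span (RG n F R) {charE (supChar ψ c)} := by
  classical
  obtain ⟨ρ, hρ1, hρ2⟩ := exists_sorted_mul b Fin.revPerm
  simp only [Fin.revPerm_apply, Fin.rev_lt_rev] at hρ2
  have hρ3 : ∀ i, b (ρ⁻¹ i) = b i := fun i => by rw [← hρ1]; simp
  set χ := supChar ψ c with hχ
  set χ' := supChar ψ c' with hχ'
  have hmem : MonoidAlgebra.single (permGL F π⁻¹) (1 : R) * charE χ ∈ latI n F R :=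
    Submodule.smul_mem _ _ (charE_mem χ)
  obtain ⟨κ, hκ⟩ := exists_charProj_eq_smul χ' hmem
  -- Split v into its block diagonal part and an element of the unipotent radical. The latter is
  -- absorbed on the right, because its conjugate by ρ⁻¹ stays in B; the former becomes, after
  -- conjugation by π, an element w of U with χ(w) = χ'(v).
  have hterm : ∀ v : unitri n F, (charE χ).coeff (permGL F π * ((v : GL (Fin n) F) * permGL F ρ))
      = (χ' v : R) * (charE χ).coeff (permGL F (π * ρ)) := by
    intro v
    set w : unitri n F := ⟨_, blockPart_conj_mem hA v⟩ with hw
    set t : GL (Fin n) F := (permGL F ρ)⁻¹ * (((blockPart b v)⁻¹ * v : unitri n F) : GL (Fin n) F) *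
      permGL F ρ with ht
    have htB : t ∈ borelB n F := by
      rw [mem_borelB]
      intro k l hlk
      rw [ht, permGL_inv_mul_mul_apply]
      by_cases hbkl : b k = b l
      · exact blockPart_inv_mul_apply b v (by rw [hρ1, hρ1, hbkl])
          fun h => hlk.ne' (ρ.injective h)
      · refine (mem_unitri.1 ((blockPart b v)⁻¹ * v).2).1 _ _ ?_
        have h1 : b l < b k := lt_of_le_of_ne (hb hlk.le) (Ne.symm hbkl)
        by_contra h2
        have h3 := hb (not_lt.1 h2)
        rw [hρ1, hρ1] at h3
        exact absurd h1 h3.not_gt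
    have h1 : permGL F π * ((v : GL (Fin n) F) * permGL F ρ)
        = (w : GL (Fin n) F) * permGL F (π * ρ) * t := by
      rw [hw, ht, permGL_mul]
      simp only [Subgroup.coe_mul, Subgroup.coe_inv]
      group
    rw [h1, charE_coeff_mul χ _ htB, charE_coeff_unitri_mul]
    congr 1
    rw [hχ, hχ', supChar_apply, supChar_apply, hw, supSum_blockPart_conj hA hC]
  have hcoeff := congrArg (fun x : RG n F R => x.coeff (permGL F ρ)) hκ
  simp only [charProj, MonoidAlgebra.coeff_sum, Finsupp.finsetSum_apply,
    MonoidAlgebra.coeff_single_mul_apply, one_mul, MonoidAlgebra.coeff_smul, Finsupp.smul_apply,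
    smul_eq_mul, permGL_inv, inv_inv] at hcoeff
  have hterm' : ∀ u : unitri n F, (χ' u : R) * (charE χ).coeff (permGL F π *
      ((u : GL (Fin n) F)⁻¹ * permGL F ρ)) = (charE χ).coeff (permGL F (π * ρ)) := by
    intro u
    have := hterm u⁻¹
    rw [Subgroup.coe_inv] at this
    rw [this, ← mul_assoc, ← Units.val_mul, ← map_mul, mul_inv_cancel, map_one, Units.val_one,
      one_mul]
  simp only [hterm'] at hcoeff
  -- (πρ)⁻¹ reverses every simple root in the support of c: `hB` settles pairs coming from different
  -- blocks, the block reversal ρ those from the same block.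
  have hgood : ∀ i j : Fin n, (i : ℕ) + 1 = j → c i ≠ 0 → (π * ρ)⁻¹ j < (π * ρ)⁻¹ i := by
    intro i j hij hci
    rw [_root_.mul_inv_rev, Equiv.Perm.mul_apply, Equiv.Perm.mul_apply]
    have h1 := hB i j hij hci
    rcases h1.lt_or_eq with h | h
    · by_contra hle
      have h2 := hb (not_lt.1 hle)
      rw [hρ3, hρ3] at h2
      exact absurd h h2.not_gt
    · have h2 := hA _ _ h
      rw [← Equiv.Perm.mul_apply, ← Equiv.Perm.mul_apply, mul_inv_cancel, Equiv.Perm.one_apply,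
        Equiv.Perm.one_apply] at h2
      by_contra hle
      have hlt : π⁻¹ i < π⁻¹ j := by rw [Fin.lt_def]; omega
      have h3 := lt_of_le_of_ne (not_lt.1 hle) fun h' => hlt.ne (ρ⁻¹.injective h')
      have h4 := hρ2 _ _ h3 (by rw [hρ3, hρ3, h])
      have h5 : ∀ x, ρ (ρ⁻¹ x) = x := fun x => by simp
      rw [h5, h5] at h4
      exact absurd hlt h4.not_gt
  rw [charE_coeff_permGL χ, hχ, sum_stabU hψ, if_pos hgood, Finset.sum_const, Finset.card_univ,
    ← Nat.card_eq_fintype_card, card_unitri, card_stabU, nsmul_eq_mul,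
    ← Int.cast_smul_eq_zsmul R, smul_eq_mul] at hcoeff
  have hunit : IsUnit κ := by
    refine isUnit_of_mul_isUnit_left (y := (charE χ').coeff (permGL F ρ)) ?_
    rw [← hcoeff]
    push_cast
    refine (hq.pow _).mul (IsUnit.mul ?_ (hq.pow _))
    exact ((Equiv.Perm.sign (π * ρ)).isUnit).map (Int.castRingHom R)
  obtain ⟨κ, rfl⟩ := hunit
  refine Submodule.mem_span_singleton.2
    ⟨((κ⁻¹ : Rˣ) : R) • (charProj χ' 1 * MonoidAlgebra.single (permGL F π⁻¹) 1), ?_⟩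
  rw [smul_eq_mul, smul_mul_assoc, mul_assoc, ← charProj_eq_mul, hκ, smul_smul, Units.inv_mul,
    one_smul]

end Key

/-! ### Reversing the inclusions -/

section Reverse

variable {n : ℕ} {F : Type*} [Field F] [Fintype F] {R : Type*} [CommRing R]

theorem canForm_single_mul_right (g : GL (Fin n) F) (x y : RG n F R) :
    canForm x (MonoidAlgebra.single g 1 * y) = canForm (MonoidAlgebra.single g⁻¹ 1 * x) y := by
  rw [canForm_comm, canForm_single_mul, one_mul, canForm_comm]

theorem canForm_charE_single_mul (χ : unitri n F →* Rˣ) (u : unitri n F) (y : RG n F R) :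
    canForm (charE χ) (MonoidAlgebra.single (u : GL (Fin n) F) 1 * y)
      = (χ u : R) * canForm (charE χ) y := by
  have h := single_mul_charProj χ u⁻¹ (steinbergElt n F R)
  rw [← charE_eq, inv_inv, Subgroup.coe_inv] at h
  rw [canForm_single_mul_right, h, canForm_smul_left]

/-- I is spanned by U-translates of ê, and translating by u only multiplies the value at E_χ by
χ(u). So the value at ê decides which I(c) contains E_χ. -/
theorem exists_canForm_charE_eq (χ : unitri n F →* Rˣ) {y : RG n F R} (hy : y ∈ latI n F R) :
    ∃ r, canForm (charE χ) y = r * canForm (charE χ) (steinbergElt n F R) := by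
  have hy' := mem_spanU_of_mem_latI hy
  clear hy
  induction hy' using Submodule.span_induction with
  | zero => exact ⟨0, by rw [canForm_zero_right, zero_mul]⟩
  | add x y _ _ hx hy =>
    obtain ⟨r, hr⟩ := hx
    obtain ⟨s, hs⟩ := hy
    exact ⟨r + s, by rw [canForm_add_right, hr, hs, add_mul]⟩
  | smul a x _ hx =>
    obtain ⟨r, hr⟩ := hx
    exact ⟨a * r, by rw [canForm_smul_right, hr, mul_assoc]⟩
  | mem x hx =>
    obtain ⟨u, rfl⟩ := hx
    exact ⟨_, canForm_charE_single_mul χ u _⟩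

/-- The adjoint of a is its image under g ↦ g⁻¹; only membership of the result in RG·y is needed. -/
theorem exists_adjoint (a x y : RG n F R) :
    ∃ z ∈ Submodule.span (RG n F R) {y}, canForm (a * x) y = canForm x z := by
  induction a using MonoidAlgebra.induction_linear with
  | zero => exact ⟨0, zero_mem _, by rw [zero_mul, canForm_zero_right, canForm_comm,
      canForm_zero_right]⟩
  | add a b ha hb =>
    obtain ⟨z, hz, hz'⟩ := ha
    obtain ⟨w, hw, hw'⟩ := hb
    exact ⟨z + w, add_mem hz hw, by rw [add_mul, canForm_add, hz', hw', canForm_add_right]⟩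
  | single g r =>
    refine ⟨MonoidAlgebra.single g⁻¹ r * y, Submodule.mem_span_singleton.2 ⟨_, rfl⟩, ?_⟩
    rw [canForm_single_mul, single_eq_smul g⁻¹ r, smul_mul_assoc, canForm_smul_right]

theorem canForm_single_mul_right' (g : GL (Fin n) F) (r : R) (x y : RG n F R) :
    canForm x (MonoidAlgebra.single g r * y)
      = r * canForm x (MonoidAlgebra.single g 1 * y) := by
  rw [single_eq_smul, smul_mul_assoc, canForm_smul_right]

theorem canForm_charProj_neg (ψ : AddChar F R) (c : Fin n → F) (z y : RG n F R) :
    canForm (charProj (supChar ψ (-c)) z) y = canForm z (charProj (supChar ψ c) y) := by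
  classical
  rw [charProj, charProj, canForm_sum_left, canForm_sum_right]
  refine Fintype.sum_equiv (Equiv.inv _) _ _ fun u => ?_
  rw [canForm_single_mul, Equiv.inv_apply, Subgroup.coe_inv, supChar_neg,
    canForm_single_mul_right' _ ((supChar ψ c u⁻¹ : Rˣ) : R)]

variable [IsDomain R] [CharZero R] {ψ : AddChar F R}

/-- If `E_χ'` is a multiple of `E_χ`, and the values of the form agree up to units, then `E_χ` is a
multiple of `E_χ'`. -/
theorem charE_mem_span_symm (hψ : ψ ≠ 1) (hq : IsUnit (Fintype.card F : R)) {c c' : Fin n → F}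
    (h : charE (supChar ψ c') ∈ Submodule.span (RG n F R) {charE (supChar ψ c)})
    (hval : ∀ r : R, r * (formVal F c : R) = (formVal F c' : R) → IsUnit r) :
    charE (supChar ψ c) ∈ Submodule.span (RG n F R) {charE (supChar ψ c')} := by
  classical
  -- c and −c have the same support, so a character and its inverse generate the same submodule.
  have hneg : ∀ c : Fin n → F, charE (supChar ψ (-c))
      ∈ Submodule.span (RG n F R) {charE (supChar ψ c)} ∧ charE (supChar ψ c)
      ∈ Submodule.span (RG n F R) {charE (supChar ψ (-c))} := fun c =>
    ⟨charE_mem_span_of_support_eq ψ fun i j _ => by simp,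
      charE_mem_span_of_support_eq ψ fun i j _ => by simp⟩
  have htrans : ∀ {x y z : RG n F R}, x ∈ Submodule.span (RG n F R) {y} →
      y ∈ Submodule.span (RG n F R) {z} → x ∈ Submodule.span (RG n F R) {z} := fun hx hy =>
    (Submodule.span_singleton_le_iff_mem _ _).2 hy hx
  obtain ⟨a, ha⟩ := Submodule.mem_span_singleton.1 h
  obtain ⟨z, hz, hz'⟩ := exists_adjoint a (charE (supChar ψ c)) (charE (supChar ψ (-c')))
  rw [smul_eq_mul] at ha
  rw [ha] at hz'
  have hzI : z ∈ latI n F R :=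
    (Submodule.span_singleton_le_iff_mem _ _).2 (charE_mem _) hz
  obtain ⟨κ, hκ⟩ := exists_charProj_eq_smul (supChar ψ (-c)) hzI
  -- The same value of the form is computed twice: directly from E_χ', and in `hval2` by moving the
  -- projection onto z, which produces κ. Comparing both makes κ a unit.
  have hval1 : canForm (charE (supChar ψ c')) (charE (supChar ψ (-c')))
      = (Nat.card (unitri n F) : R) * ((Nat.card (borelB n F) : R) * (formVal F c' : R)) := by
    rw [charE_eq (supChar ψ (-c')), charProj, canForm_sum_right, Nat.card_eq_fintype_card,
      ← Finset.card_univ, ← nsmul_eq_mul, ← Finset.sum_const]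
    refine Finset.sum_congr rfl fun u _ => ?_
    rw [canForm_single_mul_right', canForm_charE_single_mul, supChar_neg,
      ← mul_assoc, ← Units.val_mul, ← map_mul, inv_mul_cancel, map_one, Units.val_one, one_mul,
      canForm_supChar hψ]
  have hval2 : canForm (charE (supChar ψ c)) z
      = κ * ((Nat.card (borelB n F) : R) * (formVal F c : R)) := by
    rw [canForm_comm, charE_eq, ← canForm_charProj_neg, hκ, canForm_smul_left,
      canForm_supChar hψ]
    -- `formVal` sees only the support, so it agrees for c and −c.
    simp [formVal]
  rw [hz', hval2] at hval1
  have hB : (Nat.card (borelB n F) : R) ≠ 0 := Nat.cast_ne_zero.2 Nat.card_pos.ne'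
  have hκu : IsUnit κ := by
    rw [card_unitri] at hval1
    push_cast at hval1
    obtain ⟨w, hw⟩ := hq.pow (nonInv (1 : Equiv.Perm (Fin n)))
    rw [← hw] at hval1
    have h1 : (((w⁻¹ : Rˣ) : R) * κ) * (formVal F c : R) = (formVal F c' : R) := by
      apply mul_left_cancel₀ hB
      have h2 : ((w⁻¹ : Rˣ) : R) * (w : R) = 1 := Units.inv_mul w
      linear_combination ((w⁻¹ : Rˣ) : R) * hval1 + (Nat.card (borelB n F) : R) *
        (formVal F c' : R) * h2
    exact isUnit_of_mul_isUnit_right (hval _ h1)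
  obtain ⟨κ, rfl⟩ := hκu
  refine htrans (hneg c).2 (htrans (y := z) ?_ (htrans hz (hneg c').1))
  refine Submodule.mem_span_singleton.2 ⟨((κ⁻¹ : Rˣ) : R) • charProj (supChar ψ (-c)) 1, ?_⟩
  rw [smul_eq_mul, smul_mul_assoc, ← charProj_eq_mul, hκ, smul_smul, Units.inv_mul, one_smul]

end Reverse

/-! ### Boundaries of lists of block sizes -/

/-- `k` is a partial sum of the list. -/
def IsBd : List ℕ → ℕ → Prop
  | [], k => k = 0
  | a :: l, k => k = 0 ∨ ∃ j, IsBd l j ∧ k = a + j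

theorem isBd_zero (l : List ℕ) : IsBd l 0 := by
  cases l with
  | nil => rfl
  | cons a l => exact Or.inl rfl

theorem IsBd.le_sum {l : List ℕ} {k : ℕ} (h : IsBd l k) : k ≤ l.sum := by
  induction l generalizing k with
  | nil => exact le_of_eq h
  | cons a l ih =>
    rcases h with rfl | ⟨j, hj, rfl⟩
    · exact Nat.zero_le _
    · have := ih hj
      simp only [List.sum_cons]
      omega

theorem isBd_sum (l : List ℕ) : IsBd l l.sum := by
  induction l with
  | nil => rfl
  | cons a l ih => exact Or.inr ⟨_, ih, by simp⟩

theorem isBd_append {l l' : List ℕ} {k : ℕ} :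
    IsBd (l ++ l') k ↔ IsBd l k ∨ ∃ j, IsBd l' j ∧ k = l.sum + j := by
  induction l generalizing k with
  | nil =>
    simp only [List.nil_append, IsBd, List.sum_nil, zero_add]
    constructor
    · intro h; exact Or.inr ⟨k, h, rfl⟩
    · rintro (rfl | ⟨j, hj, rfl⟩)
      · exact isBd_zero _
      · exact hj
  | cons a l ih =>
    simp only [List.cons_append, IsBd, ih, List.sum_cons]
    constructor
    · rintro (rfl | ⟨j, hj | ⟨i, hi, rfl⟩, rfl⟩)
      · exact Or.inl (Or.inl rfl)
      · exact Or.inl (Or.inr ⟨j, hj, rfl⟩)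
      · exact Or.inr ⟨i, hi, by omega⟩
    · rintro ((rfl | ⟨j, hj, rfl⟩) | ⟨j, hj, rfl⟩)
      · exact Or.inl rfl
      · exact Or.inr ⟨j, Or.inl hj, rfl⟩
      · exact Or.inr ⟨l.sum + j, Or.inr ⟨j, hj, rfl⟩, by omega⟩

theorem isBd_iff_take {l : List ℕ} {k : ℕ} : IsBd l k ↔ ∃ m, k = (l.take m).sum := by
  induction l generalizing k with
  | nil => simp [IsBd]
  | cons a l ih =>
    simp only [IsBd, ih]
    constructor
    · rintro (rfl | ⟨j, ⟨m, rfl⟩, rfl⟩)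
      · exact ⟨0, by simp⟩
      · exact ⟨m + 1, by simp⟩
    · rintro ⟨m, rfl⟩
      cases m with
      | zero => exact Or.inl (by simp)
      | succ m => exact Or.inr ⟨_, ⟨m, rfl⟩, by simp⟩

open Classical in
/-- The number of the block that contains `i`. -/
noncomputable def bdIdx (l : List ℕ) (i : ℕ) : ℕ := ((Finset.range (i + 1)).filter (IsBd l)).card

open Classical in
theorem bdIdx_mono (l : List ℕ) : Monotone (bdIdx l) := fun i j hij =>
  Finset.card_le_card (Finset.filter_subset_filter _ (Finset.range_mono (by omega)))

theorem bdIdx_lt_iff {l : List ℕ} {i j : ℕ} :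
    bdIdx l i < bdIdx l j ↔ ∃ k, IsBd l k ∧ i < k ∧ k ≤ j := by
  classical
  constructor
  · intro h
    by_contra! hcon
    refine absurd h (not_lt.2 (Finset.card_le_card fun k hk => ?_))
    simp only [Finset.mem_filter, Finset.mem_range] at hk ⊢
    refine ⟨?_, hk.2⟩
    by_contra hlt
    exact absurd (hcon k hk.2 (by omega)) (by omega)
  · rintro ⟨k, hk, hik, hkj⟩
    refine Finset.card_lt_card ⟨Finset.filter_subset_filter _ (Finset.range_mono (by omega)),
      fun h => ?_⟩
    have := h (x := k) (by simp only [Finset.mem_filter, Finset.mem_range]; exact ⟨by omega, hk⟩)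
    simp only [Finset.mem_filter, Finset.mem_range] at this
    omega

theorem bdIdx_eq_iff {l : List ℕ} {i j : ℕ} (hij : i ≤ j) :
    bdIdx l i = bdIdx l j ↔ ∀ k, i < k → k ≤ j → ¬ IsBd l k := by
  have h := bdIdx_mono l hij
  rw [← not_iff_not, ← Ne, ← lt_iff_le_and_ne.trans (and_iff_right h), bdIdx_lt_iff]
  push Not
  exact ⟨fun ⟨k, h1, h2, h3⟩ => ⟨k, h2, h3, h1⟩, fun ⟨k, h1, h2, h3⟩ => ⟨k, h3, h1, h2⟩⟩

theorem index_lt_iff {n : ℕ} (P : Composition n) {i j : Fin n} :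
    P.index i < P.index j ↔ ∃ k, IsBd P.blocks k ∧ (i : ℕ) < k ∧ k ≤ j := by
  constructor
  · intro h
    refine ⟨P.sizeUpTo (P.index j), isBd_iff_take.2 ⟨_, rfl⟩, ?_, P.sizeUpTo_index_le j⟩
    exact (P.lt_sizeUpTo_index_succ i).trans_le (P.monotone_sizeUpTo h)
  · rintro ⟨k, hk, hik, hkj⟩
    obtain ⟨m, rfl⟩ := isBd_iff_take.1 hk
    have h1 : (P.index i : ℕ) < m := by
      by_contra hle
      exact absurd (P.monotone_sizeUpTo (not_lt.1 hle))
        (not_le.2 ((P.sizeUpTo_index_le i).trans_lt hik))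
    have h2 : m ≤ P.index j := by
      by_contra hlt
      exact absurd (P.monotone_sizeUpTo (not_le.1 hlt))
        (not_le.2 (hkj.trans_lt (P.lt_sizeUpTo_index_succ j)))
    exact h1.trans_le h2

theorem index_mono {n : ℕ} (P : Composition n) : Monotone P.index := by
  intro i j hij
  by_contra h
  obtain ⟨k, -, h1, h2⟩ := (index_lt_iff P).1 (not_le.1 h)
  have : (i : ℕ) ≤ j := hij
  omega

theorem index_eq_iff {n : ℕ} (P : Composition n) {i j : Fin n} (hij : (i : ℕ) + 1 = j) :
    P.index i = P.index j ↔ ¬ IsBd P.blocks (i + 1) := by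
  have h : P.index i ≤ P.index j := index_mono P (by rw [Fin.le_def]; omega)
  rw [← not_iff_not, ← Ne, ← lt_iff_le_and_ne.trans (and_iff_right h), index_lt_iff, not_not]
  constructor
  · rintro ⟨k, hk, h1, h2⟩
    rwa [show (i : ℕ) + 1 = k by omega]
  · intro h
    exact ⟨_, h, by omega, by omega⟩

/-- The vector `c` vanishes exactly at the block boundaries. -/
def GenFor {n : ℕ} {F : Type*} [Field F] (l : List ℕ) (c : Fin n → F) : Prop :=
  ∀ i j : Fin n, (i : ℕ) + 1 = j → (c i ≠ 0 ↔ ¬ IsBd l (i + 1))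

theorem exists_genFor (n : ℕ) (F : Type*) [Field F] (l : List ℕ) : ∃ c : Fin n → F, GenFor l c := by
  classical
  refine ⟨fun i => if IsBd l (i + 1) then 0 else 1, fun i j _ => ?_⟩
  by_cases h : IsBd l (i + 1) <;> simp [h]

theorem parabolic_le_of_isBd {n : ℕ} {F : Type*} [Field F] {P Q : Composition n}
    (h : ∀ k, IsBd P.blocks k → IsBd Q.blocks k) : parabolic F Q ≤ parabolic F P := by
  intro g hg
  refine mem_blockSubgroup.2 fun i j hij => mem_blockSubgroup.1 hg i j ?_
  rw [index_lt_iff] at hij ⊢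
  obtain ⟨k, hk, h'⟩ := hij
  exact ⟨k, h k hk, h'⟩

/-! ### The parabolic subgroup of a character -/

section CharP

variable {n : ℕ} {F : Type*} [Field F] {R : Type*} [CommRing R] {ψ : AddChar F R}

theorem charJ_supChar (hψ : ψ ≠ 1) (c : Fin n → F) :
    charJ (supChar ψ c) = {s | ∃ i j : Fin n, (i : ℕ) + 1 = j ∧ c i ≠ 0 ∧ s = Equiv.swap i j} := by
  ext s
  constructor
  · rintro ⟨i, j, hij, rfl, u, ⟨a, ha⟩, hu⟩
    refine ⟨i, j, hij, fun hc => hu ?_, rfl⟩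
    apply Units.ext
    rw [supChar_apply, ha, supSum_transvection c hij, hc, zero_mul, AddChar.map_zero_eq_one,
      Units.val_one]
  · rintro ⟨i, j, hij, hc, rfl⟩
    have hlt : i < j := by rw [Fin.lt_def]; omega
    obtain ⟨a, ha⟩ := exists_rootElt_ne_one hψ hij hlt hc
    exact ⟨i, j, hij, rfl, _, ⟨a, rootElt_coe hlt a⟩, ha⟩

theorem charP_eq_parabolic_iff [Finite F] (hψ : ψ ≠ 1) (c : Fin n → F) (P : Composition n) :
    charP (supChar ψ c) = parabolic F P ↔ GenFor P.blocks c := by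
  classical
  constructor
  · intro h i j hij
    rw [← index_eq_iff P hij]
    constructor
    · intro hc
      have h1 : permGL F (Equiv.swap i j) ∈ charP (supChar ψ c) := by
        refine Subgroup.subset_closure (Or.inr ⟨_, ?_, rfl⟩)
        rw [charJ_supChar hψ]
        exact ⟨i, j, hij, hc, rfl⟩
      rw [h] at h1
      have h2 := permGL_mem_blockSubgroup.1 h1 j
      rwa [Equiv.swap_apply_right] at h2
    · intro hidx hc
      -- b counts the zeros of c before k. Its block subgroup contains P(χ), but not the swap of i
      -- and i + 1 when c i = 0.
      let b : Fin n → ℕ := fun k => (Finset.univ.filter fun m : Fin n => m < k ∧ c m = 0).card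
      have hb : Monotone b := fun k l hkl => Finset.card_le_card fun m => by
        simp only [Finset.mem_filter, Finset.mem_univ, true_and]
        exact fun hm => ⟨hm.1.trans_le hkl, hm.2⟩
      have h1 : charP (supChar ψ c) ≤ blockSubgroup F b := by
        rw [blockSubgroup_eq_closure hb, charP]
        refine Subgroup.closure_mono (Set.union_subset_union_right _ (Set.image_mono ?_))
        rw [charJ_supChar hψ]
        rintro s ⟨k, l, hkl, hck, rfl⟩
        refine ⟨k, l, hkl, ?_, rfl⟩
        simp only [b]
        congr 1
        ext m
        simp only [Finset.mem_filter, Finset.mem_univ, true_and, Fin.lt_def]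
        constructor
        · exact fun hm => ⟨by omega, hm.2⟩
        · intro hm
          refine ⟨?_, hm.2⟩
          have : m ≠ k := by rintro rfl; exact hck hm.2
          have : (m : ℕ) ≠ k := fun h => this (Fin.ext h)
          omega
      have h2 : permGL F (Equiv.swap i j) ∈ parabolic F P := by
        refine permGL_mem_blockSubgroup.2 fun k => ?_
        rcases eq_or_ne k i with rfl | hki
        · simp [hidx]
        rcases eq_or_ne k j with rfl | hkj
        · simp [hidx]
        rw [Equiv.swap_apply_of_ne_of_ne hki hkj]
      rw [← h] at h2
      have h3 := permGL_mem_blockSubgroup.1 (h1 h2) j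
      rw [Equiv.swap_apply_right] at h3
      refine absurd h3 (ne_of_lt (Finset.card_lt_card ⟨?_, fun hsub => ?_⟩))
      · intro m
        simp only [Finset.mem_filter, Finset.mem_univ, true_and, Fin.lt_def]
        exact fun hm => ⟨by omega, hm.2⟩
      · have := hsub (x := i) (by
          simp only [Finset.mem_filter, Finset.mem_univ, true_and, Fin.lt_def]
          exact ⟨by omega, hc⟩)
        simp at this
  · intro h
    rw [charP, parabolic, blockSubgroup_eq_closure (index_mono P), charJ_supChar hψ]
    congr 3
    ext s
    constructor
    · rintro ⟨i, j, hij, hc, rfl⟩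
      exact ⟨i, j, hij, (index_eq_iff P hij).2 ((h i j hij).1 hc), rfl⟩
    · rintro ⟨i, j, hij, hc, rfl⟩
      exact ⟨i, j, hij, (h i j hij).2 ((index_eq_iff P hij).1 hc), rfl⟩

end CharP

/-! ### Splitting and permuting blocks -/

/-- The permutation that exchanges the intervals `[s, s + a)` and `[s + a, s + a + b)`. -/
def shiftPerm (n s a b : ℕ) (h : s + a + b ≤ n) : Equiv.Perm (Fin n) where
  toFun i := ⟨if s ≤ i ∧ i < s + a then i + b else if s + a ≤ i ∧ i < s + a + b then i - a else i, by
    have := i.2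
    split_ifs <;> omega⟩
  invFun i := ⟨if s ≤ i ∧ i < s + b then i + a else if s + b ≤ i ∧ i < s + a + b then i - b else i, by
    have := i.2
    split_ifs <;> omega⟩
  left_inv i := by
    apply Fin.ext
    simp only
    split_ifs <;> omega
  right_inv i := by
    apply Fin.ext
    simp only
    split_ifs <;> omega

theorem shiftPerm_apply {n s a b : ℕ} (h : s + a + b ≤ n) (i : Fin n) :
    (shiftPerm n s a b h i : ℕ) = if s ≤ i ∧ (i : ℕ) < s + a then i + b
      else if s + a ≤ i ∧ (i : ℕ) < s + a + b then i - a else i := rfl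

theorem shiftPerm_inv_apply {n s a b : ℕ} (h : s + a + b ≤ n) (i : Fin n) :
    ((shiftPerm n s a b h)⁻¹ i : ℕ) = if s ≤ i ∧ (i : ℕ) < s + b then i + a
      else if s + b ≤ i ∧ (i : ℕ) < s + a + b then i - b else i := rfl

section Below

variable {n : ℕ} {F : Type*} [Field F] [Fintype F] {R : Type*} [CommRing R]

/-- Every eigenvector of type `l` generates an eigenvector of type `l'`. -/
def Below (n : ℕ) (ψ : AddChar F R) (l l' : List ℕ) : Prop :=
  ∀ c : Fin n → F, GenFor l c → ∃ c' : Fin n → F, GenFor l' c' ∧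
    charE (supChar ψ c') ∈ Submodule.span (RG n F R) {charE (supChar ψ c)}

variable {ψ : AddChar F R}

theorem Below.refl (l : List ℕ) : Below n ψ l l := fun c hc =>
  ⟨c, hc, Submodule.mem_span_singleton_self _⟩

theorem Below.trans {l l' l'' : List ℕ} (h : Below n ψ l l') (h' : Below n ψ l' l'') :
    Below n ψ l l'' := by
  intro c hc
  obtain ⟨c', hc', h1⟩ := h c hc
  obtain ⟨c'', hc'', h2⟩ := h' c' hc'
  exact ⟨c'', hc'', (Submodule.span_singleton_le_iff_mem _ _).2 h1 h2⟩

variable [IsDomain R]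

/-- Treats splitting and exchanging together: between s and s + a + b the list l' has the single
boundary s + a, while l has at most the boundary s + b. It has none when a block a + b is split, and
one when blocks b, a are exchanged. The permutation moves the first a indices of the interval behind
the other b. -/
theorem below_of_shift (hψ : ψ ≠ 1) (hq : IsUnit (Fintype.card F : R)) {s a b : ℕ} (ha : 0 < a)
    (hb : 0 < b) (hn : s + a + b ≤ n) {l l' : List ℕ}
    (h12 : ∀ k, IsBd l k → IsBd l' k ∨ k = s + b) (h21 : ∀ k, IsBd l' k → IsBd l k ∨ k = s + a)
    (h1 : ∀ k, IsBd l k → k ≤ s ∨ k = s + b ∨ s + a + b ≤ k)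
    (h2 : ∀ k, IsBd l' k → k ≤ s ∨ k = s + a ∨ s + a + b ≤ k)
    (hs : IsBd l' s) (hsa : IsBd l' (s + a)) (hsab : IsBd l' (s + a + b)) : Below n ψ l l' := by
  classical
  intro c hc
  set π := shiftPerm n s a b hn with hπ
  let B : Fin n → ℕ := fun i => bdIdx l' i
  have hB : Monotone B := fun i j hij => bdIdx_mono l' hij
  have hls : IsBd l s := (h21 s hs).resolve_right (by omega)
  have hlsab : IsBd l (s + a + b) := (h21 _ hsab).resolve_right (by omega)
  have hBadj : ∀ i j : Fin n, (i : ℕ) + 1 = j → (B i = B j ↔ ¬ IsBd l' (i + 1)) := by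
    intro i j hij
    rw [bdIdx_eq_iff (by omega)]
    constructor
    · intro h; exact h _ (by omega) (by omega)
    · intro h k hk1 hk2
      rwa [show k = (i : ℕ) + 1 by omega]
  have hA' : ∀ i j : Fin n, i ≤ j → B i = B j → (π j : ℕ) + i = π i + j := by
    intro i j hij hBij
    have hij' : (i : ℕ) ≤ j := hij
    rw [bdIdx_eq_iff hij'] at hBij
    have e1 : ¬ ((i : ℕ) < s ∧ s ≤ j) := fun h => hBij s h.1 h.2 hs
    have e2 : ¬ ((i : ℕ) < s + a ∧ s + a ≤ j) := fun h => hBij _ h.1 h.2 hsa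
    have e3 : ¬ ((i : ℕ) < s + a + b ∧ s + a + b ≤ j) := fun h => hBij _ h.1 h.2 hsab
    rw [hπ, shiftPerm_apply, shiftPerm_apply]
    split_ifs <;> omega
  let c' : Fin n → F := fun i => if IsBd l' (i + 1) then 0 else c (π i)
  refine ⟨c', ?_, charE_mem_span_of_perm (b := B) (π := π) hψ hq hB ?_ ?_ ?_⟩
  · intro i j hij
    simp only [c']
    split_ifs with h
    · simp [h]
    · simp only [h, not_false_eq_true, iff_true]
      have hi1 : (i : ℕ) + 1 ≠ s := fun h' => h (h' ▸ hs)
      have hi2 : (i : ℕ) + 1 ≠ s + a := fun h' => h (h' ▸ hsa)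
      have hi3 : (i : ℕ) + 1 ≠ s + a + b := fun h' => h (h' ▸ hsab)
      have hπi := shiftPerm_apply hn i
      rw [← hπ] at hπi
      have hlt : (π i : ℕ) + 1 < n := by
        have := j.2
        split_ifs at hπi <;> omega
      refine (hc (π i) ⟨_, hlt⟩ rfl).2 fun hbd => ?_
      have h3 := h1 _ hbd
      have h4 := h12 _ hbd
      by_cases hout : (i : ℕ) < s ∨ s + a + b ≤ i
      · have hπi' : (π i : ℕ) = i := by split_ifs at hπi <;> omega
        rw [hπi'] at h4 h3
        exact h (h4.resolve_right (by omega))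
      · split_ifs at hπi <;> omega
  · intro i j hij
    rcases le_total i j with h | h
    · exact hA' i j h hij
    · exact (hA' j i h hij.symm).symm
  · intro i j hij hci
    have hnb := (hc i j hij).1 hci
    have hi1 : (i : ℕ) + 1 ≠ s := fun h' => hnb (h' ▸ hls)
    have hi3 : (i : ℕ) + 1 ≠ s + a + b := fun h' => hnb (h' ▸ hlsab)
    have hπi := shiftPerm_inv_apply hn i
    have hπj := shiftPerm_inv_apply hn j
    rw [← hπ] at hπi hπj
    -- Reversal occurs only across s + b, and only when l has no boundary there. In all other cases
    -- the preimages are adjacent and lie in one block of l'.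
    by_cases hle : π⁻¹ j ≤ π⁻¹ i
    · exact hB hle
    · have hlt : (π⁻¹ i : ℕ) < π⁻¹ j := not_le.1 hle
      have hadj : (π⁻¹ i : ℕ) + 1 = π⁻¹ j := by
        split_ifs at hπi <;> split_ifs at hπj <;> omega
      refine le_of_eq ((hBadj _ _ hadj).2 fun hbd => ?_).symm
      have h3 := h2 _ hbd
      have h4 := h21 _ hbd
      by_cases hout : (i : ℕ) < s ∨ s + a + b ≤ i
      · have hπi' : (π⁻¹ i : ℕ) = i := by split_ifs at hπi <;> omega
        rw [hπi'] at h4 h3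
        rcases h4 with h4 | h4
        · exact hnb h4
        · omega
      · split_ifs at hπi <;> split_ifs at hπj <;> omega
  · intro i j hij
    simp only [c']
    by_cases h : IsBd l' (i + 1)
    · rw [if_pos h, if_neg fun h' => (hBadj i j hij).1 h' h]
    · rw [if_neg h, if_pos ((hBadj i j hij).2 h)]

theorem below_split (hψ : ψ ≠ 1) (hq : IsUnit (Fintype.card F : R)) {pre l : List ℕ} {a b : ℕ}
    (ha : 0 < a) (hb : 0 < b) (hn : (pre ++ (a + b) :: l).sum ≤ n) :
    Below n ψ (pre ++ (a + b) :: l) (pre ++ a :: b :: l) := by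
  simp only [List.sum_append, List.sum_cons] at hn
  refine below_of_shift (s := pre.sum) hψ hq ha hb (by omega) ?_ ?_ ?_ ?_ ?_ ?_ ?_
  all_goals simp only [isBd_append, IsBd]
  · rintro k (h | ⟨j, rfl | ⟨i, hi, rfl⟩, rfl⟩)
    · exact Or.inl (Or.inl h)
    · exact Or.inl (Or.inr ⟨0, Or.inl rfl, rfl⟩)
    · exact Or.inl (Or.inr ⟨_, Or.inr ⟨_, Or.inr ⟨i, hi, rfl⟩, rfl⟩, by omega⟩)
  · rintro k (h | ⟨j, rfl | ⟨i, rfl | ⟨m, hm, rfl⟩, rfl⟩, rfl⟩)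
    · exact Or.inl (Or.inl h)
    · exact Or.inl (Or.inr ⟨0, Or.inl rfl, rfl⟩)
    · exact Or.inr (by omega)
    · exact Or.inl (Or.inr ⟨_, Or.inr ⟨m, hm, rfl⟩, by omega⟩)
  · rintro k (h | ⟨j, rfl | ⟨i, hi, rfl⟩, rfl⟩)
    · exact Or.inl h.le_sum
    · omega
    · omega
  · rintro k (h | ⟨j, rfl | ⟨i, rfl | ⟨m, hm, rfl⟩, rfl⟩, rfl⟩)
    · exact Or.inl h.le_sum
    all_goals omega
  · exact Or.inl (isBd_sum _)
  · exact Or.inr ⟨a, Or.inr ⟨0, Or.inl rfl, rfl⟩, rfl⟩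
  · exact Or.inr ⟨a + b, Or.inr ⟨b, Or.inr ⟨0, isBd_zero _, rfl⟩, rfl⟩, by omega⟩

theorem below_swap (hψ : ψ ≠ 1) (hq : IsUnit (Fintype.card F : R)) {pre l : List ℕ} {a b : ℕ}
    (ha : 0 < a) (hb : 0 < b) (hn : (pre ++ b :: a :: l).sum ≤ n) :
    Below n ψ (pre ++ b :: a :: l) (pre ++ a :: b :: l) := by
  simp only [List.sum_append, List.sum_cons] at hn
  refine below_of_shift (s := pre.sum) hψ hq ha hb (by omega) ?_ ?_ ?_ ?_ ?_ ?_ ?_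
  all_goals simp only [isBd_append, IsBd]
  · rintro k (h | ⟨j, rfl | ⟨i, rfl | ⟨m, hm, rfl⟩, rfl⟩, rfl⟩)
    · exact Or.inl (Or.inl h)
    · exact Or.inl (Or.inr ⟨0, Or.inl rfl, rfl⟩)
    · exact Or.inr (by omega)
    · exact Or.inl (Or.inr ⟨_, Or.inr ⟨_, Or.inr ⟨m, hm, rfl⟩, rfl⟩, by omega⟩)
  · rintro k (h | ⟨j, rfl | ⟨i, rfl | ⟨m, hm, rfl⟩, rfl⟩, rfl⟩)
    · exact Or.inl (Or.inl h)
    · exact Or.inl (Or.inr ⟨0, Or.inl rfl, rfl⟩)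
    · exact Or.inr (by omega)
    · exact Or.inl (Or.inr ⟨_, Or.inr ⟨_, Or.inr ⟨m, hm, rfl⟩, rfl⟩, by omega⟩)
  · rintro k (h | ⟨j, rfl | ⟨i, rfl | ⟨m, hm, rfl⟩, rfl⟩, rfl⟩)
    · exact Or.inl h.le_sum
    all_goals omega
  · rintro k (h | ⟨j, rfl | ⟨i, rfl | ⟨m, hm, rfl⟩, rfl⟩, rfl⟩)
    · exact Or.inl h.le_sum
    all_goals omega
  · exact Or.inl (isBd_sum _)
  · exact Or.inr ⟨a, Or.inr ⟨0, Or.inl rfl, rfl⟩, rfl⟩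
  · exact Or.inr ⟨a + b, Or.inr ⟨b, Or.inr ⟨0, isBd_zero _, rfl⟩, rfl⟩, by omega⟩

theorem below_split_list (hψ : ψ ≠ 1) (hq : IsUnit (Fintype.card F : R)) {t : List ℕ}
    (ht : t ≠ []) (hpos : ∀ x ∈ t, 0 < x) {pre l : List ℕ} (hn : (pre ++ t.sum :: l).sum ≤ n) :
    Below n ψ (pre ++ t.sum :: l) (pre ++ t ++ l) := by
  induction t generalizing pre with
  | nil => exact absurd rfl ht
  | cons x t ih =>
    by_cases ht' : t = []
    · subst ht'
      simpa using Below.refl _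
    · have hx := hpos x List.mem_cons_self
      have hpos' : ∀ y ∈ t, 0 < y := fun y hy => hpos y (List.mem_cons_of_mem _ hy)
      have hsum : 0 < t.sum := by
        obtain ⟨y, t', rfl⟩ := List.exists_cons_of_ne_nil ht'
        have := hpos' y List.mem_cons_self
        simp only [List.sum_cons]
        omega
      rw [List.sum_cons] at hn ⊢
      have h1 := below_split (n := n) (ψ := ψ) hψ hq hx hsum hn
      have h2 := ih ht' hpos' (pre := pre ++ [x]) (by
        simp only [List.sum_append, List.sum_cons, List.sum_nil] at hn ⊢
        omega)
      refine h1.trans ?_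
      simpa using h2

theorem below_flatMap (hψ : ψ ≠ 1) (hq : IsUnit (Fintype.card F : R)) {parts : ℕ → List ℕ}
    {L : List ℕ} (hL : ∀ a ∈ L, 0 < a ∧ (parts a).sum = a ∧ ∀ x ∈ parts a, 0 < x) {pre : List ℕ}
    (hn : (pre ++ L).sum ≤ n) : Below n ψ (pre ++ L) (pre ++ L.flatMap parts) := by
  induction L generalizing pre with
  | nil => simpa using Below.refl _
  | cons a L ih =>
    obtain ⟨h1, h2, h3⟩ := hL a List.mem_cons_self
    have h4 : parts a ≠ [] := by
      intro h
      rw [h] at h2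
      simp at h2
      omega
    have h5 := below_split_list (n := n) (ψ := ψ) hψ hq h4 h3 (pre := pre) (l := L) (by rwa [h2])
    rw [h2] at h5
    refine h5.trans ?_
    have h6 := ih (pre := pre ++ parts a) (fun x hx => hL x (List.mem_cons_of_mem _ hx)) (by
      simp only [List.sum_append, List.sum_cons] at hn ⊢
      omega)
    simpa using h6

theorem below_perm (hψ : ψ ≠ 1) (hq : IsUnit (Fintype.card F : R)) {l l' : List ℕ}
    (h : l.Perm l') (hpos : ∀ x ∈ l, 0 < x) {pre : List ℕ} (hn : (pre ++ l).sum ≤ n) :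
    Below n ψ (pre ++ l) (pre ++ l') := by
  induction h generalizing pre with
  | nil => exact Below.refl _
  | cons x _ ih =>
    have := ih (fun y hy => hpos y (List.mem_cons_of_mem _ hy)) (pre := pre ++ [x]) (by simpa using hn)
    simpa using this
  | swap x y l =>
    exact below_swap hψ hq (hpos x (by simp)) (hpos y (by simp)) hn
  | trans h1 h2 ih1 ih2 =>
    refine (ih1 hpos hn).trans (ih2 (fun x hx => hpos x (h1.mem_iff.2 hx)) ?_)
    rw [List.sum_append, ← h1.sum_eq, ← List.sum_append]
    exact hn

end Below

theorem isBd_flatMap {parts : ℕ → List ℕ} {L : List ℕ} (hL : ∀ a ∈ L, (parts a).sum = a) {k : ℕ}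
    (h : IsBd L k) : IsBd (L.flatMap parts) k := by
  induction L generalizing k with
  | nil => exact h
  | cons a L ih =>
    rcases h with rfl | ⟨j, hj, rfl⟩
    · exact isBd_zero _
    · rw [List.flatMap_cons, isBd_append, hL a List.mem_cons_self]
      exact Or.inr ⟨j, ih (fun x hx => hL x (List.mem_cons_of_mem _ hx)) hj, rfl⟩

/-! ### Valuations of `q`-integers and `q`-factorials -/

section Arith

/-- `1 + x + ⋯ + x ^ (k - 1)`. -/
def qInt (x k : ℕ) : ℕ := ∑ j ∈ Finset.range k, x ^ j

theorem qInt_add (x i j : ℕ) : qInt x (i + j) = qInt x i + x ^ i * qInt x j := by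
  simp only [qInt, Finset.sum_range_add, Finset.mul_sum, pow_add]

theorem qInt_mul (x e k : ℕ) : qInt x (e * k) = qInt x e * qInt (x ^ e) k := by
  induction k with
  | zero => simp [qInt]
  | succ k ih =>
    rw [mul_add, mul_one, qInt_add, ih, qInt_add (x ^ e) k 1, mul_add, ← pow_mul]
    simp only [qInt, Finset.sum_range_one, pow_zero, mul_one]
    ring

theorem qInt_pos {x k : ℕ} (hk : 0 < k) : 0 < qInt x k := by
  obtain ⟨k, rfl⟩ := Nat.exists_eq_succ_of_ne_zero hk.ne'
  rw [qInt, Finset.sum_range_succ']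
  simp

theorem qInt_eq_div {x : ℕ} (hx : 2 ≤ x) (k : ℕ) : (x ^ k - 1) / (x - 1) = qInt x k :=
  (Nat.geomSum_eq hx k).symm

theorem sub_one_mul_qInt {x : ℕ} (hx : 1 ≤ x) (k : ℕ) : (x - 1) * qInt x k = x ^ k - 1 := by
  obtain ⟨y, rfl⟩ := Nat.exists_eq_add_of_le hx
  have h := geom_sum_mul_add y k
  simp only [qInt, Nat.add_sub_cancel_left]
  rw [add_comm 1 y, ← h, mul_comm]
  simp

variable {ℓ : ℕ} [hl : Fact ℓ.Prime]

/-- Lifting the exponent for x^k − 1 = (x − 1)[k]_x. For ℓ = 2 and even k the formula involves x +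
1, whose valuation is 1 because 4 divides x − 1. -/
theorem padicValNat_qInt_of_dvd {x : ℕ} (hx : 1 < x) (h : ℓ ∣ x - 1) (h2 : ℓ = 2 → 4 ∣ x - 1)
    {k : ℕ} (hk : 0 < k) : padicValNat ℓ (qInt x k) = padicValNat ℓ k := by
  have hnd : ¬ ℓ ∣ x := by
    intro hd
    have h1 : ℓ ∣ 1 := by
      have := (Nat.dvd_sub hd h)
      rwa [show x - (x - 1) = 1 by omega] at this
    exact hl.out.one_lt.ne' (Nat.dvd_one.1 h1)
  have hmul : padicValNat ℓ (x ^ k - 1) = padicValNat ℓ (x - 1) + padicValNat ℓ (qInt x k) := by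
    rw [← sub_one_mul_qInt hx.le, padicValNat.mul (by omega) (qInt_pos hk).ne']
  rcases hl.out.eq_two_or_odd' with rfl | hodd
  · rcases Nat.even_or_odd k with hev | hodd
    · have h1 := padicValNat.pow_two_sub_one hx hnd hk.ne' hev
      have h3 : padicValNat 2 (x + 1) = 1 := by
        obtain ⟨y, hy⟩ := h2 rfl
        have hx' : x + 1 = 2 * (2 * y + 1) := by omega
        rw [hx', padicValNat.mul (by norm_num) (by omega), padicValNat_self,
          padicValNat.eq_zero_of_not_dvd (by omega)]
      omega
    · rw [padicValNat.eq_zero_of_not_dvd, padicValNat.eq_zero_of_not_dvd]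
      · rw [← even_iff_two_dvd, Nat.not_even_iff_odd]; exact hodd
      · obtain ⟨m, rfl⟩ := hodd
        rw [qInt_add, qInt_mul]
        have h4 : 2 ∣ qInt x 2 := by
          simp only [qInt, Finset.sum_range_succ, Finset.sum_range_zero, pow_zero, pow_one]
          omega
        have h5 : ¬ 2 ∣ x ^ (2 * m) * qInt x 1 := by
          simp only [qInt, Finset.sum_range_one, pow_zero, mul_one]
          exact fun hd => hnd (Nat.prime_two.dvd_of_dvd_pow hd)
        rw [Nat.dvd_add_right (h4.mul_right _)]
        exact h5
  · have h1 := padicValNat.pow_sub_pow hodd hx h hnd hk.ne'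
    rw [one_pow] at h1
    omega

/-- Division with remainder: modulo ℓ, [i]_q is a power of q times [i mod e]_q. No case distinction
on ℓ ∣ q − 1 is needed, although e is then not the order of q modulo ℓ. -/
theorem dvd_qInt_iff {q e : ℕ} (hq : ¬ ℓ ∣ q) (he : 0 < e) (hd : ℓ ∣ qInt q e)
    (hmin : ∀ i, 0 < i → i < e → ¬ ℓ ∣ qInt q i) (i : ℕ) : ℓ ∣ qInt q i ↔ e ∣ i := by
  constructor
  · intro h
    rw [← Nat.div_add_mod i e, qInt_add, qInt_mul, Nat.dvd_add_right (hd.mul_right _)] at h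
    have h1 := (hl.out.dvd_mul.1 h).resolve_left fun h' => hq (hl.out.dvd_of_dvd_pow h')
    by_contra hne
    exact hmin _ (Nat.pos_of_ne_zero fun h0 => hne (Nat.dvd_of_mod_eq_zero h0))
      (Nat.mod_lt _ he) h1
  · rintro ⟨k, rfl⟩
    rw [qInt_mul]
    exact hd.mul_right _

theorem padicValNat_qInt {q e : ℕ} (hq1 : 1 < q) (hq : ¬ ℓ ∣ q) (he : 0 < e) (hd : ℓ ∣ qInt q e)
    (hmin : ∀ i, 0 < i → i < e → ¬ ℓ ∣ qInt q i) {i : ℕ} (hi : 0 < i) :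
    padicValNat ℓ (qInt q i)
      = if e ∣ i then padicValNat ℓ (qInt q e) + padicValNat ℓ (i / e) else 0 := by
  split_ifs with h
  · obtain ⟨k, rfl⟩ := h
    have hk : 0 < k := Nat.pos_of_mul_pos_left hi
    have h1 : ℓ ∣ q ^ e - 1 := by
      rw [← sub_one_mul_qInt hq1.le]
      exact hd.mul_left _
    rw [qInt_mul, padicValNat.mul (qInt_pos he).ne' (qInt_pos hk).ne', Nat.mul_div_cancel_left _ he,
      padicValNat_qInt_of_dvd (Nat.one_lt_pow he.ne' hq1) h1 ?_ hk]
    -- For ℓ = 2 both factors of q^e − 1 = (q − 1)[e]_q are even.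
    rintro rfl
    rw [← sub_one_mul_qInt hq1.le]
    exact mul_dvd_mul (a := 2) (c := 2) (by omega : 2 ∣ q - 1) hd
  · exact padicValNat.eq_zero_of_not_dvd fun h' => h ((dvd_qInt_iff hq he hd hmin i).1 h')

theorem sum_padicValNat_qInt {q e : ℕ} (hq1 : 1 < q) (hq : ¬ ℓ ∣ q) (he : 0 < e)
    (hd : ℓ ∣ qInt q e) (hmin : ∀ i, 0 < i → i < e → ¬ ℓ ∣ qInt q i) (a : ℕ) :
    ∑ j ∈ Finset.range a, padicValNat ℓ (qInt q (j + 1))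
      = padicValNat ℓ (qInt q e) * (a / e) + padicValNat ℓ (a / e).factorial := by
  induction a with
  | zero => simp
  | succ a ih =>
    rw [Finset.sum_range_succ, ih, padicValNat_qInt hq1 hq he hd hmin (Nat.succ_pos a),
      Nat.succ_div]
    split_ifs with h
    · rw [Nat.factorial_succ, padicValNat.mul (Nat.succ_ne_zero _) (Nat.factorial_ne_zero _)]
      ring
    · simp

/-- Legendre's formula by digits, from ν(N!) = ⌊N/ℓ⌋ + ν(⌊N/ℓ⌋!). -/
theorem padicValNat_factorial_eq_sum (k N : ℕ) (h : N < ℓ ^ k) :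
    padicValNat ℓ N.factorial
      = ∑ i ∈ Finset.range k, N / ℓ ^ i % ℓ * ∑ j ∈ Finset.range i, ℓ ^ j := by
  induction k generalizing N with
  | zero => simp at h; simp [h]
  | succ k ih =>
    have h1 : N / ℓ < ℓ ^ k := by
      rw [Nat.div_lt_iff_lt_mul hl.out.pos]
      rwa [pow_succ] at h
    rw [← padicValNat_mul_div_factorial, padicValNat_factorial_mul, ih _ h1, Finset.sum_range_succ',
      ← sum_digit_mul_pow hl.out.one_lt k (N / ℓ) h1]
    simp only [Finset.range_zero, Finset.sum_empty, mul_zero, add_zero]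
    rw [sum_digit_mul_pow hl.out.one_lt k (N / ℓ) h1]
    nth_rw 2 [← sum_digit_mul_pow hl.out.one_lt k (N / ℓ) h1]
    rw [← Finset.sum_add_distrib]
    refine Finset.sum_congr rfl fun i _ => ?_
    rw [Finset.sum_range_succ, mul_add, Nat.div_div_eq_div_mul, pow_succ, mul_comm ℓ (ℓ ^ i)]

theorem sum_padicValNat_qInt_eq {q e : ℕ} (hq1 : 1 < q) (hq : ¬ ℓ ∣ q) (he : 0 < e)
    (hd : ℓ ∣ qInt q e) (hmin : ∀ i, 0 < i → i < e → ¬ ℓ ∣ qInt q i) {a n : ℕ} (ha : a ≤ n) :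
    ∑ j ∈ Finset.range a, padicValNat ℓ (qInt q (j + 1))
      = ∑ i ∈ Finset.range (mNum ℓ e n + 1),
        sNum ℓ (padicValNat ℓ (qInt q e)) i * digit ℓ e a i := by
  have h1 : a / e < ℓ ^ (mNum ℓ e n + 1) :=
    (Nat.div_le_div_right ha).trans_lt (Nat.lt_pow_succ_log_self hl.out.one_lt _)
  rw [sum_padicValNat_qInt hq1 hq he hd hmin, padicValNat_factorial_eq_sum _ _ h1]
  nth_rw 1 [← sum_digit_mul_pow hl.out.one_lt _ _ h1]
  rw [Finset.mul_sum, ← Finset.sum_add_distrib]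
  refine Finset.sum_congr rfl fun i _ => ?_
  rw [sNum, digit]
  ring

theorem eNum_spec {F : Type*} [Field F] [Fintype F] (p : ℕ) [Fact p.Prime] [CharP F p]
    (hpℓ : ℓ ≠ p) : ¬ ℓ ∣ Fintype.card F ∧ 2 ≤ eNum ℓ (Fintype.card F) ∧
      ℓ ∣ qInt (Fintype.card F) (eNum ℓ (Fintype.card F)) ∧
      ∀ i, 0 < i → i < eNum ℓ (Fintype.card F) → ¬ ℓ ∣ qInt (Fintype.card F) i := by
  have hq1 : 1 < Fintype.card F := Fintype.one_lt_card
  obtain ⟨k, hp, hk⟩ := FiniteField.card F p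
  refine ⟨fun h => ?_, ?_⟩
  · rw [hk] at h
    exact hpℓ ((Nat.prime_dvd_prime_iff_eq hl.out hp).1 (hl.out.dvd_of_dvd_pow h))
  have h0 := eNum_pos F p ℓ hpℓ
  have hne := Nat.nonempty_of_pos_sInf h0
  have hmem := Nat.sInf_mem hne
  rw [Set.mem_ofPred_eq, qInt_eq_div hq1] at hmem
  refine ⟨hmem.1, hmem.2, fun i hi hie hdvd => ?_⟩
  -- e is minimal among i ≥ 2 only; the remaining case i = 1 is harmless since [1]_q = 1.
  rcases Nat.lt_or_ge i 2 with h | h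
  · have : i = 1 := by omega
    subst this
    simp only [qInt, Finset.sum_range_one, pow_zero] at hdvd
    exact hl.out.one_lt.ne' (Nat.dvd_one.1 hdvd)
  · exact Nat.notMem_of_lt_sInf hie ⟨h, by rwa [qInt_eq_div hq1]⟩

end Arith

/-! ### Cardinalities of parabolic subgroups -/

section Card

variable {n : ℕ} {F : Type*} [Field F]

/-- The block upper triangular matrix with given diagonal blocks and given entries above them. -/
def blockMatrix {α : Type*} [LinearOrder α] (b : Fin n → α)
    (A : ∀ k : α, Matrix {i // b i = k} {i // b i = k} F)
    (f : {x : Fin n × Fin n // b x.1 < b x.2} → F) : Matrix (Fin n) (Fin n) F :=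
  Matrix.of fun i j => if h : b i = b j then A (b j) ⟨i, h⟩ ⟨j, rfl⟩
    else if h : b i < b j then f ⟨(i, j), h⟩ else 0

theorem blockTriangular_blockMatrix {α : Type*} [LinearOrder α] (b : Fin n → α)
    (A : ∀ k : α, Matrix {i // b i = k} {i // b i = k} F)
    (f : {x : Fin n × Fin n // b x.1 < b x.2} → F) :
    (blockMatrix b A f).BlockTriangular b := by
  intro i j hij
  rw [blockMatrix, of_apply, dif_neg hij.ne', dif_neg hij.not_gt]

theorem toSquareBlock_blockMatrix {α : Type*} [LinearOrder α] (b : Fin n → α)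
    (A : ∀ k : α, Matrix {i // b i = k} {i // b i = k} F)
    (f : {x : Fin n × Fin n // b x.1 < b x.2} → F) (k : α) :
    (blockMatrix b A f).toSquareBlock b k = A k := by
  ext ⟨i, hi⟩ ⟨j, hj⟩
  subst hj
  rw [toSquareBlock_def, of_apply, blockMatrix, of_apply, dif_pos hi]

/-- Coordinates on a group of invertible block triangular matrices. -/
noncomputable def blockSubgroupEquiv {α : Type*} [LinearOrder α] [Fintype α] (F : Type*) [Field F]
    (b : Fin n → α) :
    blockSubgroup F b ≃ (∀ k : α, GL {i // b i = k} F) ×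
      ({x : Fin n × Fin n // b x.1 < b x.2} → F) where
  toFun g := (fun k => GeneralLinearGroup.mkOfDetNeZero
      (((g : GL (Fin n) F) : Matrix (Fin n) (Fin n) F).toSquareBlock b k) (by
        have h1 : ((g : GL (Fin n) F) : Matrix (Fin n) (Fin n) F).det ≠ 0 :=
          ((isUnit_iff_isUnit_det _).1 (g : GL (Fin n) F).isUnit).ne_zero
        rw [BlockTriangular.det_fintype g.2] at h1
        exact Finset.prod_ne_zero_iff.1 h1 k (Finset.mem_univ _)),
    fun x => (g : GL (Fin n) F) x.1.1 x.1.2)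
  invFun y := ⟨GeneralLinearGroup.mkOfDetNeZero
      (blockMatrix b (fun k => (y.1 k).val) y.2) (by
        rw [BlockTriangular.det_fintype
          (blockTriangular_blockMatrix b (fun k => (y.1 k).val) y.2)]
        refine Finset.prod_ne_zero_iff.2 fun k _ => ?_
        rw [toSquareBlock_blockMatrix b (fun k => (y.1 k).val) y.2]
        exact ((isUnit_iff_isUnit_det _).1 (y.1 k).isUnit).ne_zero),
    by exact blockTriangular_blockMatrix b (fun k => (y.1 k).val) y.2⟩
  left_inv g := by
    apply Subtype.ext
    apply Units.ext
    ext i j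
    change (if h : b i = b j then (g : GL (Fin n) F) i j
      else if h : b i < b j then (g : GL (Fin n) F) i j else 0) = (g : GL (Fin n) F) i j
    split_ifs with h1 h2
    · rfl
    · rfl
    · exact (mem_blockSubgroup.1 g.2 i j (lt_of_le_of_ne (not_lt.1 h2) (Ne.symm h1))).symm
  right_inv y := by
    refine Prod.ext ?_ ?_
    · funext k
      apply Units.ext
      exact toSquareBlock_blockMatrix b (fun k => (y.1 k).val) y.2 k
    · funext ⟨⟨i, j⟩, hx⟩
      change blockMatrix b (fun k => (y.1 k).val) y.2 i j = _
      rw [blockMatrix, of_apply, dif_neg hx.ne, dif_pos hx]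

variable [Fintype F]

theorem card_GL_eq {ι : Type*} [Fintype ι] [DecidableEq ι] :
    Nat.card (GL ι F) = ∏ i ∈ Finset.range (Fintype.card ι),
      (Fintype.card F ^ Fintype.card ι - Fintype.card F ^ i) := by
  rw [Finset.prod_range, ← card_GL_field]
  exact Nat.card_congr
    (Units.mapEquiv (reindexAlgEquiv F F (Fintype.equivFin ι)).toMulEquiv).toEquiv

theorem card_blockSubgroup {α : Type*} [LinearOrder α] [Fintype α] (b : Fin n → α) :
    ∃ N, Nat.card (blockSubgroup F b)
      = (∏ k : α, Nat.card (GL {i // b i = k} F)) * Fintype.card F ^ N := by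
  classical
  refine ⟨Nat.card {x : Fin n × Fin n // b x.1 < b x.2}, ?_⟩
  rw [Nat.card_congr (blockSubgroupEquiv F b), Nat.card_prod, Nat.card_pi, Nat.card_fun,
    Nat.card_eq_fintype_card (α := F)]

variable {ℓ : ℕ} [hl : Fact ℓ.Prime]

/-- Up to a power of q, which ℓ does not divide, |GL_a(q)| = (q − 1)^a [1]_q⋯[a]_q. -/
theorem padicValNat_card_GL {ι : Type*} [Fintype ι] [DecidableEq ι] (hq : ¬ ℓ ∣ Fintype.card F) :
    padicValNat ℓ (Nat.card (GL ι F)) = Fintype.card ι * padicValNat ℓ (Fintype.card F - 1)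
      + ∑ j ∈ Finset.range (Fintype.card ι), padicValNat ℓ (qInt (Fintype.card F) (j + 1)) := by
  have hq1 : 1 < Fintype.card F := Fintype.one_lt_card
  set q := Fintype.card F
  set a := Fintype.card ι
  have h1 : ∀ i ∈ Finset.range a, q ^ a - q ^ i = q ^ i * ((q - 1) * qInt q (a - 1 - i + 1)) := by
    intro i hi
    rw [Finset.mem_range] at hi
    rw [sub_one_mul_qInt hq1.le, Nat.mul_sub, mul_one, ← pow_add]
    congr 2
    omega
  rw [card_GL_eq, Finset.prod_congr rfl h1]
  have h2 : ∀ s : Finset ℕ, padicValNat ℓ (∏ i ∈ s, q ^ i * ((q - 1) * qInt q (a - 1 - i + 1)))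
      = ∑ i ∈ s, (padicValNat ℓ (q - 1) + padicValNat ℓ (qInt q (a - 1 - i + 1))) := by
    intro s
    have hpos : ∀ i, 0 < qInt q (a - 1 - i + 1) := fun i => qInt_pos (Nat.succ_pos _)
    induction s using Finset.induction_on with
    | empty => simp
    | insert i s hi ih =>
      have hne : ∏ i ∈ s, q ^ i * ((q - 1) * qInt q (a - 1 - i + 1)) ≠ 0 :=
        Finset.prod_ne_zero_iff.2 fun j _ => mul_ne_zero (by positivity)
          (mul_ne_zero (by omega) (hpos j).ne')
      rw [Finset.prod_insert hi, Finset.sum_insert hi, padicValNat.mul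
        (mul_ne_zero (by positivity) (mul_ne_zero (by omega) (hpos i).ne')) hne, ih,
        padicValNat.mul (by positivity) (mul_ne_zero (by omega) (hpos i).ne'),
        padicValNat.mul (by omega) (hpos i).ne',
        padicValNat.eq_zero_of_not_dvd fun h => hq (hl.out.dvd_of_dvd_pow h), zero_add]
  rw [h2, Finset.sum_add_distrib, Finset.sum_const, Finset.card_range, smul_eq_mul,
    Finset.sum_range_reflect (fun i => padicValNat ℓ (qInt q (i + 1)))]

theorem padicValNat_card_blockSubgroup {α : Type*} [LinearOrder α] [Fintype α]
    (hq : ¬ ℓ ∣ Fintype.card F) (b : Fin n → α) :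
    padicValNat ℓ (Nat.card (blockSubgroup F b)) = n * padicValNat ℓ (Fintype.card F - 1)
      + ∑ k : α, ∑ j ∈ Finset.range (Fintype.card {i // b i = k}),
          padicValNat ℓ (qInt (Fintype.card F) (j + 1)) := by
  classical
  obtain ⟨N, hN⟩ := card_blockSubgroup (F := F) b
  have hne : ∀ k : α, Nat.card (GL {i // b i = k} F) ≠ 0 := fun k => Nat.card_pos.ne'
  have h1 : ∀ s : Finset α, padicValNat ℓ (∏ k ∈ s, Nat.card (GL {i // b i = k} F))
      = ∑ k ∈ s, padicValNat ℓ (Nat.card (GL {i // b i = k} F)) := by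
    intro s
    induction s using Finset.induction_on with
    | empty => simp
    | insert i s hi ih =>
      rw [Finset.prod_insert hi, Finset.sum_insert hi, padicValNat.mul (hne i)
        (Finset.prod_ne_zero_iff.2 fun k _ => hne k), ih]
  have h2 : ∑ k : α, Fintype.card {i // b i = k} = n := by
    rw [← Fintype.card_sigma, Fintype.card_congr (Equiv.sigmaFiberEquiv b), Fintype.card_fin]
  rw [hN, padicValNat.mul (Finset.prod_ne_zero_iff.2 fun k _ => hne k)
    (pow_ne_zero _ Fintype.card_ne_zero),
    padicValNat.eq_zero_of_not_dvd fun h => hq (hl.out.dvd_of_dvd_pow h), add_zero, h1]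
  simp only [padicValNat_card_GL hq]
  rw [Finset.sum_add_distrib, ← Finset.sum_mul, h2]

theorem padicValNat_card_borelB (hq : ¬ ℓ ∣ Fintype.card F) :
    padicValNat ℓ (Nat.card (borelB n F)) = n * padicValNat ℓ (Fintype.card F - 1) := by
  rw [borelB, padicValNat_card_blockSubgroup hq]
  simp [qInt]

/-- The factors q − 1 in |P| and |B| cancel, leaving one q-factorial for each part. -/
theorem padicValNat_relIndex (hq : ¬ ℓ ∣ Fintype.card F) (P : Composition n) :
    padicValNat ℓ ((borelB n F).relIndex (parabolic F P))
      = (P.blocks.map fun a =>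
        ∑ j ∈ Finset.range a, padicValNat ℓ (qInt (Fintype.card F) (j + 1))).sum := by
  classical
  have hle : borelB n F ≤ parabolic F P := borelB_le_blockSubgroup (index_mono P)
  have h1 : (borelB n F).relIndex (parabolic F P) * Nat.card (borelB n F)
      = Nat.card (parabolic F P) := by
    rw [Subgroup.relIndex, ← Nat.card_congr (Subgroup.subgroupOfEquivOfLe hle).toEquiv]
    exact Subgroup.index_mul_card _
  have hpos : 0 < Nat.card (parabolic F P) := Nat.card_pos
  have hne : (borelB n F).relIndex (parabolic F P) ≠ 0 := by
    intro h; rw [h, zero_mul] at h1; omega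
  have h2 := congrArg (padicValNat ℓ) h1
  rw [padicValNat.mul hne Nat.card_pos.ne', padicValNat_card_borelB hq, parabolic,
    padicValNat_card_blockSubgroup hq, add_comm] at h2
  have h3 := Nat.add_left_cancel h2
  rw [parabolic, h3]
  have hfib : ∀ k : Fin P.length, Fintype.card {i : Fin n // P.index i = k} = P.blocksFun k := by
    intro k
    have e : Fin (P.blocksFun k) ≃ {i : Fin n // P.index i = k} :=
      (Equiv.ofInjective _ (P.embedding k).injective).trans (Equiv.subtypeEquivRight fun j => by
        rw [eq_comm]; exact P.mem_range_embedding_iff')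
    rw [← Fintype.card_congr e, Fintype.card_fin]
  simp only [hfib]
  rw [← P.ofFn_blocksFun, List.map_ofFn, List.sum_ofFn]
  rfl

theorem padicValNat_index_eq {P Q : Composition n}
    (h : padicValNat ℓ ((borelB n F).relIndex (parabolic F P))
      = padicValNat ℓ ((borelB n F).relIndex (parabolic F Q))) :
    padicValNat ℓ (parabolic F P).index = padicValNat ℓ (parabolic F Q).index := by
  have key : ∀ P : Composition n, padicValNat ℓ (borelB n F).index
      = padicValNat ℓ ((borelB n F).relIndex (parabolic F P))
        + padicValNat ℓ (parabolic F P).index := by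
    intro P
    have hle : borelB n F ≤ parabolic F P := borelB_le_blockSubgroup (index_mono P)
    have h1 := Subgroup.relIndex_mul_index hle
    have h2 : (borelB n F).index ≠ 0 := Subgroup.index_ne_zero_of_finite
    rw [← h1] at h2 ⊢
    exact padicValNat.mul (left_ne_zero_of_mul h2) (right_ne_zero_of_mul h2)
  have h1 := key P
  have h2 := key Q
  omega

end Card

/-! ### The refinement of a composition by digits -/

section Parts

/-- The block sizes of `P*` for the one-part composition `P = (a)`. -/
def digitParts (ℓ e n a : ℕ) : List ℕ :=
  List.replicate (a % e) 1 ++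
    (List.range (mNum ℓ e n + 1)).flatMap fun i => List.replicate (digit ℓ e a i) (e * ℓ ^ i)

theorem sum_list_range (f : ℕ → ℕ) (k : ℕ) :
    ((List.range k).map f).sum = ∑ i ∈ Finset.range k, f i := by
  induction k with
  | zero => simp
  | succ k ih => simp [List.range_succ, Finset.sum_range_succ, ih]

theorem sum_map_replicate_append_flatMap (W : ℕ → ℕ) (r x k : ℕ) (f g : ℕ → ℕ) :
    ((List.replicate r x ++ (List.range k).flatMap fun i => List.replicate (f i) (g i)).map W).sum
      = r * W x + ∑ i ∈ Finset.range k, f i * W (g i) := by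
  rw [List.map_append, List.sum_append, List.map_flatMap, ← sum_list_range, List.flatMap,
    List.sum_flatten, List.map_map]
  simp [Function.comp_def]

theorem digitParts_sum {ℓ e n a : ℕ} (hℓ : 1 < ℓ) (ha : a ≤ n) : (digitParts ℓ e n a).sum = a := by
  have h := sum_map_replicate_append_flatMap id (a % e) 1 (mNum ℓ e n + 1) (digit ℓ e a)
    fun i => e * ℓ ^ i
  simp only [List.map_id, id, mul_one] at h
  exact h.trans (sum_digits hℓ ha)

theorem digitParts_pos {ℓ e n a x : ℕ} (hℓ : 0 < ℓ) (he : 0 < e) (hx : x ∈ digitParts ℓ e n a) :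
    0 < x := by
  simp only [digitParts, List.mem_append, List.mem_replicate, List.mem_flatMap] at hx
  rcases hx with ⟨-, rfl⟩ | ⟨j, -, -, rfl⟩
  · exact one_pos
  · positivity

/-- Refining each part by its digits and collecting equal sizes gives P*; this links P to P* through
a subgroup of P. -/
theorem flatMap_digitParts_perm (ℓ e : ℕ) {n : ℕ} (P : Composition n) :
    (P.blocks.flatMap (digitParts ℓ e n)).Perm (starBlocks ℓ e P) := by
  unfold starBlocks zRem zNum
  induction P.blocks with
  | nil => simp
  | cons a L ih =>
    simp only [List.flatMap_cons, List.map_cons, List.sum_cons, List.replicate_add]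
    refine (ih.append_left _).trans ?_
    unfold digitParts
    rw [List.append_assoc, List.append_assoc]
    refine List.Perm.append_left _ ?_
    rw [← List.append_assoc]
    refine (List.perm_append_comm.append_right _).trans ?_
    rw [List.append_assoc]
    exact List.Perm.append_left _ (List.flatMap_append_perm _ _ _)

variable {ℓ : ℕ} [hl : Fact ℓ.Prime]

theorem padicValNat_factorial_pow (i : ℕ) :
    padicValNat ℓ (ℓ ^ i).factorial = ∑ j ∈ Finset.range i, ℓ ^ j := by
  rw [padicValNat_factorial_eq_sum (i + 1) _ (Nat.pow_lt_pow_right hl.out.one_lt (Nat.lt_succ_self i)),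
    Finset.sum_range_succ, Nat.div_self (pow_pos hl.out.pos i), Nat.mod_eq_of_lt hl.out.one_lt,
    one_mul, Finset.sum_eq_zero, zero_add]
  intro j hj
  rw [Finset.mem_range] at hj
  rw [Nat.pow_div hj.le hl.out.pos, Nat.mod_eq_zero_of_dvd (dvd_pow_self _ (by omega)), zero_mul]

theorem sum_padicValNat_qInt_mul_pow {q e : ℕ} (hq1 : 1 < q) (hq : ¬ ℓ ∣ q) (he : 0 < e)
    (hd : ℓ ∣ qInt q e) (hmin : ∀ i, 0 < i → i < e → ¬ ℓ ∣ qInt q i) (i : ℕ) :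
    ∑ j ∈ Finset.range (e * ℓ ^ i), padicValNat ℓ (qInt q (j + 1))
      = sNum ℓ (padicValNat ℓ (qInt q e)) i := by
  rw [sum_padicValNat_qInt hq1 hq he hd hmin, Nat.mul_div_cancel_left _ he,
    padicValNat_factorial_pow, sNum, mul_comm]

variable {n : ℕ} {F : Type*} [Field F] [Fintype F] (p : ℕ) [Fact p.Prime] [CharP F p]

theorem padicValNat_relIndex_eq_sum (hpℓ : ℓ ≠ p) (P : Composition n) :
    padicValNat ℓ ((borelB n F).relIndex (parabolic F P))
      = ∑ i ∈ Finset.range (mNum ℓ (eNum ℓ (Fintype.card F)) n + 1),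
        sNum ℓ (dNum ℓ (Fintype.card F)) i * zNum ℓ (eNum ℓ (Fintype.card F)) P i := by
  obtain ⟨hq, he, hd, hmin⟩ := eNum_spec (F := F) p hpℓ
  have hq1 : 1 < Fintype.card F := Fintype.one_lt_card
  rw [padicValNat_relIndex hq, dNum, qInt_eq_div hq1]
  have h1 := fun a (ha : a ∈ P.blocks) =>
    sum_padicValNat_qInt_eq hq1 hq (by omega) hd hmin (P.blocks_le ha)
  rw [List.map_congr_left h1]
  unfold zNum
  clear h1
  induction P.blocks with
  | nil => simp
  | cons a L ih => simp only [List.map_cons, List.sum_cons, mul_add, Finset.sum_add_distrib, ih]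

theorem padicValNat_relIndex_starComp (hpℓ : ℓ ≠ p) (P : Composition n) :
    padicValNat ℓ ((borelB n F).relIndex (parabolic F (starComp F p ℓ hpℓ P)))
      = ∑ i ∈ Finset.range (mNum ℓ (eNum ℓ (Fintype.card F)) n + 1),
        sNum ℓ (dNum ℓ (Fintype.card F)) i * zNum ℓ (eNum ℓ (Fintype.card F)) P i := by
  obtain ⟨hq, he, hd, hmin⟩ := eNum_spec (F := F) p hpℓ
  have hq1 : 1 < Fintype.card F := Fintype.one_lt_card
  rw [padicValNat_relIndex hq, dNum, qInt_eq_div hq1]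
  change ((starBlocks ℓ (eNum ℓ (Fintype.card F)) P).map _).sum = _
  rw [starBlocks, sum_map_replicate_append_flatMap]
  have h1 : ∑ j ∈ Finset.range 1, padicValNat ℓ (qInt (Fintype.card F) (j + 1)) = 0 := by
    simp [qInt]
  rw [h1, mul_zero, zero_add]
  refine Finset.sum_congr rfl fun i _ => ?_
  rw [sum_padicValNat_qInt_mul_pow hq1 hq (by omega) hd hmin, mul_comm]

end Parts

/-! ### Units of the coefficient ring -/

section Units

variable {R : Type*} [CommRing R] [IsLocalRing R] {ℓ : ℕ} [hl : Fact ℓ.Prime]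

theorem isUnit_natCast_of_not_dvd (hR : (ℓ : R) ∈ IsLocalRing.maximalIdeal R) {a : ℕ}
    (ha : ¬ ℓ ∣ a) : IsUnit (a : R) := by
  by_contra h
  have h1 : IsCoprime (a : ℤ) (ℓ : ℤ) :=
    Nat.isCoprime_iff_coprime.2 ((Nat.Prime.coprime_iff_not_dvd hl.out).2 ha).symm
  obtain ⟨x, y, hxy⟩ := h1.map (Int.castRingHom R)
  simp only [eq_intCast, Int.cast_natCast] at hxy
  have h2 : (1 : R) ∈ IsLocalRing.maximalIdeal R := by
    rw [← hxy]
    exact add_mem (Ideal.mul_mem_left _ _ ((IsLocalRing.mem_maximalIdeal _).2 h))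
      (Ideal.mul_mem_left _ _ hR)
  exact (IsLocalRing.mem_maximalIdeal _).1 h2 isUnit_one

/-- After cancelling the common power of ℓ, both integers are prime to ℓ and hence units of R. -/
theorem isUnit_of_mul_natCast_eq [IsDomain R] [CharZero R]
    (hR : (ℓ : R) ∈ IsLocalRing.maximalIdeal R) {a b : ℕ} (ha : a ≠ 0) (hb : b ≠ 0)
    (hab : padicValNat ℓ a = padicValNat ℓ b) {r : R} (h : r * (a : R) = b) : IsUnit r := by
  obtain ⟨k, a', ha', rfl⟩ := Nat.exists_eq_pow_mul_and_not_dvd ha ℓ hl.out.ne_one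
  obtain ⟨j, b', hb', rfl⟩ := Nat.exists_eq_pow_mul_and_not_dvd hb ℓ hl.out.ne_one
  rw [padicValNat.mul (left_ne_zero_of_mul ha) (right_ne_zero_of_mul ha),
    padicValNat.mul (left_ne_zero_of_mul hb) (right_ne_zero_of_mul hb), padicValNat.prime_pow,
    padicValNat.prime_pow, padicValNat.eq_zero_of_not_dvd ha', padicValNat.eq_zero_of_not_dvd hb',
    add_zero, add_zero] at hab
  subst hab
  have h1 : (ℓ : R) ^ k ≠ 0 := pow_ne_zero _ (Nat.cast_ne_zero.2 hl.out.ne_zero)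
  push_cast at h
  have h2 : r * (a' : R) = b' := mul_left_cancel₀ h1 (by rw [← h]; ring)
  exact isUnit_of_mul_isUnit_left (h2 ▸ isUnit_natCast_of_not_dvd hR hb')

end Units

/-! ### The modules `N(P)` -/

section Modules

variable {n : ℕ} {F : Type*} [Field F] [Fintype F] {R : Type*} [CommRing R]

theorem reduce_span_singleton (ℓ : ℕ) {x : RG n F R} (hx : x ∈ latI n F R) :
    reduce n F R ℓ (Submodule.span (RG n F R) {x})
      = Submodule.span (RG n F R) {(ellI n F R ℓ).mkQ ⟨x, hx⟩} := by
  have h : (Submodule.span (RG n F R) {x}).submoduleOf (latI n F R)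
      = Submodule.span (RG n F R) {⟨x, hx⟩} := by
    ext y
    change (y : RG n F R) ∈ Submodule.span (RG n F R) {x} ↔ _
    rw [Submodule.mem_span_singleton, Submodule.mem_span_singleton]
    simp only [Subtype.ext_iff, Submodule.coe_smul]
  rw [reduce, h, Submodule.map_span, Set.image_singleton]

theorem formVal_eq_index {c : Fin n → F} {P : Composition n} (hc : GenFor P.blocks c) :
    formVal F c = (parabolic F P).index :=
  (index_blockSubgroup (index_mono P) fun i j hij =>
    (hc i j hij).trans (index_eq_iff P hij).symm).symm

variable [IsDomain R] {ψ : AddChar F R}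

theorem charE_mem_latIc (hψ : ψ ≠ 1) {ℓ k : ℕ} {c : Fin n → F} (h : ℓ ^ k ∣ formVal F c) :
    charE (supChar ψ c) ∈ latIc n F R ℓ k := by
  refine ⟨charE_mem _, fun y hy => ?_⟩
  obtain ⟨r, hr⟩ := exists_canForm_charE_eq (supChar ψ c) hy
  rw [hr, canForm_supChar hψ]
  refine Dvd.dvd.mul_left (mul_dvd_mul_left _ ?_) r
  exact_mod_cast Nat.cast_dvd_cast (α := R) h

variable [CharZero R]

/-- All χ with P(χ) = P have the same support, so their eigenvectors are conjugate under diagonal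
matrices. -/
theorem span_charE_eq_latI' (hψ : ψ ≠ 1) {P : Composition n} {c : Fin n → F}
    (hc : GenFor P.blocks c) :
    Submodule.span (RG n F R) {charE (supChar ψ c)} = latI' F R P := by
  refine le_antisymm ?_ (Submodule.span_le.2 ?_)
  · rw [Submodule.span_singleton_le_iff_mem]
    exact Submodule.subset_span ⟨_, (charP_eq_parabolic_iff hψ c P).2 hc, rfl⟩
  · rintro _ ⟨χ, hχ, rfl⟩
    obtain ⟨c', rfl⟩ := eq_supChar hψ χ
    have hc' := (charP_eq_parabolic_iff hψ c' P).1 hχ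
    exact charE_mem_span_of_support_eq ψ fun i j hij =>
      not_iff_not.1 ((hc i j hij).trans (hc' i j hij).symm)

theorem facN_eq_span (hψ : ψ ≠ 1) {P : Composition n} {c : Fin n → F} (hc : GenFor P.blocks c)
    (ℓ k : ℕ) : facN F R ℓ k P = charN ℓ k (supChar ψ c) := by
  rw [facN, redL', ← span_charE_eq_latI' hψ hc, reduce_span_singleton ℓ (charE_mem _),
    Submodule.map_span, Set.image_singleton]
  rfl

theorem facN_le_facM (hψ : ψ ≠ 1) {ℓ k : ℕ} {P : Composition n}
    (h : ℓ ^ k ∣ (parabolic F P).index) : facN F R ℓ k P ≤ facM n F R ℓ k := by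
  obtain ⟨c, hc⟩ := exists_genFor n F P.blocks
  rw [facN, redL', ← span_charE_eq_latI' hψ hc, facM, redLc]
  refine Submodule.map_mono (Submodule.map_mono fun x hx => ?_)
  have h1 : charE (supChar ψ c) ∈ latIc n F R ℓ k :=
    charE_mem_latIc hψ (by rwa [formVal_eq_index hc])
  exact (Submodule.span_singleton_le_iff_mem _ _).2 h1 hx

theorem latI'_eq_of_below (hψ : ψ ≠ 1) (hq : IsUnit (Fintype.card F : R)) {P Q : Composition n}
    (h : Below n ψ P.blocks Q.blocks)
    (hval : ∀ r : R, r * ((parabolic F P).index : R) = ((parabolic F Q).index : R) → IsUnit r) :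
    latI' F R P = latI' F R Q := by
  obtain ⟨c, hc⟩ := exists_genFor n F P.blocks
  obtain ⟨c', hc', h1⟩ := h c hc
  have h2 := charE_mem_span_symm hψ hq h1 (by rwa [formVal_eq_index hc, formVal_eq_index hc'])
  rw [← span_charE_eq_latI' hψ hc, ← span_charE_eq_latI' hψ hc']
  exact le_antisymm ((Submodule.span_singleton_le_iff_mem _ _).2 h2)
    ((Submodule.span_singleton_le_iff_mem _ _).2 h1)

end Modules

end SteinbergGL

open SteinbergGL

/-! ### Assembly of the theorem -/

theorem mainTheorem2
    {F : Type*} [Field F] [Fintype F] (p : ℕ) [Fact p.Prime] [CharP F p]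
    (ℓ : ℕ) [Fact ℓ.Prime] (hpℓ : ℓ ≠ p)
    {R : Type*} [CommRing R] [IsDomain R] [IsPrincipalIdealRing R] [IsLocalRing R] [CharZero R]
    (hR : IsLocalRing.maximalIdeal R = Ideal.span {(ℓ : R)})
    (hζ : ∃ ζ : R, IsPrimitiveRoot ζ p)
    (n : ℕ) (hn : 2 ≤ n) (P : Composition n) :
    let q := Fintype.card F
    let e := eNum ℓ q
    let d := dNum ℓ q
    let m := mNum ℓ e n
    let Pstar : Composition n := starComp F p ℓ hpℓ P
    let c := padicValNat ℓ (parabolic F P).index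
    -- `P*` is equivalent to a standard parabolic subgroup `Q` contained in `P`
    (∃ Q : Composition n, Q.blocks.Perm Pstar.blocks ∧ parabolic F Q ≤ parabolic F P) ∧
    -- `ν_ℓ [P : B] = s_0 z_0 + ⋯ + s_m z_m = ν_ℓ [P* : B]`
    padicValNat ℓ ((borelB n F).relIndex (parabolic F P))
      = ∑ i ∈ Finset.range (m + 1), sNum ℓ d i * zNum ℓ e P i ∧
    padicValNat ℓ ((borelB n F).relIndex (parabolic F Pstar))
      = ∑ i ∈ Finset.range (m + 1), sNum ℓ d i * zNum ℓ e P i ∧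
    -- `N(P)` is well defined: it is `N(χ)` for every one of the linear characters `χ` of `U`
    -- with `P(χ) = P`, there are such `χ`, and it is a submodule of `M(c)`
    (∃ χ : unitri n F →* Rˣ, charP χ = parabolic F P) ∧
    (∀ χ : unitri n F →* Rˣ, charP χ = parabolic F P → charN ℓ c χ = facN F R ℓ c P) ∧
    facN F R ℓ c P ≤ facM n F R ℓ c ∧
    -- `N(P) = N(P*)`, as submodules of the same factor `M(c)`
    padicValNat ℓ (parabolic F Pstar).index = c ∧
    facN F R ℓ c P = facN F R ℓ c Pstar := by
  intro q e d m Pstar c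
  obtain ⟨hq, -⟩ := eNum_spec (F := F) p hpℓ
  have hl : ℓ.Prime := Fact.out
  have hℓR : (ℓ : R) ∈ IsLocalRing.maximalIdeal R := hR ▸ Ideal.mem_span_singleton_self _
  have hqR : IsUnit (Fintype.card F : R) := isUnit_natCast_of_not_dvd hℓR hq
  obtain ⟨ψ, hψ⟩ := exists_nontrivial_addChar (F := F) p hζ
  have hparts : ∀ a ∈ P.blocks, 0 < a ∧ (digitParts ℓ e n a).sum = a ∧
      ∀ x ∈ digitParts ℓ e n a, 0 < x := fun a ha =>
    ⟨P.blocks_pos ha, digitParts_sum hl.one_lt (P.blocks_le ha),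
      fun x => digitParts_pos hl.pos (eNum_pos F p ℓ hpℓ)⟩
  have hperm : (P.blocks.flatMap (digitParts ℓ e n)).Perm Pstar.blocks :=
    flatMap_digitParts_perm ℓ e P
  -- Q refines P part by part and rearranges to P*; it is the witness for the containment and the
  -- intermediate stage of `hbelow`.
  let Q : Composition n :=
    { blocks := P.blocks.flatMap (digitParts ℓ e n)
      blocks_pos := fun hx => Pstar.blocks_pos (hperm.mem_iff.1 hx)
      blocks_sum := hperm.sum_eq.trans Pstar.blocks_sum }
  have hbelow : Below n ψ P.blocks Pstar.blocks :=
    (below_flatMap (pre := []) hψ hqR hparts P.blocks_sum.le).trans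
      (below_perm (pre := []) hψ hqR hperm (fun x hx => Q.blocks_pos hx) Q.blocks_sum.le)
  have hP := padicValNat_relIndex_eq_sum (F := F) p hpℓ P
  have hPstar := padicValNat_relIndex_starComp (F := F) p hpℓ P
  have hval : padicValNat ℓ (parabolic F Pstar).index = c :=
    padicValNat_index_eq (hPstar.trans hP.symm)
  refine ⟨⟨Q, hperm, parabolic_le_of_isBd fun k =>
    isBd_flatMap fun a ha => (hparts a ha).2.1⟩, hP, hPstar, ?_, ?_, ?_, hval, ?_⟩
  · obtain ⟨v, hv⟩ := exists_genFor n F P.blocks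
    exact ⟨supChar ψ v, (charP_eq_parabolic_iff hψ v P).2 hv⟩
  · intro χ hχ
    obtain ⟨v, rfl⟩ := eq_supChar hψ χ
    exact (facN_eq_span hψ ((charP_eq_parabolic_iff hψ v P).1 hχ) ℓ c).symm
  · exact facN_le_facM hψ pow_padicValNat_dvd
  -- The equality already holds in I, before reduction modulo ℓ.
  · have h := latI'_eq_of_below (R := R) hψ hqR hbelow fun r =>
      isUnit_of_mul_natCast_eq hℓR Subgroup.index_ne_zero_of_finite
        Subgroup.index_ne_zero_of_finite hval.symm
    rw [facN, facN, redL', redL', h]
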